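/- A point $(i,\pi(i))$ of a permutation $\pi$ of $\{1,\dots,m\}$ is *external* if it is a left-to-right maximum, a left-to-right minimum, a right-to-left maximum or a right-to-left minimum of $\pi$; otherwise it is *internal*. For $n,k\ge 0$ let $ASq(Av_n(321),k)$ be the set of permutations of size $n+k$ with exactly $n$ external and $k$ internal points whose external points induce a $321$-avoiding permutation of size $n$, and let $$F_k(t)=\sum_{n\ge 0}\bigl|ASq(Av_n(321),k)\bigr|\,t^n\in\mathbb{Q}[[t]].$$ Let $C(t)=\frac{1-\sqrt{1-4t}}{2t}=\sum_{n\ge0}\frac{1}{n+1}\binom{2n}{n}t^n$ be the Catalan generating function. **Theorem.** For every $k\ge 0$, the series $F_k(t)$ is algebraic of degree $2$ over $\mathbb{Q}(t)$, and there is a rational function $R^{(k)}(u)\in\mathbb{Q}(u)$ such that $$F_k(t)=R^{(k)}(C(t)).$$ Moreover, for $k=1,2,3$, $$R^{(k)}(u)=\frac{(u-1)^4}{(u^2+1-u)^{2k}\,(u-2)^{3k-1}}\,P^{(k)}(u),$$ where $P^{(1)},P^{(2)},P^{(3)}$ are the following polynomials, written with $s=u-1$: $$P^{(1)}(u)=9+14s+12s^2+4s^3-s^4-2s^5,$$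 $$\begin{aligned}P^{(2)}(u)=-\bigl(&18+130s+412s^2+683s^3+823s^4+643s^5+307s^6+67s^7+13s^8\\&+57s^9+71s^{10}+35s^{11}-3s^{12}-11s^{13}-5s^{14}\bigr),\end{aligned}$$ $$\begin{aligned}P^{(3)}(u)={}&54+744s+4570s^2+16088s^3+38435s^4+69472s^5+98842s^6+113452s^7\\&+109007s^8+90876s^9+68286s^{10}+47508s^{11}+29222s^{12}+13476s^{13}+2401s^{14}\\&-2262s^{15}-1881s^{16}+26s^{17}+928s^{18}+646s^{19}+123s^{20}-90s^{21}-67s^{22}-16s^{23}.\end{aligned}$$ -/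

import Mathlib

namespace AlmostSquare

open scoped LaurentSeries RatFunc

section Permutations

variable {m n : ℕ}

/-- `i` is the position of a left-to-right maximum of `π`. -/
def IsLRMax (π : Equiv.Perm (Fin m)) (i : Fin m) : Prop := ∀ j, j < i → π j < π i

/-- `i` is the position of a left-to-right minimum of `π`. -/
def IsLRMin (π : Equiv.Perm (Fin m)) (i : Fin m) : Prop := ∀ j, j < i → π i < π j

/-- `i` is the position of a right-to-left maximum of `π`. -/
def IsRLMax (π : Equiv.Perm (Fin m)) (i : Fin m) : Prop := ∀ j, i < j → π j < π i

/-- `i` is the position of a right-to-left minimum of `π`. -/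
def IsRLMin (π : Equiv.Perm (Fin m)) (i : Fin m) : Prop := ∀ j, i < j → π i < π j

/-- The point `(i, π i)` is external: it is a record, that is, a maximum or a minimum, from the
left or from the right. The other points are the internal points. -/
def IsExternal (π : Equiv.Perm (Fin m)) (i : Fin m) : Prop :=
  IsLRMax π i ∨ IsLRMin π i ∨ IsRLMax π i ∨ IsRLMin π i

/-- The points of `π` at the positions in `S` induce the pattern `ω`: there are exactly `n` of
them, and they have the same relative order as `ω`. -/
def Induces (π : Equiv.Perm (Fin m)) (S : Set (Fin m)) (ω : Equiv.Perm (Fin n)) : Prop :=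
  ∃ e : Fin n ↪o Fin m, Set.range e = S ∧ ∀ a b, π (e a) < π (e b) ↔ ω a < ω b

/-- `π` avoids the pattern `ω`. -/
def Avoids (π : Equiv.Perm (Fin m)) (ω : Equiv.Perm (Fin n)) : Prop :=
  ∀ S : Set (Fin m), ¬ Induces π S ω

/-- The permutation `321`. -/
def perm321 : Equiv.Perm (Fin 3) := Fin.revPerm

/-- The permutations of size `n + k` with exactly `n` external points (hence exactly `k` internal
points) whose external points induce a `321`-avoiding permutation of size `n`. -/
def ASqAv321 (n k : ℕ) : Set (Equiv.Perm (Fin (n + k))) :=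
  {π | ∃ σ : Equiv.Perm (Fin n), Avoids σ perm321 ∧ Induces π {i | IsExternal π i} σ}

end Permutations

/-- The generating function `∑ₙ |ASqAv321 n k| tⁿ`. -/
noncomputable def genFun (k : ℕ) : PowerSeries ℚ :=
  PowerSeries.mk fun n => (Nat.card (ASqAv321 n k) : ℚ)

/-- The Catalan generating function `C(t) = ∑ₙ cₙ tⁿ`, with rational coefficients. -/
noncomputable def catalanGF : PowerSeries ℚ :=
  PowerSeries.map (Nat.castRingHom ℚ) PowerSeries.catalanSeries

/-- `C(t) = (1 - √(1 - 4t)) / (2t)`: the series `1 - 2 t C(t)` is the square root of `1 - 4t`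
with constant term `1`. -/
theorem catalanGF_closed_form :
    (1 - 2 * PowerSeries.X * catalanGF) ^ 2 = 1 - 4 * PowerSeries.X ∧
      PowerSeries.constantCoeff (1 - 2 * PowerSeries.X * catalanGF) = 1 := by
  constructor
  · have h : catalanGF ^ 2 * PowerSeries.X + 1 = catalanGF := by
      have := congrArg (PowerSeries.map (Nat.castRingHom ℚ))
        PowerSeries.catalanSeries_sq_mul_X_add_one
      simpa [catalanGF] using this
    linear_combination 4 * PowerSeries.X * h
  · simp

/-- A power series, seen in the field `ℚ((t))` of Laurent series. -/
noncomputable def toLaurent (F : PowerSeries ℚ) : ℚ⸨X⸩ := (F : ℚ⸨X⸩)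

/-- A power series `F` over `ℚ` is algebraic of degree `d`: it is algebraic over the field `ℚ(t)`
of rational functions (inside the field `ℚ((t))`), with minimal polynomial of degree `d`. -/
def IsAlgebraicOfDegree (F : PowerSeries ℚ) (d : ℕ) : Prop :=
  IsAlgebraic (RatFunc ℚ) (toLaurent F) ∧ (minpoly (RatFunc ℚ) (toLaurent F)).natDegree = d

/-- `F(t) = R(G(t))` for a rational function `R` whose (reduced) denominator does not vanish at
the series `G`; the division takes place in the field `ℚ((t))`. -/
def IsRationalIn (F : PowerSeries ℚ) (R : RatFunc ℚ) (G : PowerSeries ℚ) : Prop :=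
  R.denom.aeval (toLaurent G) ≠ 0 ∧
    toLaurent F = R.num.aeval (toLaurent G) / R.denom.aeval (toLaurent G)

/-- The rational function `(u - 1)⁴ P(u) / ((u² + 1 - u)^(2k) (u - 2)^(3k - 1))`, for `k ≥ 1`. -/
noncomputable def shape (k : ℕ) (P : Polynomial ℚ) : RatFunc ℚ :=
  (RatFunc.X - 1) ^ 4 /
      ((RatFunc.X ^ 2 + 1 - RatFunc.X) ^ (2 * k) * (RatFunc.X - 2) ^ (3 * k - 1)) *
    algebraMap (Polynomial ℚ) (RatFunc ℚ) P

section ExplicitPolynomials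

open Polynomial

/-- The numerator polynomial for one internal point. -/
noncomputable def P1 : ℚ[X] :=
  9 + 14 * (X - 1) + 12 * (X - 1) ^ 2 + 4 * (X - 1) ^ 3 - (X - 1) ^ 4 - 2 * (X - 1) ^ 5

/-- The numerator polynomial for two internal points. -/
noncomputable def P2 : ℚ[X] :=
  -(18 + 130 * (X - 1) + 412 * (X - 1) ^ 2 + 683 * (X - 1) ^ 3 + 823 * (X - 1) ^ 4 +
    643 * (X - 1) ^ 5 + 307 * (X - 1) ^ 6 + 67 * (X - 1) ^ 7 + 13 * (X - 1) ^ 8 +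
    57 * (X - 1) ^ 9 + 71 * (X - 1) ^ 10 + 35 * (X - 1) ^ 11 - 3 * (X - 1) ^ 12 -
    11 * (X - 1) ^ 13 - 5 * (X - 1) ^ 14)

/-- The numerator polynomial for three internal points. -/
noncomputable def P3 : ℚ[X] :=
  54 + 744 * (X - 1) + 4570 * (X - 1) ^ 2 + 16088 * (X - 1) ^ 3 + 38435 * (X - 1) ^ 4 +
    69472 * (X - 1) ^ 5 + 98842 * (X - 1) ^ 6 + 113452 * (X - 1) ^ 7 + 109007 * (X - 1) ^ 8 +
    90876 * (X - 1) ^ 9 + 68286 * (X - 1) ^ 10 + 47508 * (X - 1) ^ 11 + 29222 * (X - 1) ^ 12 +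
    13476 * (X - 1) ^ 13 + 2401 * (X - 1) ^ 14 - 2262 * (X - 1) ^ 15 - 1881 * (X - 1) ^ 16 +
    26 * (X - 1) ^ 17 + 928 * (X - 1) ^ 18 + 646 * (X - 1) ^ 19 + 123 * (X - 1) ^ 20 -
    90 * (X - 1) ^ 21 - 67 * (X - 1) ^ 22 - 16 * (X - 1) ^ 23

end ExplicitPolynomials

end AlmostSquare

/-! Call a point inner if it is neither a left-to-right maximum nor a right-to-left minimum. An
inner point lies below an earlier left-to-right maximum and above a later right-to-left minimum, and
both of these are external. So the external points avoid 321 exactly when no inner point is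
external. Inner and internal points then coincide (`mem_ASqAv321_iff`), and one counts permutations
by inner points, marked by z, with t marking the size.

Deleting the first entry gives a recursion (`innerEnum_succ`) in the size, the threshold D (how many
remaining values lie below the largest deleted one) and the floor f (how many lie below all deleted
ones). Differences in D, or in D - f after summing over floors, turn it into short linear
recurrences. Their solutions are singled out by t-adic decay: a homogeneous solution is at each
order in z a unit times its first term, and that term would be infinitely divisible by t
(`eq_zero_of_serV_type`, `eq_zero_of_serS_type`).

Let V(D) be the series with floor 0 and no condition at the right end. Forbidding inner
right-to-left maxima only adds source terms. Particular solutions with coefficients in ℚ(t) show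
that each conditioned series is Φ times the unconditioned one plus an explicit correction, with the
same Φ in ℚ(t)[[z]] (`serVn_eq`, `serS_true_eq`). Reverse-complement exchanges the conditions at the
two ends, which gives one further relation. Together they yield F = Φ² V(0) + (an element of
ℚ(t)[[z]]) (`serF_structure`, `serF_eq_rational`).

Let q = tC(t), the small root of q(1 - q) = t. Then the z^r coefficient of V(D) is q^D C u(D), where
u is a polynomial in D over ℚ[q, 1/(2q - 1)] (`coeff_serV`). Hence every F_k lies in ℚ(C), a
quadratic extension of ℚ(t). If F_k were in ℚ(t), conjugation q ↔ 1 - q would fix it, so the z^k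
coefficient of Φ² times the difference between the conjugate of V(0) and V(0) would vanish. But
t^(k+1) times that coefficient takes at t = 0 the value (-1)^k times the sum of i! j! over i + j =
k, which is not zero (`genRat_irrational`).

For k = 1, 2, 3 the polynomial and exponential-polynomial solutions are unique, so closed forms need
only be checked against the recurrences (`genRat_one`, `genRat_two`, `genRat_three`). -/

namespace AlmostSquare

open Finset

/-! ### Scanning a permutation from left to right: threshold and floor. -/

section Scan

variable {l : ℕ}

/-- `i` is neither a left-to-right maximum of value at least `D` nor a right-to-left minimum. -/
def IsInner (D : ℕ) (τ : Equiv.Perm (Fin l)) (i : Fin l) : Prop :=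
  ¬ (D ≤ (τ i : ℕ) ∧ ∀ j, j < i → τ j < τ i) ∧ ¬ ∀ j, i < j → τ i < τ j

/-- Every inner point is above the floor `f` or above an earlier point; if `e` holds then it is also
below a later point. -/
def IsAdmissible (e : Prop) (D f : ℕ) (τ : Equiv.Perm (Fin l)) : Prop :=
  ∀ i, IsInner D τ i →
    (e → ∃ j, i < j ∧ τ i < τ j) ∧ (f ≤ (τ i : ℕ) ∨ ∃ j, j < i ∧ τ j < τ i)

open Classical in
/-- The enumerator of admissible permutations by number of inner points. -/
noncomputable def innerEnum (e : Prop) (l D f : ℕ) : PowerSeries ℚ :=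
  ∑ τ : Equiv.Perm (Fin l),
    if IsAdmissible e D f τ then PowerSeries.X ^ #{i | IsInner D τ i} else 0

/-- The permutation with first value `p` whose other values are in the relative order `σ`. -/
noncomputable def consPerm (p : Fin (l + 1)) (σ : Equiv.Perm (Fin l)) :
    Equiv.Perm (Fin (l + 1)) :=
  Equiv.ofBijective (Fin.cons p fun i => p.succAbove (σ i) : Fin (l + 1) → Fin (l + 1)) <| by
    rw [← Finite.injective_iff_bijective]
    rw [Fin.cons_injective_iff]
    refine ⟨?_, Fin.succAbove_right_injective.comp σ.injective⟩
    rintro ⟨i, hi⟩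
    exact Fin.succAbove_ne _ _ hi

@[simp] lemma consPerm_zero (p : Fin (l + 1)) (σ : Equiv.Perm (Fin l)) :
    consPerm p σ 0 = p := rfl

@[simp] lemma consPerm_succ (p : Fin (l + 1)) (σ : Equiv.Perm (Fin l)) (i : Fin l) :
    consPerm p σ i.succ = p.succAbove (σ i) := rfl

lemma consPerm_bijective :
    Function.Bijective fun x : Fin (l + 1) × Equiv.Perm (Fin l) => consPerm x.1 x.2 := by
  rw [Fintype.bijective_iff_injective_and_card]
  constructor
  · rintro ⟨p, σ⟩ ⟨p', σ'⟩ h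
    have h0 : p = p' := by simpa using congrArg (fun τ : Equiv.Perm (Fin (l + 1)) => τ 0) h
    subst h0
    congr 1
    ext i
    have := congrArg (fun τ : Equiv.Perm (Fin (l + 1)) => τ i.succ) h
    simp only [consPerm_succ] at this
    rw [Fin.succAbove_right_injective this]
  · simp [Fintype.card_perm, Nat.factorial_succ]

lemma succAbove_val (p : Fin (l + 1)) (v : Fin l) :
    (p.succAbove v : ℕ) = if (v : ℕ) < p then (v : ℕ) else v + 1 := by
  unfold Fin.succAbove
  simp only [Fin.lt_def, Fin.val_castSucc]
  split_ifs <;> simp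

lemma lt_succAbove_val (p : Fin (l + 1)) (v : Fin l) : p < p.succAbove v ↔ (p : ℕ) ≤ v := by
  rw [Fin.lt_def, succAbove_val]; split_ifs <;> omega

/-- If `p` reaches the threshold, it is the new running maximum and exactly `p` remaining values lie
below it. Otherwise `p` was one of the `D` values under the threshold, which drops by one. -/
lemma isInner_consPerm_succ (D : ℕ) (p : Fin (l + 1)) (σ : Equiv.Perm (Fin l)) (i : Fin l) :
    IsInner D (consPerm p σ) i.succ ↔
      IsInner (if D ≤ (p : ℕ) then (p : ℕ) else D - 1) σ i := by
  have h := succAbove_val p (σ i)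
  unfold IsInner
  refine and_congr (not_congr ?_) (not_congr ?_)
  · simp only [Fin.forall_fin_succ, consPerm_zero, consPerm_succ, Fin.succ_pos, forall_const,
      Fin.succ_lt_succ_iff, Fin.succAbove_lt_succAbove_iff, lt_succAbove_val, ← and_assoc]
    refine and_congr_left fun _ => ?_
    split_ifs at h ⊢ <;> omega
  · simp [Fin.forall_fin_succ]

lemma exists_val_eq (p : Fin (l + 1)) (v : ℕ) (hv : v < l + 1) (h : v ≠ p) :
    ∃ i : Fin l, (p.succAbove i : ℕ) = v := by
  obtain ⟨i, hi⟩ := Fin.exists_succAbove_eq (x := ⟨v, hv⟩) (y := p) (by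
    intro h'; exact h (by rw [← h']))
  exact ⟨i, by rw [hi]⟩

lemma isInner_consPerm_zero (D : ℕ) (p : Fin (l + 1)) (σ : Equiv.Perm (Fin l)) :
    IsInner D (consPerm p σ) 0 ↔ (p : ℕ) < D ∧ (p : ℕ) ≠ 0 := by
  unfold IsInner
  refine and_congr ?_ (not_congr ?_)
  · simp
  · simp only [Fin.forall_fin_succ, consPerm_zero, consPerm_succ, Fin.succ_pos, forall_const,
      lt_self_iff_false, false_imp_iff, true_and, lt_succAbove_val]
    constructor
    · intro h
      by_contra h0
      obtain ⟨v, hv⟩ := exists_val_eq p 0 (by omega) (by omega)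
      obtain ⟨i, rfl⟩ := σ.surjective v
      have := h i
      rw [succAbove_val] at hv
      split_ifs at hv
      omega
    · intro h i
      omega

lemma exists_lt_consPerm (p : Fin (l + 1)) (σ : Equiv.Perm (Fin l)) :
    (∃ j, 0 < j ∧ consPerm p σ 0 < consPerm p σ j) ↔ (p : ℕ) ≠ l := by
  simp only [Fin.exists_fin_succ, consPerm_zero, consPerm_succ, Fin.succ_pos, lt_self_iff_false,
    false_and, false_or, true_and, lt_succAbove_val]
  constructor
  · rintro ⟨i, hi⟩
    have := (σ i).isLt
    omega
  · intro h
    obtain ⟨v, hv⟩ := exists_val_eq p l (by omega) (by omega)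
    obtain ⟨i, rfl⟩ := σ.surjective v
    refine ⟨i, ?_⟩
    rw [succAbove_val] at hv
    split_ifs at hv <;> omega

/-- A later point is above the deleted entry exactly when its standardized value is at least `p`.
The deleted entry thus acts as a floor at height `p`, and the lower of the two floors decides. -/
lemma isAdmissible_consPerm (e : Prop) (D f : ℕ) (p : Fin (l + 1)) (σ : Equiv.Perm (Fin l)) :
    IsAdmissible e D f (consPerm p σ) ↔
      ((p : ℕ) < D ∧ (p : ℕ) ≠ 0 → (e → (p : ℕ) ≠ l) ∧ f ≤ (p : ℕ)) ∧
      IsAdmissible e (if D ≤ (p : ℕ) then (p : ℕ) else D - 1) (min f p) σ := by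
  unfold IsAdmissible
  rw [Fin.forall_fin_succ]
  refine and_congr ?_ (forall_congr' fun i => ?_)
  · rw [isInner_consPerm_zero, exists_lt_consPerm]
    simp
  · rw [isInner_consPerm_succ]
    refine imp_congr Iff.rfl (and_congr ?_ ?_)
    · simp [Fin.exists_fin_succ]
    · simp only [Fin.exists_fin_succ, consPerm_zero, consPerm_succ, Fin.succ_pos, true_and,
        Fin.succ_lt_succ_iff, Fin.succAbove_lt_succAbove_iff, lt_succAbove_val, ← or_assoc]
      refine or_congr_left ?_
      have h := succAbove_val p (σ i)
      split_ifs at h <;> omega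

open Classical in
lemma card_isInner_consPerm (D : ℕ) (p : Fin (l + 1)) (σ : Equiv.Perm (Fin l)) :
    #{i | IsInner D (consPerm p σ) i} =
      #{i | IsInner (if D ≤ (p : ℕ) then (p : ℕ) else D - 1) σ i} +
        if (p : ℕ) < D ∧ (p : ℕ) ≠ 0 then 1 else 0 := by
  rw [Fin.card_filter_univ_succ, isInner_consPerm_zero]
  simp only [isInner_consPerm_succ]
  split_ifs <;> rfl

open Classical in
-- Only a first value strictly between 0 and the threshold is inner. Its own conditions then include
-- `f ≤ p`, so the floor does not move.
lemma innerEnum_succ (e : Prop) (l D f : ℕ) :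
    innerEnum e (l + 1) D f = ∑ p ∈ range (l + 1),
      if p < D ∧ p ≠ 0 then
        if (e → p ≠ l) ∧ f ≤ p then PowerSeries.X * innerEnum e l (D - 1) f else 0
      else innerEnum e l (if D ≤ p then p else D - 1) (min f p) := by
  have h1 : innerEnum e (l + 1) D f = ∑ x : Fin (l + 1) × Equiv.Perm (Fin l),
      if IsAdmissible e D f (consPerm x.1 x.2) then
        (PowerSeries.X : PowerSeries ℚ) ^ #{i | IsInner D (consPerm x.1 x.2) i} else 0 :=
    (Function.Bijective.sum_comp consPerm_bijective (g := fun τ => if IsAdmissible e D f τ then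
      (PowerSeries.X : PowerSeries ℚ) ^ #{i | IsInner D τ i} else 0)).symm
  rw [h1, Fintype.sum_prod_type, Finset.sum_range]
  refine Finset.sum_congr rfl fun p _ => ?_
  simp only [isAdmissible_consPerm, card_isInner_consPerm]
  by_cases hp : (p : ℕ) < D ∧ (p : ℕ) ≠ 0
  · simp only [if_pos hp, if_neg (not_le.2 hp.1)]
    by_cases hq : (e → (p : ℕ) ≠ l) ∧ f ≤ (p : ℕ)
    · rw [if_pos hq, min_eq_left hq.2, innerEnum, Finset.mul_sum]
      refine Finset.sum_congr rfl fun σ _ => ?_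
      rw [if_congr (and_iff_right fun _ => hq) rfl rfl, mul_ite, mul_zero, pow_succ']
    · rw [if_neg hq]
      exact Finset.sum_eq_zero fun σ _ => if_neg fun h => hq (h.1 hp)
  · simp only [if_neg hp, add_zero]
    refine Finset.sum_congr rfl fun σ _ => ?_
    exact if_congr (and_iff_right fun h => absurd h hp) rfl rfl

lemma innerEnum_zero (e : Prop) (D f : ℕ) : innerEnum e 0 D f = 1 := by
  simp [innerEnum, IsAdmissible]

lemma revConj_apply {m : ℕ} (τ : Equiv.Perm (Fin m)) (i : Fin m) :
    (Fin.revPerm.permCongr τ) i = (τ i.rev).rev := rfl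

lemma isInner_revConj {m : ℕ} (τ : Equiv.Perm (Fin m)) (i : Fin m) :
    IsInner 0 (Fin.revPerm.permCongr τ) i ↔ IsInner 0 τ i.rev := by
  unfold IsInner
  simp only [revConj_apply, Fin.rev_lt_rev, Nat.zero_le, true_and]
  rw [and_comm]
  refine and_congr (not_congr ?_) (not_congr ?_) <;>
  · refine ⟨fun h j hj => ?_, fun h j hj => h _ (Fin.rev_lt_rev.2 hj)⟩
    have := h j.rev (by rwa [← Fin.rev_lt_rev, Fin.rev_rev])
    rwa [Fin.rev_rev] at this

/-- Reverse-complement swaps "above an earlier point" with "below a later point". Floor `m` is never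
reached and floor 0 always is, so each side carries just one of these two conditions. -/
lemma isAdmissible_revConj {m : ℕ} (τ : Equiv.Perm (Fin m)) :
    IsAdmissible False 0 m (Fin.revPerm.permCongr τ) ↔ IsAdmissible True 0 0 τ := by
  unfold IsAdmissible
  rw [← Fin.revPerm.forall_congr_right]
  refine forall_congr' fun i => ?_
  rw [isInner_revConj]
  simp only [Fin.revPerm_apply, Fin.rev_rev, false_imp_iff, true_and, zero_le, true_or, and_true,
    true_imp_iff, revConj_apply, Fin.rev_lt_rev, not_le.2 (Fin.isLt _), false_or]
  refine imp_congr_right fun _ => ?_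
  rw [← Fin.revPerm.exists_congr_right]
  simp only [Fin.revPerm_apply, Fin.rev_rev, Fin.rev_lt_rev]

lemma innerEnum_symm (m : ℕ) : innerEnum False m 0 m = innerEnum True m 0 0 := by
  classical
  unfold innerEnum
  rw [← (Equiv.permCongr Fin.revPerm).sum_comp]
  refine Finset.sum_congr rfl fun τ _ => ?_
  rw [if_congr (isAdmissible_revConj τ) rfl rfl]
  congr 2
  rw [← Finset.card_map Fin.revPerm.toEmbedding]
  congr 1
  ext i
  simp only [mem_map_equiv, mem_filter, mem_univ, true_and, isInner_revConj]
  simp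

end Scan

/-! ### Avoiding 321 on external points, expressed through inner points. -/

section Characterization

variable {m n : ℕ}

lemma isInner_zero_iff (π : Equiv.Perm (Fin m)) (i : Fin m) :
    IsInner 0 π i ↔ ¬ IsLRMax π i ∧ ¬ IsRLMin π i := by
  simp [IsInner, IsLRMax, IsRLMin]

lemma isAdmissible_zero_iff (π : Equiv.Perm (Fin m)) :
    IsAdmissible True 0 m π ↔ ∀ i, IsInner 0 π i → ¬ IsExternal π i := by
  unfold IsAdmissible
  refine forall_congr' fun i => ?_
  rw [isInner_zero_iff]
  refine imp_congr_right fun h => ?_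
  simp only [true_imp_iff, not_le.2 (Fin.isLt _), false_or, IsExternal, h.1, h.2, or_false,
    not_or, IsLRMin, IsRLMax, not_forall, not_lt, exists_prop]
  rw [and_comm]
  refine and_congr (exists_congr fun j => and_congr_right fun hj => ?_)
    (exists_congr fun j => and_congr_right fun hj => ?_)
  · exact ⟨le_of_lt, fun h' => lt_of_le_of_ne h' fun h'' => hj.ne (π.injective h'')⟩
  · exact ⟨le_of_lt, fun h' => lt_of_le_of_ne h' fun h'' => hj.ne (π.injective h'')⟩

/-- A point that is not a left-to-right maximum is below an earlier left-to-right maximum. -/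
lemma exists_lrMax_of_not (π : Equiv.Perm (Fin m)) (i : Fin m) (h : ¬ IsLRMax π i) :
    ∃ j, j < i ∧ π i < π j ∧ IsLRMax π j := by
  obtain ⟨j, hj, hmax⟩ := Finset.exists_max_image (univ.filter (· ≤ i)) π ⟨i, by simp⟩
  simp only [mem_filter, mem_univ, true_and] at hj hmax
  have hl : IsLRMax π j := fun a ha =>
    lt_of_le_of_ne (hmax a (ha.le.trans hj)) fun h' => ha.ne (π.injective h')
  have hne : j ≠ i := by rintro rfl; exact h hl
  exact ⟨j, lt_of_le_of_ne hj hne,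
    lt_of_le_of_ne (hmax i le_rfl) fun h' => hne (π.injective h').symm, hl⟩

/-- A point that is not a right-to-left minimum is above a later right-to-left minimum. -/
lemma exists_rlMin_of_not (π : Equiv.Perm (Fin m)) (i : Fin m) (h : ¬ IsRLMin π i) :
    ∃ j, i < j ∧ π j < π i ∧ IsRLMin π j := by
  obtain ⟨j, hj, hmin⟩ := Finset.exists_min_image (univ.filter (i ≤ ·)) π ⟨i, by simp⟩
  simp only [mem_filter, mem_univ, true_and] at hj hmin
  have hl : IsRLMin π j := fun a ha =>
    lt_of_le_of_ne (hmin a (hj.trans ha.le)) fun h' => ha.ne (π.injective h')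
  have hne : j ≠ i := by rintro rfl; exact h hl
  exact ⟨j, lt_of_le_of_ne hj hne.symm,
    lt_of_le_of_ne (hmin i le_rfl) fun h' => hne (π.injective h'), hl⟩

lemma avoids_perm321_iff (σ : Equiv.Perm (Fin n)) :
    Avoids σ perm321 ↔ ∀ a b c, a < b → b < c → ¬ (σ b < σ a ∧ σ c < σ b) := by
  constructor
  · rintro h a b c hab hbc ⟨h1, h2⟩
    refine h (Set.range ![a, b, c]) ⟨OrderEmbedding.ofStrictMono ![a, b, c] ?_, rfl, ?_⟩
    · intro i j hij
      fin_cases i <;> fin_cases j <;>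
        first | exact absurd hij (by decide) | simp [hab, hbc, hab.trans hbc]
    · have hanti : StrictAnti fun i => σ (![a, b, c] i) := by
        intro i j hij
        fin_cases i <;> fin_cases j <;>
          
        first | exact absurd hij (by decide) | simp [h1, h2, h2.trans h1]
      exact fun i j => (hanti.lt_iff_gt (a := i) (b := j)).trans Fin.rev_lt_rev.symm
  · rintro h S ⟨e, -, he⟩
    refine h (e 0) (e 1) (e 2) (by simp) (by simp) ⟨(he _ _).2 ?_, (he _ _).2 ?_⟩ <;>
    · simp only [perm321, Fin.revPerm_apply]; decide

/-- Otherwise the point is the middle of a 321 whose outer entries are a left-to-right maximum and a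
right-to-left minimum, so all three are external. -/
lemma isLRMax_or_isRLMin_of_isExternal (π : Equiv.Perm (Fin m)) (σ : Equiv.Perm (Fin n))
    (hσ : Avoids σ perm321) (h : Induces π {i | IsExternal π i} σ) (i : Fin m)
    (hi : IsExternal π i) : IsLRMax π i ∨ IsRLMin π i := by
  obtain ⟨e, hr, he⟩ := h
  by_contra hcon
  rw [not_or] at hcon
  obtain ⟨j, hj, hj', hje⟩ := exists_lrMax_of_not π i hcon.1
  obtain ⟨k, hk, hk', hke⟩ := exists_rlMin_of_not π i hcon.2
  have hsurj : ∀ x, IsExternal π x → ∃ a, e a = x := fun x hx => by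
    have : x ∈ Set.range e := hr ▸ hx
    exact this
  obtain ⟨a, rfl⟩ := hsurj j (Or.inl hje)
  obtain ⟨b, rfl⟩ := hsurj i hi
  obtain ⟨c, rfl⟩ := hsurj k (Or.inr (Or.inr (Or.inr hke)))
  exact (avoids_perm321_iff σ).1 hσ a b c (e.lt_iff_lt.1 hj) (e.lt_iff_lt.1 hk)
    ⟨(he _ _).1 hj', (he _ _).1 hk'⟩

/-- Every set of `n` points of a permutation induces a permutation of size `n`. -/
lemma exists_induces (π : Equiv.Perm (Fin m)) (S : Finset (Fin m)) (hS : #S = n) :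
    ∃ (σ : Equiv.Perm (Fin n)) (e : Fin n ↪o Fin m), Set.range e = S ∧
      ∀ a b, π (e a) < π (e b) ↔ σ a < σ b := by
  let e := S.orderEmbOfFin hS
  let S' : Finset (Fin m) := S.map π.toEmbedding
  have hS' : #S' = n := by simp [S', hS]
  have hmem : ∀ a, π (e a) ∈ S' := fun a => by
    simp [S', e]
  let g : Fin n → Fin n := fun a => (S'.orderIsoOfFin hS').symm ⟨π (e a), hmem a⟩
  have hg : ∀ a b, g a < g b ↔ π (e a) < π (e b) := fun a b => by
    simp [g]
  have hinj : Function.Injective g := by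
    intro a b hab
    have := (S'.orderIsoOfFin hS').symm.injective hab
    simpa using this
  refine ⟨Equiv.ofBijective g (Finite.injective_iff_bijective.1 hinj), e, ?_, fun a b =>
    (hg a b).symm⟩
  simp [e]

open Classical in
-- Either side makes inner the same as internal. For the converse, the middle of a 321 among
-- external points would be both inner and external.
lemma mem_ASqAv321_iff (k : ℕ) (π : Equiv.Perm (Fin (n + k))) :
    π ∈ ASqAv321 n k ↔ IsAdmissible True 0 (n + k) π ∧ #{i | IsInner 0 π i} = k := by
  rw [isAdmissible_zero_iff]
  constructor
  · rintro ⟨σ, hσ, hi⟩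
    have key : ∀ i, IsInner 0 π i ↔ ¬ IsExternal π i := fun i => by
      rw [isInner_zero_iff]
      constructor
      · intro h he
        have := isLRMax_or_isRLMin_of_isExternal π σ hσ hi i he
        tauto
      · intro h
        unfold IsExternal at h
        tauto
    refine ⟨fun i => (key i).1, ?_⟩
    obtain ⟨e, hr, -⟩ := hi
    have h1 : #{i | IsExternal π i} = n := by
      have h2 : (univ.map e.toEmbedding) = ({i | IsExternal π i} : Finset (Fin (n + k))) := by
        ext x
        have := Set.ext_iff.1 hr x
        simpa using this
      rw [← h2]; simp
    have h3 := Finset.card_filter_add_card_filter_not (s := (univ : Finset (Fin (n + k))))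
      (fun i => IsExternal π i)
    simp only [key]
    simp only [card_univ, Fintype.card_fin] at h3
    omega
  · rintro ⟨h, hk⟩
    have key : ∀ i, IsInner 0 π i ↔ ¬ IsExternal π i := fun i => by
      refine ⟨h i, fun h' => ?_⟩
      rw [isInner_zero_iff]
      unfold IsExternal at h'
      tauto
    have h1 : #{i | IsExternal π i} = n := by
      have h3 := Finset.card_filter_add_card_filter_not (s := (univ : Finset (Fin (n + k))))
        (fun i => IsExternal π i)
      simp only [key] at hk
      simp only [card_univ, Fintype.card_fin] at h3
      omega
    obtain ⟨σ, e, hr, he⟩ := exists_induces π _ h1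
    simp only [coe_filter, mem_univ, true_and] at hr
    refine ⟨σ, ?_, e, hr, he⟩
    rw [avoids_perm321_iff]
    rintro a b c hab hbc ⟨h2, h3⟩
    rw [← he] at h2 h3
    have hb : IsExternal π (e b) := by
      have : e b ∈ Set.range e := ⟨b, rfl⟩
      rw [hr] at this; exact this
    have hb' : ¬ IsInner 0 π (e b) := fun h' => h _ h' hb
    rw [isInner_zero_iff] at hb'
    apply hb'
    constructor
    · intro h4
      exact lt_asymm h2 (h4 _ (e.lt_iff_lt.2 hab))
    · intro h4
      exact lt_asymm h3 (h4 _ (e.lt_iff_lt.2 hbc))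

lemma card_ASqAv321 (n k : ℕ) :
    (Nat.card (ASqAv321 n k) : ℚ) =
      PowerSeries.coeff k (innerEnum True (n + k) 0 (n + k)) := by
  classical
  have : Nat.card (ASqAv321 n k) = #{π : Equiv.Perm (Fin (n + k)) | π ∈ ASqAv321 n k} := by
    rw [Nat.card_eq_fintype_card, Fintype.card_subtype]
  rw [this, innerEnum, map_sum, Finset.card_filter, Nat.cast_sum]
  refine Finset.sum_congr rfl fun π _ => ?_
  rw [if_congr (mem_ASqAv321_iff k π) rfl rfl]
  by_cases h : IsAdmissible True 0 (n + k) π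
  · simp [h, PowerSeries.coeff_X_pow, eq_comm]
  · simp [h]

end Characterization

/-! ### Recurrences in the threshold for each size. -/

section NumberRecurrences

local notation "z" => (PowerSeries.X : PowerSeries ℚ)

lemma innerEnum_succ_zero (e : Prop) (l f : ℕ) :
    innerEnum e (l + 1) 0 f = ∑ p ∈ range (l + 1), innerEnum e l p (min f p) := by
  simp [innerEnum_succ]

open Classical in
-- The first value is a new maximum, or 0 (which lowers the floor to 0), or inner. All inner choices
-- contribute the same series, so only their number matters; the end condition removes the choice `p
-- = l`, which lies under the threshold only if `D = l`.
lemma innerEnum_succ_succ (e : Prop) (l D f : ℕ) (hD : D ≤ l) (hf : f ≤ D + 1) :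
    innerEnum e (l + 1) (D + 1) f = ∑ p ∈ Ico (D + 1) (l + 1), innerEnum e l p f +
      innerEnum e l D 0 +
      ((if e ∧ D = l then D - max f 1 else D + 1 - max f 1 : ℕ) : PowerSeries ℚ) *
        (z * innerEnum e l D f) := by
  rw [innerEnum_succ, range_eq_Ico, ← Finset.sum_Ico_consecutive _ (Nat.zero_le (D + 1)) (by omega),
    Finset.sum_eq_sum_Ico_succ_bot (by omega)]
  have h1 : ∑ p ∈ Ico (D + 1) (l + 1), (if p < D + 1 ∧ p ≠ 0 then
        if (e → p ≠ l) ∧ f ≤ p then z * innerEnum e l (D + 1 - 1) f else 0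
      else innerEnum e l (if D + 1 ≤ p then p else D + 1 - 1) (min f p)) =
      ∑ p ∈ Ico (D + 1) (l + 1), innerEnum e l p f := by
    refine Finset.sum_congr rfl fun p hp => ?_
    rw [mem_Ico] at hp
    rw [if_neg (by omega), if_pos hp.1, min_eq_left (by omega)]
  have h2 : ∑ p ∈ Ico (0 + 1) (D + 1), (if p < D + 1 ∧ p ≠ 0 then
        if (e → p ≠ l) ∧ f ≤ p then z * innerEnum e l (D + 1 - 1) f else 0
      else innerEnum e l (if D + 1 ≤ p then p else D + 1 - 1) (min f p)) =
      ((if e ∧ D = l then D - max f 1 else D + 1 - max f 1 : ℕ) : PowerSeries ℚ) *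
        (z * innerEnum e l D f) := by
    have h3 : ∀ p ∈ Ico (0 + 1) (D + 1), (if p < D + 1 ∧ p ≠ 0 then
        if (e → p ≠ l) ∧ f ≤ p then z * innerEnum e l (D + 1 - 1) f else 0
      else innerEnum e l (if D + 1 ≤ p then p else D + 1 - 1) (min f p)) =
        if (e → p ≠ l) ∧ f ≤ p then z * innerEnum e l D f else 0 := by
      intro p hp
      rw [mem_Ico] at hp
      rw [if_pos (by omega)]
      rfl
    rw [Finset.sum_congr rfl h3, ← Finset.sum_filter, Finset.sum_const, nsmul_eq_mul]
    congr 2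
    by_cases he : e ∧ D = l
    · rw [if_pos he, ← Nat.card_Ico]
      congr 1
      ext p
      simp only [mem_filter, mem_Ico, he.1, true_imp_iff]
      omega
    · rw [if_neg he, ← Nat.card_Ico]
      congr 1
      ext p
      have : p < D + 1 → (e → p ≠ l) := fun h1 h2 h3 => he ⟨h2, by omega⟩
      simp only [mem_filter, mem_Ico]
      constructor
      · omega
      · intro h
        exact ⟨by omega, this h.2, by omega⟩
  rw [h1, h2, if_neg (by simp), if_neg (by omega), min_eq_right (Nat.zero_le f)]
  simp only [Nat.add_sub_cancel]
  ring

/-- Floor `0`, threshold at most the size. -/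
noncomputable def weakEnum (e : Prop) [Decidable e] (l D : ℕ) : PowerSeries ℚ :=
  if D ≤ l then innerEnum e l D 0 else 0

/-- Floor `0`, threshold below the size, last point not maximal. -/
noncomputable def strictEnum (l D : ℕ) : PowerSeries ℚ :=
  if D < l then innerEnum True l D 0 else 0

/-- Sum over all floors `f ≥ 1` with threshold `f + x`. -/
noncomputable def floorEnum (e : Prop) (l x : ℕ) : PowerSeries ℚ :=
  ∑ f ∈ Ico 1 (l - x + 1), innerEnum e l (f + x) f

/-- Floor `l - x`, threshold `l`. -/
noncomputable def topEnum (l x : ℕ) : PowerSeries ℚ :=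
  if x < l then innerEnum True l l (l - x) else 0

lemma weakEnum_succ_one (l : ℕ) : weakEnum False (l + 1) 1 = weakEnum False (l + 1) 0 := by
  have h := innerEnum_succ_succ False l 0 0 (by omega) (by omega)
  have h' := innerEnum_succ_zero False l 0
  rw [range_eq_Ico, Finset.sum_eq_sum_Ico_succ_bot (by omega)] at h'
  simp only [zero_add, false_and, if_false, Nat.zero_le, sup_of_le_right, Nat.sub_self,
    Nat.cast_zero, zero_mul, add_zero, min_self, inf_of_le_left] at h h'
  simp only [weakEnum, if_pos (Nat.zero_le _), if_pos (show 1 ≤ l + 1 by omega)]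
  rw [h, h']; ring

/-- Subtracting the recursions for consecutive thresholds telescopes the sum over new maxima.
Setting the value to 0 above the diagonal makes the identity valid for all sizes. -/
lemma weakEnum_succ_succ_succ (l D : ℕ) : weakEnum False (l + 1) (D + 2) =
    weakEnum False (l + 1) (D + 1) + ((D + 1 : ℕ) : PowerSeries ℚ) * (z * weakEnum False l (D + 1))
      - weakEnum False l D - (D : PowerSeries ℚ) * (z * weakEnum False l D) := by
  rcases lt_trichotomy l D with h | h | h
  · simp only [weakEnum]
    rw [if_neg (by omega), if_neg (by omega), if_neg (by omega), if_neg (by omega)]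
    ring
  · subst h
    have h1 := innerEnum_succ_succ False l l 0 (by omega) (by omega)
    simp only [false_and, if_false, Nat.zero_le, sup_of_le_right, Ico_self, sum_empty,
      Nat.add_sub_cancel] at h1
    simp only [weakEnum]
    rw [if_neg (by omega), if_pos (by omega), if_neg (by omega), if_pos (by omega), h1]
    ring
  · have h1 := innerEnum_succ_succ False l D 0 (by omega) (by omega)
    have h2 := innerEnum_succ_succ False l (D + 1) 0 (by omega) (by omega)
    rw [Finset.sum_eq_sum_Ico_succ_bot (by omega)] at h1
    simp only [false_and, if_false, Nat.zero_le, sup_of_le_right,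
      Nat.add_sub_cancel] at h1 h2
    simp only [weakEnum]
    rw [if_pos (by omega), if_pos (by omega), if_pos (by omega), if_pos (by omega), h1, h2]
    ring

lemma innerEnum_diag_succ (l : ℕ) : innerEnum True (l + 1) (l + 1) 0 =
    innerEnum True l l 0 + ((l - 1 : ℕ) : PowerSeries ℚ) * (z * innerEnum True l l 0) := by
  have h1 := innerEnum_succ_succ True l l 0 (by omega) (by omega)
  simpa using h1

lemma strictEnum_succ_one (l : ℕ) :
    strictEnum (l + 1) 1 = strictEnum (l + 1) 0 - if l = 0 then 1 else 0 := by
  rcases Nat.eq_zero_or_pos l with rfl | hl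
  · simp [strictEnum, innerEnum_succ_zero, innerEnum_zero]
  · have h := innerEnum_succ_succ True l 0 0 (by omega) (by omega)
    have h' := innerEnum_succ_zero True l 0
    rw [range_eq_Ico, Finset.sum_eq_sum_Ico_succ_bot (by omega)] at h'
    simp only [zero_add, true_and, if_neg hl.ne, Nat.zero_le, sup_of_le_right, Nat.sub_self,
      Nat.cast_zero, zero_mul, add_zero, min_self, inf_of_le_left] at h h'
    simp only [strictEnum, if_pos (Nat.succ_pos _), if_pos (show 1 < l + 1 by omega)]
    rw [h, h', if_neg hl.ne']; ring

/-- Keeping the threshold strictly below the size avoids the exceptional number of inner choices on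
the diagonal; the price is a diagonal source term. -/
lemma strictEnum_succ_succ_succ (l D : ℕ) : strictEnum (l + 1) (D + 2) =
    strictEnum (l + 1) (D + 1) + ((D + 1 : ℕ) : PowerSeries ℚ) * (z * strictEnum l (D + 1))
      - strictEnum l D - (D : PowerSeries ℚ) * (z * strictEnum l D)
      - if l = D + 1 then innerEnum True l l 0 else 0 := by
  rcases lt_trichotomy l (D + 1) with h | h | h
  · simp only [strictEnum]
    rw [if_neg (by omega), if_neg (by omega), if_neg (by omega), if_neg (by omega),
      if_neg (by omega)]
    ring
  · subst h
    have h1 := innerEnum_succ_succ True (D + 1) D 0 (by omega) (by omega)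
    simp only [true_and, Nat.zero_le, sup_of_le_right, show D ≠ D + 1 by omega, if_false,
      Nat.add_sub_cancel] at h1
    rw [Finset.sum_eq_sum_Ico_succ_bot (by omega), Ico_self, sum_empty] at h1
    simp only [strictEnum]
    rw [if_neg (by omega), if_pos (by omega), if_neg (by omega), if_pos (by omega),
      if_pos trivial, h1]
    ring
  · have h1 := innerEnum_succ_succ True l D 0 (by omega) (by omega)
    have h2 := innerEnum_succ_succ True l (D + 1) 0 (by omega) (by omega)
    rw [Finset.sum_eq_sum_Ico_succ_bot (by omega)] at h1
    simp only [true_and, show D ≠ l by omega, show D + 1 ≠ l by omega, if_false, Nat.zero_le,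
      sup_of_le_right, Nat.add_sub_cancel] at h1 h2
    simp only [strictEnum]
    rw [if_pos (by omega), if_pos (by omega), if_pos (by omega), if_pos (by omega),
      if_neg (by omega), h1, h2]
    ring

lemma weakEnum_true (l D : ℕ) : weakEnum True l D =
    strictEnum l D + if l = D then innerEnum True l l 0 else 0 := by
  unfold weakEnum strictEnum
  rcases lt_trichotomy l D with h | h | h
  · rw [if_neg (by omega), if_neg (by omega), if_neg (by omega), add_zero]
  · subst h; simp
  · rw [if_pos (by omega), if_pos (by omega), if_neg (by omega), add_zero]

lemma topEnum_succ_zero (l : ℕ) : topEnum (l + 1) 0 = innerEnum True l l 0 := by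
  have h1 := innerEnum_succ_succ True l l (l + 1) (by omega) (by omega)
  simp [topEnum, h1]

lemma topEnum_succ_succ (l x : ℕ) : topEnum (l + 1) (x + 1) =
    (if x + 1 ≤ l then innerEnum True l l 0 else 0) +
      (x : PowerSeries ℚ) * (z * topEnum l x) := by
  unfold topEnum
  by_cases h : x + 1 ≤ l
  · have h1 := innerEnum_succ_succ True l l (l - x) (by omega) (by omega)
    simp only [Ico_self, sum_empty, true_and, if_true, zero_add] at h1
    rw [show max (l - x) 1 = l - x by omega, show l - (l - x) = x by omega] at h1
    rw [if_pos (by omega), if_pos h, if_pos (by omega), show l + 1 - (x + 1) = l - x by omega, h1]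
  · rw [if_neg (by omega), if_neg h, if_neg (by omega)]
    ring

open Classical in
-- With `x` the threshold minus the floor, a positive floor leaves exactly `x` inner choices, each
-- lowering `x` by one. Only for the largest floor is the top value `l` among them, which accounts
-- for the subtracted `topEnum`.
lemma floorEnum_succ (e : Prop) (l x : ℕ) : floorEnum e (l + 1) x =
    ∑ x' ∈ Ico x (l + 1), floorEnum e l x' + ∑ D ∈ Ico x (l + 1), innerEnum e l D 0 +
      (x : PowerSeries ℚ) * (z * floorEnum e l (x - 1)) -
      if e ∧ x ≠ 0 then z * topEnum l (x - 1) else 0 := by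
  rcases Nat.lt_or_ge l x with hx | hx
  · simp only [floorEnum, topEnum, Ico_eq_empty_of_le (show l + 1 ≤ x from hx), sum_empty]
    rw [show l + 1 - x + 1 = 1 by omega, show l - (x - 1) + 1 = 1 by omega,
      if_neg (show ¬ x - 1 < l by omega)]
    simp
  have h0 : ∀ f ∈ Ico 1 (l + 1 - x + 1), innerEnum e (l + 1) (f + x) f =
      ∑ x' ∈ Ico x (l + 1 - f), innerEnum e l (f + x') f + innerEnum e l (f - 1 + x) 0 +
        ((x : PowerSeries ℚ) * (z * innerEnum e l (f + (x - 1)) f) -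
          if f = l + 1 - x then (if e ∧ x ≠ 0 then z * topEnum l (x - 1) else 0) else 0) := by
    intro f hf
    rw [mem_Ico] at hf
    obtain ⟨g, rfl⟩ : ∃ g, f = g + 1 := ⟨f - 1, by omega⟩
    have h1 := innerEnum_succ_succ e l (g + x) (g + 1) (by omega) (by omega)
    rw [show g + x + 1 = g + 1 + x by omega] at h1
    rw [h1]
    congr 1
    · congr 1
      rw [Finset.sum_Ico_eq_sum_range, Finset.sum_Ico_eq_sum_range]
      rw [show l + 1 - (g + 1 + x) = l + 1 - (g + 1) - x by omega]
      refine Finset.sum_congr rfl fun i _ => ?_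
      rw [show g + 1 + x + i = g + 1 + (x + i) by omega]
    · rcases Nat.eq_zero_or_pos x with rfl | hx0
      · simp
      · rw [show g + x = g + 1 + (x - 1) by omega]
        by_cases he : e
        · by_cases hg : g + 1 = l + 1 - x
          · rw [if_pos ⟨he, by omega⟩, if_pos hg, if_pos ⟨he, by omega⟩, topEnum,
              if_pos (by omega), show l - (x - 1) = g + 1 by omega,
              show g + 1 + (x - 1) = l by omega, show l - max (g + 1) 1 = x - 1 by omega]
            have : (x : PowerSeries ℚ) = ((x - 1 : ℕ) : PowerSeries ℚ) + 1 := by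
              rw [← Nat.cast_add_one]; congr 1; omega
            simp only [he, this]
            ring
          · rw [if_neg (by omega), if_neg hg,
              show g + 1 + x - max (g + 1) 1 = x by omega, sub_zero]
        · simp only [he, false_and, if_false, ite_self, sub_zero]
          rw [show g + 1 + x - max (g + 1) 1 = x by omega]
  rw [floorEnum, Finset.sum_congr rfl h0, Finset.sum_add_distrib, Finset.sum_add_distrib,
    Finset.sum_sub_distrib, Finset.sum_ite_eq', ← Finset.mul_sum, ← Finset.mul_sum,
    if_pos (by rw [mem_Ico]; omega)]
  have h1 : ∑ f ∈ Ico 1 (l + 1 - x + 1), ∑ x' ∈ Ico x (l + 1 - f), innerEnum e l (f + x') f =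
      ∑ x' ∈ Ico x (l + 1), floorEnum e l x' := by
    refine Finset.sum_comm' fun f x' => ?_
    simp only [mem_Ico]
    omega
  have h2 : ∑ f ∈ Ico 1 (l + 1 - x + 1), innerEnum e l (f - 1 + x) 0 =
      ∑ D ∈ Ico x (l + 1), innerEnum e l D 0 := by
    rw [Finset.sum_Ico_eq_sum_range, Finset.sum_Ico_eq_sum_range,
      show l + 1 - x + 1 - 1 = l + 1 - x by omega]
    refine Finset.sum_congr rfl fun i _ => ?_
    rw [show 1 + i - 1 + x = x + i by omega]
  rw [h1, h2]
  rcases Nat.eq_zero_or_pos x with rfl | hx0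
  · simp
  · rw [floorEnum, show l - (x - 1) + 1 = l + 1 - x + 1 by omega]
    ring

lemma floorEnum_zero_left (e : Prop) (x : ℕ) : floorEnum e 0 x = 0 := by
  simp [floorEnum]

lemma floorEnum_eq_zero (e : Prop) (l x : ℕ) (h : l ≤ x) : floorEnum e l x = 0 := by
  rw [floorEnum, show l - x + 1 = 1 by omega, Ico_self, sum_empty]

lemma floorEnum_false_succ_succ (l x : ℕ) : floorEnum False (l + 1) (x + 1) =
    floorEnum False (l + 1) x - floorEnum False l x - weakEnum False l x
      - (x : PowerSeries ℚ) * (z * floorEnum False l (x - 1))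
      + ((x + 1 : ℕ) : PowerSeries ℚ) * (z * floorEnum False l x) := by
  rw [floorEnum_succ, floorEnum_succ False l x]
  simp only [false_and, if_false, Nat.add_sub_cancel]
  rcases Nat.lt_or_ge l x with hx | hx
  · rw [Ico_eq_empty_of_le (by omega), Ico_eq_empty_of_le (by omega), weakEnum, if_neg (by omega),
      floorEnum_eq_zero _ _ _ hx.le]
    simp
  · rw [Finset.sum_eq_sum_Ico_succ_bot (show x < l + 1 by omega),
      Finset.sum_eq_sum_Ico_succ_bot (show x < l + 1 by omega), weakEnum, if_pos hx]
    ring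

lemma floorEnum_true_succ_succ (l x : ℕ) : floorEnum True (l + 1) (x + 1) =
    floorEnum True (l + 1) x - floorEnum True l x - weakEnum True l x
      - (x : PowerSeries ℚ) * (z * floorEnum True l (x - 1))
      + ((x + 1 : ℕ) : PowerSeries ℚ) * (z * floorEnum True l x)
      - z * topEnum l x + if x = 0 then 0 else z * topEnum l (x - 1) := by
  rw [floorEnum_succ, floorEnum_succ True l x]
  simp only [true_and, Nat.add_sub_cancel, ne_eq, Nat.add_one_ne_zero, not_false_eq_true, if_true,
    ite_not]
  rcases Nat.lt_or_ge l x with hx | hx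
  · rw [Ico_eq_empty_of_le (by omega), Ico_eq_empty_of_le (by omega), weakEnum,
      if_neg (show ¬ x ≤ l by omega),
      floorEnum_eq_zero _ _ _ hx.le]
    rcases Nat.eq_zero_or_pos x with rfl | hx0
    · omega
    · simp only [if_neg hx0.ne', sum_empty]
      ring
  · rw [Finset.sum_eq_sum_Ico_succ_bot (show x < l + 1 by omega),
      Finset.sum_eq_sum_Ico_succ_bot (show x < l + 1 by omega), weakEnum, if_pos hx]
    ring

/-- The first entry becomes both running maximum and floor, so their difference starts at 0. -/
lemma innerEnum_start (e : Prop) [Decidable e] (l : ℕ) :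
    innerEnum e (l + 1) 0 (l + 1) = weakEnum e l 0 + floorEnum e l 0 := by
  rw [innerEnum_succ_zero, range_eq_Ico, Finset.sum_eq_sum_Ico_succ_bot (by omega), weakEnum,
    if_pos (Nat.zero_le l), floorEnum]
  simp only [Nat.zero_le, inf_of_le_right, zero_add, Nat.sub_zero, add_zero]
  congr 1
  refine Finset.sum_congr rfl fun p hp => ?_
  rw [mem_Ico] at hp
  rw [min_eq_right (by omega)]

end NumberRecurrences

open scoped LaurentSeries RatFunc

/-! ### Laurent series in t, t-adic decay, and bivariate generating functions. -/

section Series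

/-- The embedding of power series into Laurent series. -/
noncomputable abbrev lau : PowerSeries ℚ →+* ℚ⸨X⸩ := HahnSeries.ofPowerSeries ℤ ℚ

/-- The variable `t` of `ℚ((t))`. -/
noncomputable def tL : ℚ⸨X⸩ := lau PowerSeries.X

lemma tL_ne_zero : tL ≠ 0 := by
  rw [tL, map_ne_zero_iff _ HahnSeries.ofPowerSeries_injective]
  exact PowerSeries.X_ne_zero

/-- The Laurent series `a` is `t ^ N` times a power series. -/
def IsSmall (N : ℤ) (a : ℚ⸨X⸩) : Prop := ∃ p : PowerSeries ℚ, a = tL ^ N * lau p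

lemma isSmall_zero (N : ℤ) : IsSmall N 0 := ⟨0, by simp⟩

lemma isSmall_lau (p : PowerSeries ℚ) : IsSmall 0 (lau p) := ⟨p, by simp⟩

lemma IsSmall.add {N : ℤ} {a b : ℚ⸨X⸩} (ha : IsSmall N a) (hb : IsSmall N b) :
    IsSmall N (a + b) := by
  obtain ⟨p, rfl⟩ := ha
  obtain ⟨q, rfl⟩ := hb
  exact ⟨p + q, by rw [map_add]; ring⟩

lemma IsSmall.neg {N : ℤ} {a : ℚ⸨X⸩} (ha : IsSmall N a) : IsSmall N (-a) := by
  obtain ⟨p, rfl⟩ := ha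
  exact ⟨-p, by rw [map_neg]; ring⟩

lemma IsSmall.mul {N M : ℤ} {a b : ℚ⸨X⸩} (ha : IsSmall N a) (hb : IsSmall M b) :
    IsSmall (N + M) (a * b) := by
  obtain ⟨p, rfl⟩ := ha
  obtain ⟨q, rfl⟩ := hb
  exact ⟨p * q, by rw [map_mul, zpow_add₀ tL_ne_zero]; ring⟩

lemma isSmall_zpow (N : ℤ) : IsSmall N (tL ^ N) := ⟨1, by simp⟩

lemma IsSmall.mono {N M : ℤ} {a : ℚ⸨X⸩} (ha : IsSmall N a) (h : M ≤ N) : IsSmall M a := by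
  obtain ⟨p, rfl⟩ := ha
  obtain ⟨n, rfl⟩ := Int.le.dest h
  refine ⟨PowerSeries.X ^ n * p, ?_⟩
  rw [map_mul, map_pow, zpow_add₀ tL_ne_zero, zpow_natCast]
  change _ = _ * (tL ^ n * _)
  ring

lemma IsSmall.sum {ι : Type*} {N : ℤ} {s : Finset ι} {a : ι → ℚ⸨X⸩}
    (h : ∀ i ∈ s, IsSmall N (a i)) : IsSmall N (∑ i ∈ s, a i) := by
  classical
  induction s using Finset.induction_on with
  | empty => simpa using isSmall_zero N
  | insert i s hi ih =>
    rw [Finset.sum_insert hi]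
    exact (h i (mem_insert_self _ _)).add (ih fun j hj => h j (mem_insert_of_mem hj))

lemma exists_isSmall (a : ℚ⸨X⸩) : ∃ N, IsSmall N a := by
  obtain ⟨⟨p, x, n, rfl⟩, hp⟩ := IsLocalization.surj
    (Submonoid.powers (PowerSeries.X : PowerSeries ℚ)) a
  refine ⟨-n, p, ?_⟩
  change a * lau (PowerSeries.X ^ n) = lau p at hp
  rw [← hp, map_pow, zpow_neg, zpow_natCast]
  change a = (tL ^ n)⁻¹ * (a * tL ^ n)
  have := tL_ne_zero
  field_simp

lemma eq_zero_of_isSmall {a : ℚ⸨X⸩} (h : ∀ N : ℕ, IsSmall N a) : a = 0 := by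
  obtain ⟨p, rfl⟩ := h 0
  have hp : p = 0 := by
    ext n
    obtain ⟨q, hq⟩ := h (n + 1)
    have : p = PowerSeries.X ^ (n + 1) * q := by
      apply HahnSeries.ofPowerSeries_injective (Γ := ℤ)
      change lau p = lau _
      rw [map_mul, map_pow]
      rw [Nat.cast_zero, zpow_zero, one_mul, zpow_natCast] at hq
      exact hq
    rw [this, PowerSeries.coeff_X_pow_mul']
    simp
  simp [hp]

/-- A unit of `ℚ[[t]]` does not change smallness. -/
lemma IsSmall.of_mul_lau {N : ℤ} {a : ℚ⸨X⸩} {u : PowerSeries ℚ} (hu : IsUnit u)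
    (h : IsSmall N (a * lau u)) : IsSmall N a := by
  obtain ⟨v, hv⟩ := hu.exists_right_inv
  have := h.mul (isSmall_lau v)
  rwa [add_zero, mul_assoc, ← map_mul, hv, map_one, mul_one] at this

/-- The coefficients of `X D` have order at least `D`, up to constants. -/
def IsNull (X : ℕ → PowerSeries ℚ⸨X⸩) : Prop :=
  ∀ r, ∃ c : ℤ, ∀ D : ℕ, IsSmall (D - c) (PowerSeries.coeff r (X D))

/-- The coefficients of `X D` have order bounded below uniformly in `D`. -/
def IsBdd (X : ℕ → PowerSeries ℚ⸨X⸩) : Prop :=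
  ∀ r, ∃ c : ℤ, ∀ D : ℕ, IsSmall (-c) (PowerSeries.coeff r (X D))

lemma isBdd_const (A : PowerSeries ℚ⸨X⸩) : IsBdd fun _ => A := by
  intro r
  obtain ⟨N, hN⟩ := exists_isSmall (PowerSeries.coeff r A)
  exact ⟨-N, fun D => by simpa using hN⟩

lemma IsNull.add {X Y : ℕ → PowerSeries ℚ⸨X⸩} (hX : IsNull X) (hY : IsNull Y) :
    IsNull fun D => X D + Y D := by
  intro r
  obtain ⟨c, hc⟩ := hX r
  obtain ⟨d, hd⟩ := hY r
  refine ⟨max c d, fun D => ?_⟩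
  rw [map_add]
  exact ((hc D).mono (by omega)).add ((hd D).mono (by omega))

lemma IsNull.neg {X : ℕ → PowerSeries ℚ⸨X⸩} (hX : IsNull X) : IsNull fun D => -X D := by
  intro r
  obtain ⟨c, hc⟩ := hX r
  exact ⟨c, fun D => by rw [map_neg]; exact (hc D).neg⟩

lemma IsNull.sub {X Y : ℕ → PowerSeries ℚ⸨X⸩} (hX : IsNull X) (hY : IsNull Y) :
    IsNull fun D => X D - Y D :=
  funext (fun D => (sub_eq_add_neg (X D) (Y D)).symm) ▸ hX.add hY.neg

lemma IsNull.mul {X Y : ℕ → PowerSeries ℚ⸨X⸩} (hX : IsNull X) (hY : IsBdd Y) :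
    IsNull fun D => X D * Y D := by
  intro r
  choose c hc using hX
  choose d hd using hY
  refine ⟨∑ p ∈ antidiagonal r, (|c p.1| + |d p.2|), fun D => ?_⟩
  rw [PowerSeries.coeff_mul]
  refine IsSmall.sum fun p hp => ((hc p.1 D).mul (hd p.2 D)).mono ?_
  have := Finset.single_le_sum (f := fun p : ℕ × ℕ => |c p.1| + |d p.2|)
    (fun i _ => by positivity) hp
  have h1 := le_abs_self (c p.1)
  have h2 := le_abs_self (d p.2)
  linarith

/-- A null solution of a homogeneous first order problem vanishes. -/
lemma eq_zero_of_isSmall_of_unit {a : ℕ → ℚ⸨X⸩} {c : ℤ} (h : ∀ D : ℕ, IsSmall (D - c) (a D))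
    (u : ℕ → PowerSeries ℚ) (hu : ∀ D, IsUnit (u D)) (ha : ∀ D, a D = a 0 * lau (u D)) :
    ∀ D, a D = 0 := by
  have h0 : a 0 = 0 := by
    refine eq_zero_of_isSmall fun N => ?_
    obtain ⟨n, hn⟩ : ∃ n : ℕ, (N : ℤ) + c ≤ n := ⟨(N + c).toNat, Int.self_le_toNat _⟩
    have := h n
    rw [ha n] at this
    exact (this.of_mul_lau (hu n)).mono (by linarith)
  intro D
  rw [ha D, h0, zero_mul]

/-- The generating function in two variables of a sequence of power series. -/
noncomputable def gs (p : ℕ → PowerSeries ℚ) : PowerSeries ℚ⸨X⸩ :=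
  PowerSeries.mk fun r => lau (PowerSeries.mk fun l => PowerSeries.coeff r (p l))

lemma gs_add (p q : ℕ → PowerSeries ℚ) : gs (fun l => p l + q l) = gs p + gs q := by
  ext1 r
  simp only [gs, PowerSeries.coeff_mk, map_add]
  rw [← map_add]
  rfl

lemma gs_sub (p q : ℕ → PowerSeries ℚ) : gs (fun l => p l - q l) = gs p - gs q := by
  ext1 r
  simp only [gs, PowerSeries.coeff_mk, map_sub]
  rw [← map_sub]
  congr 1

lemma gs_X_mul (p : ℕ → PowerSeries ℚ) :
    gs (fun l => PowerSeries.X * p l) = PowerSeries.X * gs p := by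
  ext1 r
  cases r with
  | zero =>
    simp only [gs, PowerSeries.coeff_mk, PowerSeries.coeff_zero_X_mul]
    exact map_zero lau
  | succ r => simp only [gs, PowerSeries.coeff_mk, PowerSeries.coeff_succ_X_mul]

lemma gs_natCast_mul (n : ℕ) (p : ℕ → PowerSeries ℚ) :
    gs (fun l => (n : PowerSeries ℚ) * p l) = (n : PowerSeries ℚ⸨X⸩) * gs p := by
  ext1 r
  simp only [← nsmul_eq_mul, map_nsmul, gs, PowerSeries.coeff_mk]
  rw [← map_nsmul]
  congr 1

lemma gs_zero : gs (fun _ => 0) = 0 := by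
  ext1 r
  simp only [gs, PowerSeries.coeff_mk, map_zero]
  exact map_zero lau

/-- The variable `t`, as a constant of `ℚ((t))[[z]]`. -/
noncomputable def tC : PowerSeries ℚ⸨X⸩ := PowerSeries.C tL

lemma gs_of_zero (p : ℕ → PowerSeries ℚ) (h : p 0 = 0) :
    gs p = tC * gs fun l => p (l + 1) := by
  ext1 r
  simp only [gs, tC, PowerSeries.coeff_mk, PowerSeries.coeff_C_mul, tL, ← map_mul]
  congr 1
  ext l
  cases l with
  | zero => simp [h]
  | succ l => simp [PowerSeries.coeff_succ_X_mul]

lemma gs_ite_zero : gs (fun l => if l = 0 then 1 else 0) = 1 := by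
  ext1 r
  rw [gs, PowerSeries.coeff_mk, PowerSeries.coeff_one]
  split_ifs with h
  · rw [← map_one lau]
    congr 1
    ext l
    rw [PowerSeries.coeff_mk, PowerSeries.coeff_one]
    split_ifs <;> simp [h]
  · rw [← map_zero lau]
    congr 1
    ext l
    rw [PowerSeries.coeff_mk]
    split_ifs <;> simp [PowerSeries.coeff_one, h]

lemma gs_of_one (p : ℕ → PowerSeries ℚ) (h : p 0 = 1) :
    gs p = 1 + tC * gs fun l => p (l + 1) := by
  have h1 := gs_of_zero (fun l => p l - if l = 0 then 1 else 0) (by simp [h])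
  rw [gs_sub, gs_ite_zero] at h1
  simp only [Nat.add_one_ne_zero, if_false, sub_zero] at h1
  rw [← h1]; ring

lemma isNull_gs (p : ℕ → ℕ → PowerSeries ℚ) (h : ∀ D l, l < D → p D l = 0) :
    IsNull fun D => gs (p D) := by
  refine fun r => ⟨0, fun D => ?_⟩
  beta_reduce
  rw [gs, PowerSeries.coeff_mk]
  have h1 : PowerSeries.X ^ D ∣ (PowerSeries.mk fun l => PowerSeries.coeff r (p D l)) := by
    rw [PowerSeries.X_pow_dvd_iff]
    intro m hm
    rw [PowerSeries.coeff_mk, h D m hm, map_zero]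
  obtain ⟨q, hq⟩ := h1
  refine ⟨q, ?_⟩
  rw [hq, map_mul, map_pow, sub_zero, zpow_natCast]
  rfl

end Series

/-! ### Recurrences for the generating functions. -/

section Equations

local notation "Z" => (PowerSeries.X : PowerSeries ℚ⸨X⸩)

/-- Generating function of `weakEnum False`. -/
noncomputable def serV (D : ℕ) : PowerSeries ℚ⸨X⸩ := gs fun l => weakEnum False l D

/-- Generating function of `strictEnum`. -/
noncomputable def serVn (D : ℕ) : PowerSeries ℚ⸨X⸩ := gs fun l => strictEnum l D

/-- The contribution of threshold `D` and size `D`. -/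
noncomputable def serPhi (D : ℕ) : PowerSeries ℚ⸨X⸩ :=
  gs fun l => if l = D then innerEnum True l l 0 else 0

/-- Generating function of `floorEnum`. -/
noncomputable def serS (e : Prop) (x : ℕ) : PowerSeries ℚ⸨X⸩ := gs fun l => floorEnum e l x

/-- Generating function of `topEnum`. -/
noncomputable def serPsi (x : ℕ) : PowerSeries ℚ⸨X⸩ := gs fun l => topEnum l x

/-- The tails of `serPhi`. -/
noncomputable def serTail (x : ℕ) : PowerSeries ℚ⸨X⸩ :=
  gs fun l => if x ≤ l then innerEnum True l l 0 else 0

lemma isNull_serV : IsNull serV :=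
  isNull_gs _ fun D l h => by simp [weakEnum, not_le.2 h]

lemma isNull_serVn : IsNull serVn :=
  isNull_gs _ fun D l h => by simp [strictEnum, not_lt.2 h.le]

lemma isNull_serS (e : Prop) : IsNull (serS e) :=
  isNull_gs _ fun D l h => floorEnum_eq_zero e l D h.le

lemma isNull_serTail : IsNull serTail :=
  isNull_gs _ fun D l h => by simp [not_le.2 h]

lemma serV_one : serV 1 = serV 0 - 1 := by
  rw [serV, serV, gs_of_zero (fun l => weakEnum False l 1) (by simp [weakEnum]),
    gs_of_one (fun l => weakEnum False l 0) (by simp [weakEnum, innerEnum_zero])]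
  simp only [weakEnum_succ_one]
  ring

lemma serV_succ_succ (D : ℕ) : serV (D + 2) =
    (1 + tC * Z * (D + 1)) * serV (D + 1) - tC * (1 + Z * D) * serV D := by
  have h : serV (D + 1) = tC * gs fun l => weakEnum False (l + 1) (D + 1) :=
    gs_of_zero _ (by simp [weakEnum])
  have h' : serV (D + 2) = tC * gs fun l => weakEnum False (l + 1) (D + 2) :=
    gs_of_zero _ (by simp [weakEnum])
  rw [h']
  simp only [weakEnum_succ_succ_succ, gs_sub, gs_add, gs_natCast_mul, gs_X_mul]
  rw [mul_sub, mul_sub, mul_add, ← h]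
  change serV (D + 1) + tC * (((D + 1 : ℕ) : PowerSeries ℚ⸨X⸩) * (Z * serV (D + 1)))
    - tC * serV D - tC * (D * (Z * serV D)) = _
  push_cast
  ring

lemma serVn_one : serVn 1 = serVn 0 - tC := by
  rw [serVn, serVn, gs_of_zero (fun l => strictEnum l 1) (by simp [strictEnum]),
    gs_of_zero (fun l => strictEnum l 0) (by simp [strictEnum])]
  simp only [strictEnum_succ_one, gs_sub, gs_ite_zero]
  ring

lemma serVn_succ_succ (D : ℕ) : serVn (D + 2) =
    (1 + tC * Z * (D + 1)) * serVn (D + 1) - tC * (1 + Z * D) * serVn D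
      - tC * serPhi (D + 1) := by
  have h : serVn (D + 1) = tC * gs fun l => strictEnum (l + 1) (D + 1) :=
    gs_of_zero _ (by simp [strictEnum])
  have h' : serVn (D + 2) = tC * gs fun l => strictEnum (l + 1) (D + 2) :=
    gs_of_zero _ (by simp [strictEnum])
  rw [h']
  simp only [strictEnum_succ_succ_succ, gs_sub, gs_add, gs_natCast_mul, gs_X_mul]
  rw [mul_sub, mul_sub, mul_sub, mul_add, ← h]
  change serVn (D + 1) + tC * (((D + 1 : ℕ) : PowerSeries ℚ⸨X⸩) * (Z * serVn (D + 1)))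
    - tC * serVn D - tC * (D * (Z * serVn D)) - tC * serPhi (D + 1) = _
  push_cast
  ring

lemma serPhi_zero : serPhi 0 = 1 := by
  rw [← gs_ite_zero, serPhi]
  congr 1
  ext1 l
  split_ifs with h
  · rw [h, innerEnum_zero]
  · rfl

lemma serPhi_succ (D : ℕ) : serPhi (D + 1) =
    tC * (1 + Z * ((D - 1 : ℕ) : PowerSeries ℚ⸨X⸩)) * serPhi D := by
  have h' : serPhi (D + 1) = tC * gs fun l =>
      (fun l => if l = D then innerEnum True l l 0 else 0) l +
        ((D - 1 : ℕ) : PowerSeries ℚ) *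
          (PowerSeries.X * (fun l => if l = D then innerEnum True l l 0 else 0) l) := by
    rw [serPhi, gs_of_zero _ (by simp)]
    congr 2
    ext1 l
    simp only [Nat.add_right_cancel_iff]
    split_ifs with h
    · subst h; rw [innerEnum_diag_succ]
    · ring
  rw [h', gs_add, gs_natCast_mul, gs_X_mul]
  change tC * (serPhi D + _ * (Z * serPhi D)) = _
  ring

lemma serTail_succ (x : ℕ) : serTail x - serTail (x + 1) = serPhi x := by
  rw [serTail, serTail, ← gs_sub, serPhi]
  congr 1
  ext1 l
  split_ifs <;> first | omega | ring

lemma serPsi_zero : serPsi 0 = tC * serTail 0 := by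
  rw [serPsi, gs_of_zero _ (by simp [topEnum])]
  simp only [topEnum_succ_zero]
  simp [serTail]

lemma serPsi_succ (x : ℕ) : serPsi (x + 1) =
    tC * serTail (x + 1) + tC * Z * x * serPsi x := by
  rw [serPsi, gs_of_zero _ (by simp [topEnum])]
  simp only [topEnum_succ_succ, gs_add, gs_natCast_mul, gs_X_mul]
  change tC * (serTail (x + 1) + x * (Z * serPsi x)) = _
  ring

lemma serS_false_succ (x : ℕ) : serS False (x + 1) =
    (1 - tC + tC * Z * (x + 1)) * serS False x - tC * Z * x * serS False (x - 1)
      - tC * serV x := by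
  have h : ∀ x, serS False x = tC * gs fun l => floorEnum False (l + 1) x :=
    fun x => gs_of_zero _ (floorEnum_zero_left _ _)
  rw [h (x + 1)]
  simp only [floorEnum_false_succ_succ, gs_sub, gs_add, gs_natCast_mul, gs_X_mul]
  rw [mul_add, mul_sub, mul_sub, mul_sub, ← h]
  change serS False x - tC * serS False x - tC * serV x - tC * (x * (Z * serS False (x - 1)))
    + tC * (((x + 1 : ℕ) : PowerSeries ℚ⸨X⸩) * (Z * serS False x)) = _
  push_cast
  ring

lemma gs_weakEnum_true (D : ℕ) : gs (fun l => weakEnum True l D) = serVn D + serPhi D := by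
  simp only [weakEnum_true, gs_add]
  rfl

lemma serS_true_succ (x : ℕ) : serS True (x + 1) =
    (1 - tC + tC * Z * (x + 1)) * serS True x - tC * Z * x * serS True (x - 1)
      - tC * (serVn x + serPhi x) - tC * Z * serPsi x
      + if x = 0 then 0 else tC * Z * serPsi (x - 1) := by
  have h : ∀ x, serS True x = tC * gs fun l => floorEnum True (l + 1) x :=
    fun x => gs_of_zero _ (floorEnum_zero_left _ _)
  have h1 : gs (fun l => if x = 0 then 0 else PowerSeries.X * topEnum l (x - 1)) =
      if x = 0 then 0 else Z * serPsi (x - 1) := by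
    split_ifs
    · exact gs_zero
    · exact gs_X_mul _
  rw [h (x + 1)]
  simp only [floorEnum_true_succ_succ, gs_sub, gs_add, gs_natCast_mul, gs_X_mul, h1]
  rw [mul_add, mul_sub, mul_add, mul_sub, mul_sub, mul_sub, ← h, gs_weakEnum_true]
  change serS True x - tC * serS True x - tC * (serVn x + serPhi x)
    - tC * (x * (Z * serS True (x - 1)))
    + tC * (((x + 1 : ℕ) : PowerSeries ℚ⸨X⸩) * (Z * serS True x)) - tC * (Z * serPsi x) + _ = _
  push_cast
  split_ifs <;> ring

/-- The generating function of all permutations in question, by size. -/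
noncomputable def serF : PowerSeries ℚ⸨X⸩ := gs fun l => innerEnum True l 0 l

lemma serF_eq : serF = 1 + tC * (serVn 0 + serPhi 0 + serS True 0) := by
  rw [serF, gs_of_one (fun l => innerEnum True l 0 l) (innerEnum_zero _ _ _)]
  simp only [innerEnum_start, gs_add, gs_weakEnum_true]
  rfl

/-- By `innerEnum_symm`, floor 0 with the end condition counts the same as the full floor without
it. This is the extra relation that later eliminates `serS False 0`. -/
lemma serVn_add_serPhi_eq : serVn 0 + serPhi 0 = 1 + tC * (serV 0 + serS False 0) := by
  have h : (fun l => weakEnum True l 0) = fun l => innerEnum False l 0 l := by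
    ext1 l
    rw [innerEnum_symm, weakEnum, if_pos (Nat.zero_le _)]
  rw [← gs_weakEnum_true, h, gs_of_one (fun l => innerEnum False l 0 l) (innerEnum_zero _ _ _)]
  simp only [innerEnum_start, gs_add]
  rfl

end Equations

/-! ### Decaying solutions of the homogeneous recurrences vanish. -/

section Uniqueness

local notation "Z" => (PowerSeries.X : PowerSeries ℚ⸨X⸩)

lemma coeff_tC_mul (r : ℕ) (A : PowerSeries ℚ⸨X⸩) :
    PowerSeries.coeff r (tC * A) = tL * PowerSeries.coeff r A := by
  rw [tC, PowerSeries.coeff_C_mul]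

lemma coeff_natCast_mul (r n : ℕ) (A : PowerSeries ℚ⸨X⸩) :
    PowerSeries.coeff r ((n : PowerSeries ℚ⸨X⸩) * A) = n * PowerSeries.coeff r A := by
  rw [← nsmul_eq_mul, map_nsmul, nsmul_eq_mul]

/-- The fundamental solution of `u (D + 2) = u (D + 1) - t u D`. -/
noncomputable def fundSol : ℕ → PowerSeries ℚ
  | 0 => 1
  | 1 => 1
  | D + 2 => fundSol (D + 1) - PowerSeries.X * fundSol D

lemma isUnit_fundSol (D : ℕ) : IsUnit (fundSol D) := by
  have h : ∀ D, PowerSeries.constantCoeff (fundSol D) = 1 ∧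
      PowerSeries.constantCoeff (fundSol (D + 1)) = 1 := by
    intro D
    induction D with
    | zero => simp [fundSol]
    | succ D ih => exact ⟨ih.2, by simp [fundSol, ih.2]⟩
  rw [PowerSeries.isUnit_iff_constantCoeff, (h D).1]
  exact isUnit_one

/-- Each term is `a 0` times a series with constant term 1, so its order in t cannot grow with `D`
unless `a 0` vanishes. -/
lemma eq_zero_of_second_order {a : ℕ → ℚ⸨X⸩} {c : ℤ} (hs : ∀ D : ℕ, IsSmall (D - c) (a D))
    (h1 : a 1 = a 0) (h : ∀ D, a (D + 2) = a (D + 1) - tL * a D) : ∀ D, a D = 0 := by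
  refine eq_zero_of_isSmall_of_unit hs fundSol isUnit_fundSol ?_
  have : ∀ D, a D = a 0 * lau (fundSol D) ∧ a (D + 1) = a 0 * lau (fundSol (D + 1)) := by
    intro D
    induction D with
    | zero => simp [fundSol, h1]
    | succ D ih =>
      refine ⟨ih.2, ?_⟩
      rw [h D, ih.1, ih.2, fundSol, map_sub, map_mul]
      change _ = _ * (_ - tL * _)
      ring
  exact fun D => (this D).1

lemma eq_zero_of_first_order {a : ℕ → ℚ⸨X⸩} {c : ℤ} (hs : ∀ D : ℕ, IsSmall (D - c) (a D))
    (h : ∀ D, a (D + 1) = (1 - tL) * a D) : ∀ D, a D = 0 := by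
  refine eq_zero_of_isSmall_of_unit hs (fun D => (1 - PowerSeries.X) ^ D) (fun D => ?_) fun D => ?_
  · refine IsUnit.pow _ ?_
    rw [PowerSeries.isUnit_iff_constantCoeff]
    simp
  · induction D with
    | zero => simp
    | succ D ih =>
      rw [h D, ih, pow_succ, map_mul, map_sub, map_one]
      change (1 - tL) * _ = _ * (_ * (1 - tL))
      ring

/-- Induction on the power of z: every coefficient depending on `D` carries a factor z and so meets
only lower coefficients, already zero. What remains has constant coefficients. -/
lemma eq_zero_of_serV_type {A : ℕ → PowerSeries ℚ⸨X⸩} (hA : IsNull A) (h1 : A 1 = A 0)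
    (h : ∀ D : ℕ, A (D + 2) =
      (1 + tC * Z * (D + 1)) * A (D + 1) - tC * (1 + Z * D) * A D) : ∀ D, A D = 0 := by
  have key : ∀ r D, PowerSeries.coeff r (A D) = 0 := by
    intro r
    induction r with
    | zero =>
      obtain ⟨c, hc⟩ := hA 0
      refine eq_zero_of_second_order hc (by rw [h1]) fun D => ?_
      have : A (D + 2) = A (D + 1) - tC * A D +
          Z * (tC * (((D + 1 : ℕ) : PowerSeries ℚ⸨X⸩) * A (D + 1)) - tC * (D * A D)) := by
        rw [h]; push_cast; ring
      rw [this, map_add, PowerSeries.coeff_zero_X_mul, map_sub, coeff_tC_mul, add_zero]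
    | succ r ih =>
      obtain ⟨c, hc⟩ := hA (r + 1)
      refine eq_zero_of_second_order hc (by rw [h1]) fun D => ?_
      have : A (D + 2) = A (D + 1) - tC * A D +
          Z * (tC * (((D + 1 : ℕ) : PowerSeries ℚ⸨X⸩) * A (D + 1)) - tC * (D * A D)) := by
        rw [h]; push_cast; ring
      rw [this, map_add, PowerSeries.coeff_succ_X_mul, map_sub, map_sub, coeff_tC_mul,
        coeff_tC_mul, coeff_tC_mul, coeff_natCast_mul, coeff_natCast_mul, ih, ih]
      ring
  intro D
  ext r
  rw [key r D, map_zero]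

lemma eq_zero_of_serS_type {A : ℕ → PowerSeries ℚ⸨X⸩} (hA : IsNull A)
    (h : ∀ x : ℕ, A (x + 1) =
      (1 - tC + tC * Z * (x + 1)) * A x - tC * Z * x * A (x - 1)) : ∀ x, A x = 0 := by
  have key : ∀ r D, PowerSeries.coeff r (A D) = 0 := by
    intro r
    have h' : ∀ x, A (x + 1) = A x - tC * A x +
          Z * (tC * (((x + 1 : ℕ) : PowerSeries ℚ⸨X⸩) * A x) - tC * (x * A (x - 1))) := by
      intro x
      rw [h]; push_cast; ring
    induction r with
    | zero =>
      obtain ⟨c, hc⟩ := hA 0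
      refine eq_zero_of_first_order hc fun x => ?_
      rw [h', map_add, PowerSeries.coeff_zero_X_mul, map_sub, coeff_tC_mul, add_zero]
      ring
    | succ r ih =>
      obtain ⟨c, hc⟩ := hA (r + 1)
      refine eq_zero_of_first_order hc fun x => ?_
      rw [h', map_add, PowerSeries.coeff_succ_X_mul, map_sub, map_sub, coeff_tC_mul,
        coeff_tC_mul, coeff_tC_mul, coeff_natCast_mul, coeff_natCast_mul, ih, ih]
      ring
  intro D
  ext r
  rw [key r D, map_zero]

end Uniqueness

/-! ### Removing the end condition, and the shape of the generating function. -/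

section Solution

local notation "Z" => (PowerSeries.X : PowerSeries ℚ⸨X⸩)

/-- The product `t ^ D * ∏_{i < D} (1 + i z)`. -/
noncomputable def serW (D : ℕ) : PowerSeries ℚ⸨X⸩ := tC ^ D * ∏ i ∈ range D, (1 + Z * i)

lemma serW_zero : serW 0 = 1 := by simp [serW]

lemma serW_succ (D : ℕ) : serW (D + 1) = tC * (1 + Z * D) * serW D := by
  rw [serW, serW, prod_range_succ]; ring

lemma serPhi_succ_eq (D : ℕ) : serPhi (D + 1) = tC * serW D := by
  induction D with
  | zero => simp [serPhi_succ, serPhi_zero, serW_zero]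
  | succ D ih => rw [serPhi_succ, ih, serW_succ, Nat.add_sub_cancel]; ring

lemma isNull_serW : IsNull serW := by
  intro r
  refine ⟨0, fun D => ?_⟩
  have : serW D = tC ^ D * PowerSeries.map lau
      (∏ i ∈ range D, (1 + PowerSeries.X * (i : PowerSeries (PowerSeries ℚ)))) := by
    rw [serW, map_prod]
    simp
  rw [this, tC, ← map_pow, PowerSeries.coeff_C_mul, PowerSeries.coeff_map]
  refine ⟨PowerSeries.coeff r
    (∏ i ∈ range D, (1 + PowerSeries.X * (i : PowerSeries (PowerSeries ℚ)))), ?_⟩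
  rw [sub_zero, zpow_natCast]

/-- The constant `Φ` attached to a solution `b` of the auxiliary equation. -/
noncomputable def connection (b : ℕ → PowerSeries ℚ⸨X⸩) : PowerSeries ℚ⸨X⸩ :=
  tC + tC * b 1 - b 0

/-- `b` solves the auxiliary equation for the end condition. -/
def IsEndSolution (b : ℕ → PowerSeries ℚ⸨X⸩) : Prop :=
  ∀ D : ℕ, (1 + Z * D) * (tC * (1 + Z * (D + 1)) * b (D + 2) - (1 + tC * Z * (D + 1)) * b (D + 1)
    + b D) = - tC

/-- `Y` solves the auxiliary equation for the floor condition. -/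
def IsFloorSolution (b Y : ℕ → PowerSeries ℚ⸨X⸩) : Prop :=
  ∀ x : ℕ, Y (x + 1) = (1 - tC + tC * Z * (x + 1)) * Y x - tC * Z * x * Y (x - 1)
    - tC * (serW x * b x + serPhi x) - tC * Z * serPsi x
    + if x = 0 then 0 else tC * Z * serPsi (x - 1)

variable {b Y : ℕ → PowerSeries ℚ⸨X⸩}

/-- The source of the strict recurrence is a multiple of `serW D`, so a particular solution `serW D
* b D` is sought. The initial conditions at 0 and 1 force the value of `connection b`. -/
lemma serVn_eq (hb : IsBdd b) (hb' : IsEndSolution b) (D : ℕ) :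
    serVn D = connection b * serV D + serW D * b D := by
  have h := eq_zero_of_serV_type (A := fun D => serVn D - serV D * connection b - serW D * b D)
    ((isNull_serVn.sub (isNull_serV.mul (isBdd_const (connection b)))).sub (isNull_serW.mul hb))
    (by
      simp only [serVn_one, serV_one, serW_succ, serW_zero, connection]
      push_cast
      ring)
    (fun D => by
      simp only [serVn_succ_succ, serV_succ_succ, serW_succ, serPhi_succ_eq]
      have := hb' D
      push_cast
      linear_combination (-tC * serW D) * this) D
  linear_combination h

/-- By `serVn_eq`, the source here is `connection b` times the unconditioned source plus the terms
absorbed by `Y`. Decay alone gives uniqueness, so no new constant appears. -/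
lemma serS_true_eq (hb : IsBdd b) (hb' : IsEndSolution b) (hY : IsNull Y)
    (hY' : IsFloorSolution b Y) (x : ℕ) : serS True x = connection b * serS False x + Y x := by
  have h := eq_zero_of_serS_type (A := fun x => serS True x - serS False x * connection b - Y x)
    (((isNull_serS True).sub ((isNull_serS False).mul (isBdd_const (connection b)))).sub hY)
    (fun x => by
      simp only [serS_true_succ, serS_false_succ, hY' x, serVn_eq hb hb']
      ring) x
  linear_combination h

/-- The structure of the generating function. -/
theorem serF_structure (hb : IsBdd b) (hb' : IsEndSolution b) (hY : IsNull Y)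
    (hY' : IsFloorSolution b Y) : serF = connection b ^ 2 * serV 0 +
      (connection b * b 0 + 1 + tC * (1 + b 0 + Y 0)) := by
  have h1 := serVn_add_serPhi_eq
  rw [serF_eq, serS_true_eq hb hb' hY hY']
  rw [serVn_eq hb hb', serW_zero, serPhi_zero] at h1 ⊢
  -- The symmetry relation replaces `serS False 0`. The two terms with tΦV(0) cancel, and V(0)
  -- survives only with the factor Φ².
  linear_combination (-connection b) * h1

end Solution

/-! ### Polynomial functions on ℕ via finite differences. -/

section PolyFun

variable {R : Type*} [CommRing R]

/-- `f` is killed by the `d`-th power of the forward difference operator. -/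
def IsPolyDeg : ℕ → (ℕ → R) → Prop
  | 0, f => ∀ x, f x = 0
  | d + 1, f => IsPolyDeg d fun x => f (x + 1) - f x

lemma IsPolyDeg.congr {d : ℕ} {f g : ℕ → R} (hf : IsPolyDeg d f) (h : ∀ x, f x = g x) :
    IsPolyDeg d g := by
  rwa [← funext h]

lemma isPolyDeg_zero (d : ℕ) : IsPolyDeg d fun _ => (0 : R) := by
  induction d with
  | zero => exact fun _ => rfl
  | succ d ih => exact ih.congr fun x => by simp

lemma IsPolyDeg.succ {d : ℕ} {f : ℕ → R} (hf : IsPolyDeg d f) : IsPolyDeg (d + 1) f := by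
  induction d generalizing f with
  | zero => exact fun x => by simp [hf _]
  | succ d ih => exact ih hf

lemma IsPolyDeg.mono {d e : ℕ} {f : ℕ → R} (hf : IsPolyDeg d f) (h : d ≤ e) : IsPolyDeg e f := by
  induction h with
  | refl => exact hf
  | step _ ih => exact ih.succ

lemma IsPolyDeg.add {d : ℕ} {f g : ℕ → R} (hf : IsPolyDeg d f) (hg : IsPolyDeg d g) :
    IsPolyDeg d fun x => f x + g x := by
  induction d generalizing f g with
  | zero => exact fun x => by simp [hf x, hg x]
  | succ d ih => exact (ih hf hg).congr fun x => by ring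

lemma IsPolyDeg.shift {d : ℕ} {f : ℕ → R} (hf : IsPolyDeg d f) :
    IsPolyDeg d fun x => f (x + 1) := by
  induction d generalizing f with
  | zero => exact fun x => hf _
  | succ d ih => exact ih hf

lemma IsPolyDeg.const_mul {d : ℕ} {f : ℕ → R} (hf : IsPolyDeg d f) (c : R) :
    IsPolyDeg d fun x => c * f x := by
  induction d generalizing f with
  | zero => exact fun x => by simp [hf x]
  | succ d ih => exact (ih hf).congr fun x => by ring

/-- Leibniz rule: Δ(fg) = Δf · g(x + 1) + f · Δg, and both products have smaller total degree. -/
lemma IsPolyDeg.mul {d e : ℕ} {f g : ℕ → R} (hf : IsPolyDeg d f) (hg : IsPolyDeg e g) :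
    IsPolyDeg (d + e) fun x => f x * g x := by
  obtain ⟨n, hn⟩ : ∃ n, n = d + e := ⟨_, rfl⟩
  induction n generalizing d e f g with
  | zero =>
    obtain rfl : d = 0 := by omega
    exact (isPolyDeg_zero _).congr fun x => by simp [hf x]
  | succ n ih =>
    cases d with
    | zero => exact (isPolyDeg_zero _).congr fun x => by simp [hf x]
    | succ d =>
      cases e with
      | zero => exact (isPolyDeg_zero _).congr fun x => by simp [hg x]
      | succ e =>
        have h1 := ih (d := d) (e := e + 1) hf hg.shift (by omega)
        have h2 := ih (d := d + 1) (e := e) hf hg (by omega)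
        rw [show d + 1 + e = d + (e + 1) by omega] at h2
        rw [show d + 1 + (e + 1) = d + (e + 1) + 1 by omega]
        change IsPolyDeg (d + (e + 1)) fun x => f (x + 1) * g (x + 1) - f x * g x
        exact (h1.add h2).congr fun x => by ring

/-- `f` is a polynomial function, in the sense that iterated differences kill it. -/
def IsPoly (f : ℕ → R) : Prop := ∃ d, IsPolyDeg d f

lemma IsPoly.congr {f g : ℕ → R} (hf : IsPoly f) (h : ∀ x, f x = g x) : IsPoly g := by
  rwa [← funext h]

lemma isPoly_const (c : R) : IsPoly fun _ => c := ⟨1, fun x => by simp⟩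

lemma isPoly_natCast : IsPoly fun x => (x : R) :=
  ⟨2, fun x => by push_cast; ring⟩

lemma IsPoly.add {f g : ℕ → R} (hf : IsPoly f) (hg : IsPoly g) : IsPoly fun x => f x + g x := by
  obtain ⟨d, hd⟩ := hf
  obtain ⟨e, he⟩ := hg
  exact ⟨max d e, (hd.mono (le_max_left _ _)).add (he.mono (le_max_right _ _))⟩

lemma IsPoly.mul {f g : ℕ → R} (hf : IsPoly f) (hg : IsPoly g) : IsPoly fun x => f x * g x := by
  obtain ⟨d, hd⟩ := hf
  obtain ⟨e, he⟩ := hg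
  exact ⟨d + e, hd.mul he⟩

lemma IsPoly.sub {f g : ℕ → R} (hf : IsPoly f) (hg : IsPoly g) : IsPoly fun x => f x - g x :=
  (hf.add ((isPoly_const (-1)).mul hg)).congr fun x => by ring

lemma IsPoly.shift {f : ℕ → R} (hf : IsPoly f) : IsPoly fun x => f (x + 1) :=
  hf.imp fun _ h => h.shift

lemma IsPoly.sum_range {f : ℕ → R} (hf : IsPoly f) : IsPoly fun x => ∑ i ∈ range x, f i := by
  obtain ⟨d, hd⟩ := hf
  refine ⟨d + 1, ?_⟩
  refine IsPolyDeg.congr (d := d) (f := f) hd fun x => ?_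
  beta_reduce
  rw [sum_range_succ]; ring

/-- The operator a + cΔ is inverted by a geometric series in Δ, which terminates on polynomial
functions. -/
lemma IsPoly.exists_solution {h : ℕ → R} (hh : IsPoly h) {a : R} (ha : IsUnit a) (c : R) :
    ∃ p, IsPoly p ∧ ∀ x, a * p x + c * (p (x + 1) - p x) = h x := by
  obtain ⟨v, hv⟩ := ha.exists_right_inv
  obtain ⟨d, hd⟩ := hh
  induction d generalizing h with
  | zero => exact ⟨fun _ => 0, isPoly_const 0, fun x => by simp [hd x]⟩
  | succ d ih =>
    obtain ⟨p, hp, hp'⟩ := ih (IsPolyDeg.const_mul hd (-c * v))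
    refine ⟨fun x => v * h x + p x, ((isPoly_const v).mul ⟨_, hd⟩).add hp, fun x => ?_⟩
    linear_combination hp' x + h x * hv

end PolyFun

/-! ### Sequences that are eventually t^x times a polynomial in x. -/

section EventuallyExpPoly

variable {F : Type*} [Field F] {t : F}

/-- Eventually, `f x` is `t ^ x` times a polynomial function of `x`. -/
def IsExpPoly (t : F) (f : ℕ → F) : Prop :=
  ∃ N, ∃ p, IsPoly p ∧ ∀ x, N ≤ x → f x = t ^ x * p x

lemma IsExpPoly.congr {f g : ℕ → F} (hf : IsExpPoly t f) (h : ∀ x, f x = g x) :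
    IsExpPoly t g := by
  rwa [← funext h]

lemma IsExpPoly.add {f g : ℕ → F} (hf : IsExpPoly t f) (hg : IsExpPoly t g) :
    IsExpPoly t fun x => f x + g x := by
  obtain ⟨N, p, hp, hf⟩ := hf
  obtain ⟨M, q, hq, hg⟩ := hg
  refine ⟨max N M, _, hp.add hq, fun x hx => ?_⟩
  beta_reduce
  rw [hf x (by omega), hg x (by omega)]; ring

lemma IsExpPoly.poly_mul {f q : ℕ → F} (hf : IsExpPoly t f) (hq : IsPoly q) :
    IsExpPoly t fun x => q x * f x := by
  obtain ⟨N, p, hp, hf⟩ := hf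
  refine ⟨N, _, hq.mul hp, fun x hx => ?_⟩
  beta_reduce
  rw [hf x hx]; ring

lemma IsExpPoly.const_mul {f : ℕ → F} (hf : IsExpPoly t f) (c : F) :
    IsExpPoly t fun x => c * f x := hf.poly_mul (isPoly_const c)

lemma IsExpPoly.sub {f g : ℕ → F} (hf : IsExpPoly t f) (hg : IsExpPoly t g) :
    IsExpPoly t fun x => f x - g x :=
  (hf.add (hg.const_mul (-1))).congr fun x => by ring

lemma isExpPoly_of_eventually_zero {f : ℕ → F} {N : ℕ} (h : ∀ x, N ≤ x → f x = 0) :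
    IsExpPoly t f :=
  ⟨N, _, isPoly_const 0, fun x hx => by rw [h x hx, mul_zero]⟩

/-- If `g x = f (x - 1)` for large `x` and `f` is eventually exponential-polynomial, so is `g`. -/
lemma IsExpPoly.of_shift (ht : t ≠ 0) {f g : ℕ → F} (hf : IsExpPoly t f)
    (h : ∀ x, g (x + 1) = f x) : IsExpPoly t g := by
  obtain ⟨N, p, hp, hf⟩ := hf
  obtain ⟨q, hq, hq'⟩ := hp.exists_solution isUnit_one 1
  refine ⟨N + 1, _, (isPoly_const t⁻¹).mul hq, fun x hx => ?_⟩
  obtain ⟨y, rfl⟩ : ∃ y, x = y + 1 := ⟨x - 1, by omega⟩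
  rw [h, hf y (by omega), ← hq']
  field_simp
  ring

/-- A source of finite support is removed from the top down: the value -g(N)/α at N absorbs the
source at N and moves a multiple of it to N - 1. -/
lemma exists_finite_solution {α : F} (hα : α ≠ 0) (N : ℕ) (g : ℕ → F)
    (hg : ∀ x, N ≤ x → g x = 0) :
    ∃ Y : ℕ → F, (∀ x, N ≤ x → Y x = 0) ∧ ∀ x, Y (x + 1) - α * Y x = g x := by
  induction N generalizing g with
  | zero => exact ⟨fun _ => 0, fun _ _ => rfl, fun x => by simp [hg x]⟩
  | succ N ih =>
    obtain ⟨Y, hY, hY'⟩ := ih (fun x => g x - (g N * (if x = N then 1 else 0) -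
      g N / α * (if x + 1 = N then 1 else 0))) fun x hx => by
        rcases hx.eq_or_lt with rfl | hx
        · simp
        · rw [hg x hx, if_neg (by omega), if_neg (by omega)]; simp
    refine ⟨fun x => Y x - g N / α * (if x = N then 1 else 0), fun x hx => ?_, fun x => ?_⟩
    · beta_reduce
      rw [hY x (by omega), if_neg (by omega)]; simp
    · have := hY' x
      field_simp at this ⊢
      linear_combination this

/-- The ansatz t^x q(x) gives (t - α)q + tΔq = p, solvable since α ≠ t. Finitely many exceptional x
are then corrected. -/
lemma IsExpPoly.exists_solution {h : ℕ → F} (hh : IsExpPoly t h) {α : F}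
    (hα : α ≠ 0) (hαt : α ≠ t) :
    ∃ Y, IsExpPoly t Y ∧ ∀ x, Y (x + 1) - α * Y x = h x := by
  obtain ⟨N, p, hp, hh⟩ := hh
  obtain ⟨q, hq, hq'⟩ := hp.exists_solution (sub_ne_zero.2 hαt.symm).isUnit t
  obtain ⟨Y, hY, hY'⟩ := exists_finite_solution hα N
    (fun x => h x - (t ^ (x + 1) * q (x + 1) - α * (t ^ x * q x))) fun x hx => by
      rw [hh x hx, ← hq']; ring
  refine ⟨fun x => t ^ x * q x + Y x,
    IsExpPoly.add ⟨0, q, hq, fun _ _ => rfl⟩ (isExpPoly_of_eventually_zero hY), fun x => ?_⟩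
  linear_combination hY' x

end EventuallyExpPoly

/-! ### Exponential polynomials over ℚ(t) decay t-adically. -/

section Null

lemma algebraMap_ratFunc_polynomial (p : Polynomial ℚ) :
    algebraMap (RatFunc ℚ) ℚ⸨X⸩ (algebraMap (Polynomial ℚ) (RatFunc ℚ) p) =
      lau (p : PowerSeries ℚ) := by
  rw [← IsScalarTower.algebraMap_apply]
  rfl

lemma algebraMap_ratFunc_X : algebraMap (RatFunc ℚ) ℚ⸨X⸩ RatFunc.X = tL := by
  rw [← RatFunc.algebraMap_X, algebraMap_ratFunc_polynomial, Polynomial.coe_X, tL]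

lemma IsPoly.exists_isSmall {p : ℕ → RatFunc ℚ} (hp : IsPoly p) :
    ∃ c : ℤ, ∀ x, IsSmall (-c) (algebraMap (RatFunc ℚ) ℚ⸨X⸩ (p x)) := by
  obtain ⟨d, hd⟩ := hp
  induction d generalizing p with
  | zero => exact ⟨0, fun x => by rw [hd x, map_zero]; exact isSmall_zero _⟩
  | succ d ih =>
    obtain ⟨c, hc⟩ := ih hd
    obtain ⟨N, hN⟩ := AlmostSquare.exists_isSmall (algebraMap (RatFunc ℚ) ℚ⸨X⸩ (p 0))
    refine ⟨max c (-N), fun x => ?_⟩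
    induction x with
    | zero => exact hN.mono (by omega)
    | succ x ihx =>
      have := ihx.add ((hc x).mono (show -max c (-N) ≤ -c by omega))
      rwa [← map_add, add_sub_cancel] at this

lemma IsExpPoly.exists_isSmall {f : ℕ → RatFunc ℚ} (hf : IsExpPoly RatFunc.X f) :
    ∃ c : ℤ, ∀ x : ℕ, IsSmall (x - c) (algebraMap (RatFunc ℚ) ℚ⸨X⸩ (f x)) := by
  obtain ⟨N, p, hp, hf⟩ := hf
  obtain ⟨c, hc⟩ := hp.exists_isSmall
  have h1 : ∃ c : ℤ, ∀ x : ℕ, N ≤ x →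
      IsSmall (x - c) (algebraMap (RatFunc ℚ) ℚ⸨X⸩ (f x)) := by
    refine ⟨c, fun x hx => ?_⟩
    rw [hf x hx, map_mul, map_pow, algebraMap_ratFunc_X, ← zpow_natCast]
    exact (isSmall_zpow _).mul (hc x)
  clear hf
  induction N with
  | zero => exact h1.imp fun c hc x => hc x (Nat.zero_le _)
  | succ N ih =>
    obtain ⟨c, hc⟩ := h1
    obtain ⟨M, hM⟩ := AlmostSquare.exists_isSmall (algebraMap (RatFunc ℚ) ℚ⸨X⸩ (f N))
    refine ih ⟨max c (N - M), fun x hx => ?_⟩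
    rcases hx.eq_or_lt with rfl | hx
    · exact hM.mono (by omega)
    · exact (hc x hx).mono (by omega)

end Null

/-! ### The end solution: polynomial in D, with numerators in ℚ[t]. -/

section Jets

local notation "τ" => (Polynomial.X : Polynomial ℚ)

/-- `a j` is the `j`-th difference quotient with step `t` of `a 0`, and `a j = 0` for `j > r`. -/
def IsJet (r : ℕ) (a : ℕ → ℕ → Polynomial ℚ) : Prop :=
  (∀ j D, a j (D + 1) = a j D + τ * a (j + 1) D) ∧ ∀ j D, r < j → a j D = 0

/-- The difference quotients of the product with `t D`. -/
noncomputable def jetMul (a : ℕ → ℕ → Polynomial ℚ) (j D : ℕ) : Polynomial ℚ :=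
  τ * D * a j D + j * (a (j - 1) D + τ * a j D)

/-- The difference quotients of `(-t D) ^ r`. -/
noncomputable def jetPow : ℕ → ℕ → ℕ → Polynomial ℚ
  | 0 => fun j _ => if j = 0 then 1 else 0
  | r + 1 => fun j D => -jetMul (jetPow r) j D

/-- The solution `a` of `a j + (2 t - 1) a (j + 1) + t ^ 2 a (j + 2) = h j` for `j ≤ r` that
vanishes for `j > r`. -/
noncomputable def jetSol (r : ℕ) (h : ℕ → ℕ → Polynomial ℚ) (j D : ℕ) : Polynomial ℚ :=
  if r < j then 0
  else h j D - (2 * τ - 1) * jetSol r h (j + 1) D - τ ^ 2 * jetSol r h (j + 2) D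
termination_by r + 1 - j

/-- The normalized coefficients of the solution of the auxiliary equation for the end condition. -/
noncomputable def endJet : ℕ → ℕ → ℕ → Polynomial ℚ
  | 0 => jetSol 0 (jetPow 0)
  | r + 1 => jetSol (r + 1) fun j D => jetPow (r + 1) j D -
      τ * (jetMul (fun j D => endJet r (j + 1) D + τ * endJet r (j + 2) D) j D +
        τ * (endJet r (j + 1) D + τ * endJet r (j + 2) D))

lemma IsJet.jetMul {r : ℕ} {a : ℕ → ℕ → Polynomial ℚ} (ha : IsJet r a) :
    IsJet (r + 1) (jetMul a) := by
  refine ⟨fun j D => ?_, fun j D hj => ?_⟩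
  · cases j with
    | zero =>
      simp only [AlmostSquare.jetMul, ha.1]
      push_cast
      ring
    | succ j =>
      simp only [AlmostSquare.jetMul, ha.1, Nat.add_sub_cancel]
      push_cast
      ring
  · simp [AlmostSquare.jetMul, ha.2 j D (by omega), ha.2 (j - 1) D (by omega)]

lemma isJet_jetPow (r : ℕ) : IsJet r (jetPow r) := by
  induction r with
  | zero => exact ⟨fun j D => by simp [jetPow], fun j D h => by simp [jetPow, h.ne']⟩
  | succ r ih =>
    refine ⟨fun j D => ?_, fun j D hj => ?_⟩
    · simp only [jetPow, ih.jetMul.1]; ring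
    · simp only [jetPow, ih.jetMul.2 j D hj, neg_zero]

lemma jetSol_of_lt {r : ℕ} (h : ℕ → ℕ → Polynomial ℚ) {j : ℕ} (D : ℕ) (hj : r < j) :
    jetSol r h j D = 0 := by
  rw [jetSol, if_pos hj]

lemma jetSol_eq {r : ℕ} {h : ℕ → ℕ → Polynomial ℚ} (hh : IsJet r h) (j D : ℕ) :
    jetSol r h j D + (2 * τ - 1) * jetSol r h (j + 1) D + τ ^ 2 * jetSol r h (j + 2) D = h j D := by
  by_cases hj : r < j
  · rw [jetSol_of_lt h D hj, jetSol_of_lt h D (by omega), jetSol_of_lt h D (by omega),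
      hh.2 j D hj]
    ring
  · rw [jetSol, if_neg hj]; ring

/-- Downward induction on `j`: the equations at `(j, D + 1)`, `(j, D)` and `(j + 1, D)` combine to
the claim once it is known for `j + 1` and `j + 2`. -/
lemma isJet_jetSol {r : ℕ} {h : ℕ → ℕ → Polynomial ℚ} (hh : IsJet r h) :
    IsJet r (jetSol r h) := by
  refine ⟨?_, fun j D => jetSol_of_lt h D⟩
  have key : ∀ n j D, r < j + n →
      jetSol r h j (D + 1) = jetSol r h j D + τ * jetSol r h (j + 1) D := by
    intro n
    induction n with
    | zero =>
      intro j D hj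
      rw [add_zero] at hj
      rw [jetSol_of_lt h _ hj, jetSol_of_lt h _ hj, jetSol_of_lt h _ (by omega)]
      ring
    | succ n ih =>
      intro j D hj
      have e1 := jetSol_eq hh j (D + 1)
      have e2 := jetSol_eq hh j D
      have e3 := jetSol_eq hh (j + 1) D
      rw [ih (j + 1) D (by omega), ih (j + 2) D (by omega), hh.1] at e1
      linear_combination e1 - e2 - τ * e3
  exact fun j D => key (r + 1) j D (by omega)

/-- The right-hand side of the equation for `endJet (r + 1)`. -/
noncomputable def endRhs (r : ℕ) (j D : ℕ) : Polynomial ℚ :=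
  jetPow (r + 1) j D -
      τ * (jetMul (fun j D => endJet r (j + 1) D + τ * endJet r (j + 2) D) j D +
        τ * (endJet r (j + 1) D + τ * endJet r (j + 2) D))

lemma endJet_succ (r : ℕ) : endJet (r + 1) = jetSol (r + 1) (endRhs r) := by
  rw [endJet]; rfl

lemma isJet_shift {r : ℕ} {a : ℕ → ℕ → Polynomial ℚ} (ha : IsJet r a) :
    IsJet r fun j D => a (j + 1) D + τ * a (j + 2) D :=
  ⟨fun j D => by simp only [ha.1], fun j D h => by
    simp [ha.2 (j + 1) D (by omega), ha.2 (j + 2) D (by omega)]⟩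

lemma isJet_endRhs {r : ℕ} (h : IsJet r (endJet r)) : IsJet (r + 1) (endRhs r) := by
  have h1 := isJet_shift h
  have h2 := h1.jetMul
  have h3 := isJet_jetPow (r + 1)
  refine ⟨fun j D => ?_, fun j D hj => ?_⟩
  · have e1 := h1.1 j D
    have e2 := h2.1 j D
    have e3 := h3.1 j D
    simp only [endRhs]
    linear_combination e3 - τ * (e2 + τ * e1)
  · have e1 := h1.2 j D (by omega)
    have e2 := h2.2 j D hj
    have e3 := h3.2 j D hj
    simp only [endRhs]
    linear_combination e3 - τ * (e2 + τ * e1)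

lemma isJet_endJet (r : ℕ) : IsJet r (endJet r) := by
  induction r with
  | zero => rw [endJet]; exact isJet_jetSol (isJet_jetPow 0)
  | succ r ih => rw [endJet_succ]; exact isJet_jetSol (isJet_endRhs ih)

lemma jetPow_zero_index (r D : ℕ) : jetPow r 0 D = (-(τ * D)) ^ r := by
  induction r with
  | zero => simp [jetPow]
  | succ r ih => simp [jetPow, jetMul, ih, pow_succ']

/-- In difference quotients, t a(D + 2) - a(D + 1) + a(D) equals t times a₀ + (2t - 1)a₁ + t²a₂.
This is the operator that `jetSol` inverts, and the factor t cancels against the right-hand side. -/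
lemma endJet_zero_eq (D : ℕ) :
    τ * endJet 0 0 (D + 2) - endJet 0 0 (D + 1) + endJet 0 0 D = τ := by
  have hj := isJet_endJet 0
  have h1 : endJet 0 0 D + (2 * τ - 1) * endJet 0 1 D + τ ^ 2 * endJet 0 2 D = jetPow 0 0 D := by
    rw [endJet]; exact jetSol_eq (isJet_jetPow 0) 0 D
  rw [hj.1 0 (D + 1), hj.1 0 D, hj.1 (0 + 1) D]
  rw [jetPow_zero_index] at h1
  linear_combination τ * h1

lemma endJet_succ_eq (r D : ℕ) :
    τ * endJet (r + 1) 0 (D + 2) - endJet (r + 1) 0 (D + 1) + endJet (r + 1) 0 D =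
      τ * (-(τ * D)) ^ (r + 1) - τ ^ 2 * (D + 1) * (endJet r 0 (D + 2) - endJet r 0 (D + 1)) := by
  have hj := isJet_endJet (r + 1)
  have hj' := isJet_endJet r
  have h1 : endJet (r + 1) 0 D + (2 * τ - 1) * endJet (r + 1) 1 D + τ ^ 2 * endJet (r + 1) 2 D =
      endRhs r 0 D := by
    rw [endJet_succ]; exact jetSol_eq (isJet_endRhs hj') 0 D
  rw [hj.1 0 (D + 1), hj.1 0 D, hj.1 (0 + 1) D, hj'.1 0 (D + 1), hj'.1 (0 + 1) D]
  simp only [endRhs, jetPow_zero_index, jetMul] at h1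
  push_cast at h1
  linear_combination τ * h1

/-- At t = 0 the recursion reduces to multiplying the entry of index `j - 1` by `-j`, so only the
index `r` survives. -/
lemma coeff_zero_jetPow (r j D : ℕ) : (jetPow r j D).coeff 0 =
    if j = r then (-1) ^ r * (r.factorial : ℚ) else 0 := by
  induction r generalizing j with
  | zero => simp [jetPow]; split_ifs <;> simp
  | succ r ih =>
    have : (jetPow (r + 1) j D).coeff 0 = -(j * (jetPow r (j - 1) D).coeff 0) := by
      simp [jetPow, jetMul, Polynomial.mul_coeff_zero, mul_assoc]
    rw [this, ih]
    rcases Nat.eq_zero_or_pos j with rfl | hj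
    · simp
    · by_cases h : j = r + 1
      · subst h
        rw [if_pos rfl, Nat.add_sub_cancel, if_pos rfl, Nat.factorial_succ]
        push_cast; ring
      · rw [if_neg h, if_neg (by omega)]; simp

/-- At t = 0 the defining equation reads a_j = h_j + a_(j+1), so a_j is the sum of the later h_i, of
which only h_r is nonzero. These values decide the irrationality argument. -/
lemma coeff_zero_endJet (r j D : ℕ) (hj : j ≤ r) :
    (endJet r j D).coeff 0 = (-1) ^ r * (r.factorial : ℚ) := by
  have h1 : ∀ j, (endJet r j D).coeff 0 =
      (jetPow r j D).coeff 0 + (endJet r (j + 1) D).coeff 0 := by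
    intro j
    cases r with
    | zero =>
      have := jetSol_eq (isJet_jetPow 0) j D
      rw [endJet, ← this]
      simp [Polynomial.mul_coeff_zero]
    | succ r =>
      have h2 := jetSol_eq (isJet_endRhs (isJet_endJet r)) j D
      have h3 : (endRhs r j D).coeff 0 = (jetPow (r + 1) j D).coeff 0 := by
        simp [endRhs, Polynomial.mul_coeff_zero]
      rw [← h3, endJet_succ, ← h2]
      simp [Polynomial.mul_coeff_zero]
  obtain ⟨n, hn⟩ := Nat.exists_eq_add_of_le hj
  induction n generalizing j with
  | zero =>
    rw [h1, coeff_zero_jetPow, if_pos (by omega), (isJet_endJet r).2 (j + 1) D (by omega)]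
    simp
  | succ n ih =>
    rw [h1, coeff_zero_jetPow, if_neg (by omega), ih (j + 1) (by omega) (by omega), zero_add]

lemma IsJet.isPoly {r : ℕ} {a : ℕ → ℕ → Polynomial ℚ} (ha : IsJet r a) (j : ℕ) :
    IsPoly (a j) := by
  have key : ∀ n j, r < j + n → IsPolyDeg n (a j) := by
    intro n
    induction n with
    | zero => exact fun j hj D => ha.2 j D hj
    | succ n ih =>
      intro j hj
      refine ((ih (j + 1) (by omega)).const_mul τ).congr (g := fun D => a j (D + 1) - a j D)
        fun D => ?_
      rw [ha.1]; ring
  exact ⟨r + 1, key _ _ (by omega)⟩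

end Jets

/-! ### The auxiliary solutions over ℚ(t). -/

section RationalSeries

local notation "κ" => algebraMap (RatFunc ℚ) ℚ⸨X⸩

local notation "Z" => (PowerSeries.X : PowerSeries (RatFunc ℚ))

/-- The variable `t`, as a constant of `ℚ(t)[[z]]`. -/
noncomputable def tR : PowerSeries (RatFunc ℚ) := PowerSeries.C RatFunc.X

/-- The embedding of `ℚ(t)[[z]]` into `ℚ((t))[[z]]`. -/
noncomputable abbrev serMap : PowerSeries (RatFunc ℚ) →+* PowerSeries ℚ⸨X⸩ := PowerSeries.map κ

lemma serMap_tR : serMap tR = tC := by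
  simp only [serMap, tR, PowerSeries.map_C, algebraMap_ratFunc_X]
  rfl

lemma serMap_X : serMap Z = PowerSeries.X := PowerSeries.map_X _

lemma coeff_tR_mul (r : ℕ) (A : PowerSeries (RatFunc ℚ)) :
    PowerSeries.coeff r (tR * A) = RatFunc.X * PowerSeries.coeff r A := by
  rw [tR, PowerSeries.coeff_C_mul]

lemma coeff_natCast_mul' (r n : ℕ) (A : PowerSeries (RatFunc ℚ)) :
    PowerSeries.coeff r ((n : PowerSeries (RatFunc ℚ)) * A) = n * PowerSeries.coeff r A := by
  rw [← nsmul_eq_mul, map_nsmul, nsmul_eq_mul]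

/-- The coefficients of the solution of the auxiliary equation for the end condition. -/
noncomputable def endCoeff (r D : ℕ) : RatFunc ℚ :=
  -(algebraMap (Polynomial ℚ) (RatFunc ℚ) (endJet r 0 D) / RatFunc.X ^ r)

/-- The solution of the auxiliary equation for the end condition, over `ℚ(t)`. -/
noncomputable def endSer (D : ℕ) : PowerSeries (RatFunc ℚ) := PowerSeries.mk fun r => endCoeff r D

lemma endCoeff_zero_eq (D : ℕ) :
    RatFunc.X * endCoeff 0 (D + 2) - endCoeff 0 (D + 1) + endCoeff 0 D = -RatFunc.X := by
  have h := congrArg (algebraMap (Polynomial ℚ) (RatFunc ℚ)) (endJet_zero_eq D)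
  simp only [map_add, map_sub, map_mul, RatFunc.algebraMap_X] at h
  simp only [endCoeff, pow_zero, div_one]
  linear_combination -h

lemma endCoeff_succ_eq (r D : ℕ) :
    RatFunc.X * endCoeff (r + 1) (D + 2) - endCoeff (r + 1) (D + 1) + endCoeff (r + 1) D =
      -RatFunc.X * (-(D : RatFunc ℚ)) ^ (r + 1) -
        RatFunc.X * ((D : RatFunc ℚ) + 1) * (endCoeff r (D + 2) - endCoeff r (D + 1)) := by
  have h := congrArg (algebraMap (Polynomial ℚ) (RatFunc ℚ)) (endJet_succ_eq r D)
  simp only [map_add, map_sub, map_mul, map_pow, map_neg, map_natCast, map_one,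
    RatFunc.algebraMap_X] at h
  have hX : (RatFunc.X : RatFunc ℚ) ≠ 0 := RatFunc.X_ne_zero
  have h2 : (-((RatFunc.X : RatFunc ℚ) * (D : RatFunc ℚ))) ^ (r + 1) =
      RatFunc.X ^ (r + 1) * (-(D : RatFunc ℚ)) ^ (r + 1) := by rw [← mul_pow]; ring
  rw [h2] at h
  simp only [endCoeff]
  rw [← mul_left_inj' (pow_ne_zero (r + 1) hX)]
  have h3 : ∀ a : RatFunc ℚ, a / RatFunc.X ^ (r + 1) * RatFunc.X ^ (r + 1) = a :=
    fun a => div_mul_cancel₀ _ (pow_ne_zero _ hX)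
  have h4 : ∀ a : RatFunc ℚ, a / RatFunc.X ^ r * RatFunc.X ^ (r + 1) = a * RatFunc.X := by
    intro a
    rw [pow_succ, ← mul_assoc, div_mul_cancel₀ _ (pow_ne_zero _ hX)]
  have e1 := h3 (algebraMap (Polynomial ℚ) (RatFunc ℚ) (endJet (r + 1) 0 (D + 2)))
  have e2 := h3 (algebraMap (Polynomial ℚ) (RatFunc ℚ) (endJet (r + 1) 0 (D + 1)))
  have e3 := h3 (algebraMap (Polynomial ℚ) (RatFunc ℚ) (endJet (r + 1) 0 D))
  have e4 := h4 (algebraMap (Polynomial ℚ) (RatFunc ℚ) (endJet r 0 (D + 2)))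
  have e5 := h4 (algebraMap (Polynomial ℚ) (RatFunc ℚ) (endJet r 0 (D + 1)))
  linear_combination -h - RatFunc.X * e1 + e2 - e3 - RatFunc.X * ((D : RatFunc ℚ) + 1) * (e4 - e5)

/-- Dividing by 1 + zD turns the right-hand side into -t times the geometric series of -zD. This is
where the powers of -D in `endCoeff_succ_eq` come from. -/
lemma endSer_eq (D : ℕ) :
    (1 + Z * (D : PowerSeries (RatFunc ℚ))) *
      (tR * (1 + Z * ((D : PowerSeries (RatFunc ℚ)) + 1)) * endSer (D + 2) -
      (1 + tR * Z * ((D : PowerSeries (RatFunc ℚ)) + 1)) * endSer (D + 1) + endSer D) = - tR := by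
  have h1 : tR * (1 + Z * ((D : PowerSeries (RatFunc ℚ)) + 1)) * endSer (D + 2) -
      (1 + tR * Z * ((D : PowerSeries (RatFunc ℚ)) + 1)) * endSer (D + 1) + endSer D =
      PowerSeries.mk fun r => -RatFunc.X * (-(D : RatFunc ℚ)) ^ r := by
    have h2 : tR * (1 + Z * ((D : PowerSeries (RatFunc ℚ)) + 1)) * endSer (D + 2) -
      (1 + tR * Z * ((D : PowerSeries (RatFunc ℚ)) + 1)) * endSer (D + 1) + endSer D =
      tR * endSer (D + 2) - endSer (D + 1) + endSer D + Z * (tR * (((D + 1 : ℕ) :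
        PowerSeries (RatFunc ℚ)) * (endSer (D + 2) - endSer (D + 1)))) := by push_cast; ring
    rw [h2]
    ext1 r
    rw [PowerSeries.coeff_mk, map_add, map_add, map_sub, coeff_tR_mul]
    cases r with
    | zero =>
      have := endCoeff_zero_eq D
      rw [PowerSeries.coeff_zero_X_mul]
      simp only [endSer, PowerSeries.coeff_mk]
      rw [this]; ring
    | succ r =>
      have := endCoeff_succ_eq r D
      rw [PowerSeries.coeff_succ_X_mul, coeff_tR_mul, coeff_natCast_mul', map_sub]
      simp only [endSer, PowerSeries.coeff_mk]
      rw [this]; push_cast; ring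
  rw [h1]
  ext1 r
  rw [add_mul, one_mul, mul_assoc, map_add, map_neg, tR]
  cases r with
  | zero => simp
  | succ r =>
    rw [PowerSeries.coeff_succ_X_mul, coeff_natCast_mul', PowerSeries.coeff_C,
      PowerSeries.coeff_mk, PowerSeries.coeff_mk, if_neg (by omega)]
    ring

lemma isEndSolution_endSer : IsEndSolution fun D => serMap (endSer D) := by
  intro D
  have h := congrArg serMap (endSer_eq D)
  simpa only [map_mul, map_add, map_sub, map_one, map_neg, map_natCast, serMap_tR, serMap_X]
    using h

/-- The denominator of the z^r coefficient is t^r, whatever `D` is. -/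
lemma isBdd_endSer : IsBdd fun D => serMap (endSer D) := by
  intro r
  refine ⟨r, fun D => ⟨-(endJet r 0 D : PowerSeries ℚ), ?_⟩⟩
  rw [PowerSeries.coeff_map, endSer, PowerSeries.coeff_mk, endCoeff, map_neg, map_div₀, map_pow,
    algebraMap_ratFunc_X, algebraMap_ratFunc_polynomial, map_neg, zpow_neg, zpow_natCast]
  field_simp

/-- The coefficients of the sequence `A` are eventually exponential-polynomial. -/
def IsExpPolySer (A : ℕ → PowerSeries (RatFunc ℚ)) : Prop :=
  ∀ r, IsExpPoly RatFunc.X fun x => PowerSeries.coeff r (A x)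

lemma IsExpPolySer.isNull {A : ℕ → PowerSeries (RatFunc ℚ)} (hA : IsExpPolySer A) :
    IsNull fun x => serMap (A x) := by
  intro r
  obtain ⟨c, hc⟩ := (hA r).exists_isSmall
  exact ⟨c, fun D => by rw [PowerSeries.coeff_map]; exact hc D⟩

lemma IsExpPolySer.add {A B : ℕ → PowerSeries (RatFunc ℚ)} (hA : IsExpPolySer A)
    (hB : IsExpPolySer B) : IsExpPolySer fun x => A x + B x :=
  fun r => ((hA r).add (hB r)).congr fun x => by rw [map_add]

lemma IsExpPolySer.sub {A B : ℕ → PowerSeries (RatFunc ℚ)} (hA : IsExpPolySer A)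
    (hB : IsExpPolySer B) : IsExpPolySer fun x => A x - B x :=
  fun r => ((hA r).sub (hB r)).congr fun x => by rw [map_sub]

lemma IsExpPolySer.tR_mul {A : ℕ → PowerSeries (RatFunc ℚ)} (hA : IsExpPolySer A) :
    IsExpPolySer fun x => tR * A x :=
  fun r => ((hA r).const_mul RatFunc.X).congr fun x => by rw [coeff_tR_mul]

lemma IsExpPolySer.X_mul {A : ℕ → PowerSeries (RatFunc ℚ)} (hA : IsExpPolySer A) :
    IsExpPolySer fun x => Z * A x := by
  intro r
  cases r with
  | zero =>
    exact (isExpPoly_of_eventually_zero (N := 0) fun _ _ => rfl).congr fun x => by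
      rw [PowerSeries.coeff_zero_X_mul]
  | succ r => exact (hA r).congr fun x => by rw [PowerSeries.coeff_succ_X_mul]

lemma isExpPoly_sum {ι : Type*} (s : Finset ι) (f : ι → ℕ → RatFunc ℚ)
    (h : ∀ i ∈ s, IsExpPoly RatFunc.X (f i)) : IsExpPoly RatFunc.X fun x => ∑ i ∈ s, f i x := by
  classical
  induction s using Finset.induction_on with
  | empty => exact isExpPoly_of_eventually_zero (N := 0) fun _ _ => by simp
  | insert i s hi ih =>
    refine ((h i (mem_insert_self _ _)).add (ih fun j hj => h j (mem_insert_of_mem hj))).congr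
      fun x => ?_
    rw [Finset.sum_insert hi]

lemma IsExpPolySer.mul_poly {A B : ℕ → PowerSeries (RatFunc ℚ)} (hA : IsExpPolySer A)
    (hB : ∀ r, IsPoly fun x => PowerSeries.coeff r (B x)) : IsExpPolySer fun x => A x * B x := by
  intro r
  refine (isExpPoly_sum (antidiagonal r) _ fun p _ => (hA p.1).poly_mul (hB p.2)).congr fun x => ?_
  rw [PowerSeries.coeff_mul]
  exact Finset.sum_congr rfl fun p _ => mul_comm _ _

lemma IsPoly.map {R S : Type*} [CommRing R] [CommRing S] (g : R →+* S) {f : ℕ → R}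
    (hf : IsPoly f) : IsPoly fun x => g (f x) := by
  obtain ⟨d, hd⟩ := hf
  refine ⟨d, ?_⟩
  induction d generalizing f with
  | zero => exact fun x => by simp [hd x]
  | succ d ih => exact (ih hd).congr fun x => by rw [map_sub]

lemma isPoly_coeff_endSer (r : ℕ) : IsPoly fun D => PowerSeries.coeff r (endSer D) := by
  refine ((isPoly_const (-(1 / RatFunc.X ^ r))).mul (((isJet_endJet r).isPoly 0).map
    (algebraMap (Polynomial ℚ) (RatFunc ℚ)))).congr fun D => ?_
  rw [endSer, PowerSeries.coeff_mk, endCoeff]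
  ring

/-- The product `t ^ D * ∏_{i < D} (1 + i z)` over `ℚ(t)`. -/
noncomputable def ratW (D : ℕ) : PowerSeries (RatFunc ℚ) := tR ^ D * ∏ i ∈ range D, (1 + Z * i)

lemma ratW_succ (D : ℕ) : ratW (D + 1) = tR * (1 + Z * D) * ratW D := by
  rw [ratW, ratW, prod_range_succ]; ring

lemma serMap_ratW (D : ℕ) : serMap (ratW D) = serW D := by
  simp only [ratW, serW, map_mul, map_pow, map_prod, map_add, map_one, map_natCast, serMap_tR,
    serMap_X]

lemma isExpPolySer_ratW : IsExpPolySer ratW := by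
  have h : ∀ r, IsPoly fun D : ℕ =>
      PowerSeries.coeff r (∏ i ∈ range D, (1 + Z * (i : PowerSeries (RatFunc ℚ)))) := by
    intro r
    have hs : ∀ D : ℕ, (∏ i ∈ range (D + 1), (1 + Z * (i : PowerSeries (RatFunc ℚ)))) =
        ∏ i ∈ range D, (1 + Z * (i : PowerSeries (RatFunc ℚ))) +
          Z * (D * ∏ i ∈ range D, (1 + Z * (i : PowerSeries (RatFunc ℚ)))) := by
      intro D; rw [prod_range_succ]; ring
    induction r with
    | zero =>
      refine ⟨1, fun D => ?_⟩
      beta_reduce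
      rw [hs, map_add, PowerSeries.coeff_zero_X_mul]; ring
    | succ r ih =>
      obtain ⟨d, hd⟩ := isPoly_natCast.mul ih
      refine ⟨d + 1, IsPolyDeg.congr (d := d) hd fun D => ?_⟩
      beta_reduce
      rw [hs, map_add, PowerSeries.coeff_succ_X_mul, coeff_natCast_mul']; ring
  intro r
  refine ⟨0, _, h r, fun D _ => ?_⟩
  beta_reduce
  rw [ratW, tR, ← map_pow, PowerSeries.coeff_C_mul]

/-- The series `serPhi` over `ℚ(t)`. -/
noncomputable def ratPhi : ℕ → PowerSeries (RatFunc ℚ)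
  | 0 => 1
  | D + 1 => tR * ratW D

lemma serMap_ratPhi (D : ℕ) : serMap (ratPhi D) = serPhi D := by
  cases D with
  | zero => rw [serPhi_zero, ratPhi, map_one]
  | succ D => rw [serPhi_succ_eq, ratPhi, map_mul, serMap_tR, serMap_ratW]

lemma IsExpPolySer.of_shift {A B : ℕ → PowerSeries (RatFunc ℚ)} (hA : IsExpPolySer A)
    (h : ∀ x, B (x + 1) = A x) : IsExpPolySer B :=
  fun r => (hA r).of_shift RatFunc.X_ne_zero fun x => by rw [h]

lemma isExpPolySer_ratPhi : IsExpPolySer ratPhi :=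
  isExpPolySer_ratW.tR_mul.of_shift fun _ => rfl

lemma ratFunc_X_ne_C (c : ℚ) : (RatFunc.X : RatFunc ℚ) ≠ RatFunc.C c := by
  rw [← RatFunc.algebraMap_X, ← RatFunc.algebraMap_C]
  intro h
  exact Polynomial.X_ne_C c (RatFunc.algebraMap_injective ℚ h)

lemma exists_ratTail : ∃ A : ℕ → PowerSeries (RatFunc ℚ), IsExpPolySer A ∧
    ∀ x, A x - A (x + 1) = ratPhi x := by
  have h1 : (1 : RatFunc ℚ) ≠ RatFunc.X := by
    rw [← map_one RatFunc.C]; exact (ratFunc_X_ne_C 1).symm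
  choose P hP hP' using fun r =>
    ((isExpPolySer_ratPhi r).const_mul (-1)).exists_solution one_ne_zero h1
  refine ⟨fun x => PowerSeries.mk fun r => P r x, fun r => (hP r).congr fun x => by
    rw [PowerSeries.coeff_mk], fun x => ?_⟩
  ext1 r
  rw [map_sub, PowerSeries.coeff_mk, PowerSeries.coeff_mk]
  linear_combination -hP' r x

/-- The series `serTail` over `ℚ(t)`. -/
noncomputable def ratTail : ℕ → PowerSeries (RatFunc ℚ) := exists_ratTail.choose

/-- The difference is constant in `x` and decays t-adically, so it is zero. -/
lemma serMap_ratTail (x : ℕ) : serMap (ratTail x) = serTail x := by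
  have hn := exists_ratTail.choose_spec.1.isNull.sub isNull_serTail
  have hs := exists_ratTail.choose_spec.2
  have h : ∀ x, serMap (ratTail (x + 1)) - serTail (x + 1) = serMap (ratTail x) - serTail x := by
    intro x
    have h1 := congrArg serMap (hs x)
    have h2 := serTail_succ x
    rw [map_sub, serMap_ratPhi] at h1
    change serMap (ratTail x) - serMap (ratTail (x + 1)) = _ at h1
    linear_combination h2 - h1
  have key : ∀ x, serMap (ratTail x) - serTail x = 0 := by
    intro x
    ext1 r
    obtain ⟨c, hc⟩ := hn r
    refine eq_zero_of_isSmall_of_unit (a := fun x =>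
      PowerSeries.coeff r (serMap (ratTail x) - serTail x)) hc (fun _ => 1)
      (fun _ => isUnit_one) (fun D => ?_) x
    rw [map_one, mul_one]
    congr 1
    induction D with
    | zero => rfl
    | succ D ih => rw [h, ih]
  exact sub_eq_zero.1 (key x)

/-- The series `serPsi` over `ℚ(t)`. -/
noncomputable def ratPsi : ℕ → PowerSeries (RatFunc ℚ)
  | 0 => tR * ratTail 0
  | x + 1 => tR * ratTail (x + 1) + tR * Z * x * ratPsi x

lemma serMap_ratPsi (x : ℕ) : serMap (ratPsi x) = serPsi x := by
  induction x with
  | zero => rw [ratPsi, serPsi_zero, map_mul, serMap_tR, serMap_ratTail]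
  | succ x ih =>
    rw [ratPsi, serPsi_succ]
    simp only [map_add, map_mul, map_natCast, serMap_tR, serMap_X, serMap_ratTail, ih]

lemma IsExpPolySer.shift {A : ℕ → PowerSeries (RatFunc ℚ)} (hA : IsExpPolySer A) :
    IsExpPolySer fun x => A (x + 1) := by
  intro r
  obtain ⟨N, p, hp, h⟩ := hA r
  refine ⟨N, _, (isPoly_const RatFunc.X).mul hp.shift, fun x hx => ?_⟩
  have := h (x + 1) (by omega)
  beta_reduce at this ⊢
  rw [this]; ring

lemma isExpPolySer_ratPsi : IsExpPolySer ratPsi := by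
  have hT : IsExpPolySer fun x => tR * ratTail (x + 1) :=
    (IsExpPolySer.shift exists_ratTail.choose_spec.1).tR_mul
  intro r
  have hs : ∀ x, ratPsi (x + 1) = tR * ratTail (x + 1) + Z * (tR * (x * ratPsi x)) := by
    intro x; rw [ratPsi]; ring
  induction r with
  | zero =>
    refine (hT 0).of_shift RatFunc.X_ne_zero fun x => ?_
    rw [hs, map_add, PowerSeries.coeff_zero_X_mul, add_zero]
  | succ r ih =>
    refine ((hT (r + 1)).add ((ih.poly_mul isPoly_natCast).const_mul RatFunc.X)).of_shift
      RatFunc.X_ne_zero fun x => ?_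
    rw [hs, map_add, PowerSeries.coeff_succ_X_mul, coeff_tR_mul, coeff_tR_mul,
      coeff_natCast_mul']

/-- The inhomogeneous part of the equation for the floor condition. -/
noncomputable def floorRhs (x : ℕ) : PowerSeries (RatFunc ℚ) :=
  -(tR * (ratW x * endSer x + ratPhi x)) - tR * (Z * ratPsi x) +
    if x = 0 then 0 else tR * (Z * ratPsi (x - 1))

lemma isExpPolySer_floorRhs : IsExpPolySer floorRhs := by
  have h1 := ((isExpPolySer_ratW.mul_poly isPoly_coeff_endSer).add isExpPolySer_ratPhi).tR_mul
  have h2 := isExpPolySer_ratPsi.X_mul.tR_mul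
  have h3 : IsExpPolySer fun x => if x = 0 then 0 else tR * (Z * ratPsi (x - 1)) :=
    h2.of_shift fun x => by simp
  intro r
  refine (((h3.sub h1).sub h2) r).congr fun x => ?_
  congr 1
  rw [floorRhs]; ring

/-- One coefficient of the equation for the floor condition. -/
def IsFloorStep (r : ℕ) (y y' : ℕ → RatFunc ℚ) : Prop :=
  ∀ x : ℕ, y' (x + 1) - (1 - RatFunc.X) * y' x =
    RatFunc.X * (((x : RatFunc ℚ) + 1) * y x - (x : RatFunc ℚ) * y (x - 1)) +
    PowerSeries.coeff r (floorRhs x)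

/-- At each order in z the homogeneous ratio is 1 - t, which differs from both 0 and t. -/
lemma exists_floorStep (r : ℕ) (y : ℕ → RatFunc ℚ) (hy : IsExpPoly RatFunc.X y) :
    ∃ y', IsExpPoly RatFunc.X y' ∧ IsFloorStep r y y' := by
  have h1 : (1 - RatFunc.X : RatFunc ℚ) ≠ 0 := by
    rw [sub_ne_zero, ← map_one RatFunc.C]; exact (ratFunc_X_ne_C 1).symm
  have h2 : (1 - RatFunc.X : RatFunc ℚ) ≠ RatFunc.X := by
    intro h
    apply ratFunc_X_ne_C (1 / 2)
    rw [map_div₀, map_one, map_ofNat]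
    linear_combination -h / 2
  have h3 : IsExpPoly RatFunc.X fun x : ℕ => (x : RatFunc ℚ) * y (x - 1) :=
    (hy.poly_mul (isPoly_natCast.add (isPoly_const 1))).of_shift RatFunc.X_ne_zero fun x => by
      push_cast; rfl
  have h4 := hy.poly_mul (isPoly_natCast.add (isPoly_const 1))
  exact (((h4.sub h3).const_mul RatFunc.X).add (isExpPolySer_floorRhs r)).exists_solution h1 h2

/-- The coefficients of the solution of the auxiliary equation for the floor condition. -/
noncomputable def floorCoeff : ℕ → {y : ℕ → RatFunc ℚ // IsExpPoly RatFunc.X y}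
  | 0 => ⟨_, (exists_floorStep 0 (fun _ => 0)
      (isExpPoly_of_eventually_zero (N := 0) fun _ _ => rfl)).choose_spec.1⟩
  | r + 1 => ⟨_, (exists_floorStep (r + 1) (floorCoeff r).1 (floorCoeff r).2).choose_spec.1⟩

lemma floorCoeff_zero : IsFloorStep 0 (fun _ => 0) (floorCoeff 0).1 :=
  (exists_floorStep 0 (fun _ => 0)
    (isExpPoly_of_eventually_zero (N := 0) fun _ _ => rfl)).choose_spec.2

lemma floorCoeff_succ (r : ℕ) : IsFloorStep (r + 1) (floorCoeff r).1 (floorCoeff (r + 1)).1 :=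
  (exists_floorStep (r + 1) (floorCoeff r).1 (floorCoeff r).2).choose_spec.2

/-- The solution of the auxiliary equation for the floor condition, over `ℚ(t)`. -/
noncomputable def floorSer (x : ℕ) : PowerSeries (RatFunc ℚ) :=
  PowerSeries.mk fun r => (floorCoeff r).1 x

lemma isExpPolySer_floorSer : IsExpPolySer floorSer :=
  fun r => (floorCoeff r).2.congr fun x => by rw [floorSer, PowerSeries.coeff_mk]

lemma floorSer_eq (x : ℕ) : floorSer (x + 1) = (1 - tR + tR * Z * (x + 1)) * floorSer x -
    tR * Z * x * floorSer (x - 1) + floorRhs x := by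
  have h : (1 - tR + tR * Z * (x + 1)) * floorSer x -
      tR * Z * x * floorSer (x - 1) + floorRhs x = floorSer x - tR * floorSer x +
      Z * (tR * (((x + 1 : ℕ) : PowerSeries (RatFunc ℚ)) * floorSer x) -
        tR * (x * floorSer (x - 1))) + floorRhs x := by push_cast; ring
  rw [h]
  ext1 r
  rw [map_add, map_add, map_sub, coeff_tR_mul]
  cases r with
  | zero =>
    have := floorCoeff_zero x
    rw [PowerSeries.coeff_zero_X_mul]
    simp only [floorSer, PowerSeries.coeff_mk]
    linear_combination this
  | succ r =>
    have := floorCoeff_succ r x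
    rw [PowerSeries.coeff_succ_X_mul, map_sub, coeff_tR_mul, coeff_tR_mul, coeff_natCast_mul',
      coeff_natCast_mul']
    simp only [floorSer, PowerSeries.coeff_mk]
    push_cast
    linear_combination this

lemma isFloorSolution_floorSer :
    IsFloorSolution (fun D => serMap (endSer D)) fun x => serMap (floorSer x) := by
  intro x
  have h := congrArg serMap (floorSer_eq x)
  rw [floorRhs] at h
  simp only [map_mul, map_add, map_sub, map_one, map_neg, map_natCast, serMap_tR, serMap_X,
    serMap_ratW, serMap_ratPhi, serMap_ratPsi, apply_ite serMap, map_zero] at h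
  beta_reduce
  rw [h]
  split_ifs <;> ring

/-- The connection constant over `ℚ(t)`. -/
noncomputable def ratPhiConst : PowerSeries (RatFunc ℚ) := tR + tR * endSer 1 - endSer 0

/-- The rational part of the generating function. -/
noncomputable def ratPart : PowerSeries (RatFunc ℚ) :=
  ratPhiConst * endSer 0 + 1 + tR * (1 + endSer 0 + floorSer 0)

/-- The structure of the generating function: a rational square times `serV 0` plus a rational
part. -/
theorem serF_eq_rational : serF = serMap ratPhiConst ^ 2 * serV 0 + serMap ratPart := by
  rw [serF_structure isBdd_endSer isEndSolution_endSer isExpPolySer_floorSer.isNull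
    isFloorSolution_floorSer]
  simp only [ratPart, ratPhiConst, connection, map_mul, map_add, map_sub, map_one, serMap_tR]

end RationalSeries

/-! ### The recursion for V after division by q^D. -/

section SecondOrder

variable {A : Type*} [CommRing A]

/-- One step of the recursion for the coefficients of `serV` divided by `q ^ D`. -/
def IsQuadStep (q : A) (u u' : ℕ → A) : Prop :=
  (∀ D : ℕ, q * u' (D + 2) - u' (D + 1) + (1 - q) * u' D =
    (1 - q) * (q * ((D + 1) * u (D + 1)) - D * u D)) ∧ q * u' 1 = u' 0

lemma exists_quadStep {q : A} (hq : IsUnit (2 * q - 1)) {u : ℕ → A} (hu : IsPoly u) :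
    ∃ u', IsPoly u' ∧ IsQuadStep q u u' := by
  have h1 : IsPoly fun D : ℕ => (D : A) * u D := isPoly_natCast.mul hu
  have h2 : IsPoly fun D : ℕ => q * (((D + 1 : ℕ) : A) * u (D + 1)) - D * u D :=
    ((isPoly_const q).mul h1.shift).sub h1
  obtain ⟨p, hp, hp'⟩ := h2.sum_range.exists_solution hq q
  -- The second-order recursion integrates once to (2q - 1)p + qΔp = Σ. Constants solve the
  -- homogeneous recursion, and this one enforces the initial condition without dividing by 1 - q.
  refine ⟨fun D => (1 - q) * p D + (q * p 1 - p 0),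
    ((isPoly_const (1 - q)).mul hp).add (isPoly_const _), fun D => ?_, ?_⟩
  · have e1 := hp' D
    have e2 := hp' (D + 1)
    rw [sum_range_succ, ← e1] at e2
    push_cast at e2
    linear_combination (1 - q) * e2
  · ring

lemma IsPolyDeg.eq_zero {L : Type*} [Field L] {d : ℕ} {w : ℕ → L} (hw : IsPolyDeg d w) {a c : L}
    (ha : a ≠ 0) (h : ∀ x, a * w x + c * (w (x + 1) - w x) = 0) : ∀ x, w x = 0 := by
  induction d generalizing w with
  | zero => exact hw
  | succ d ih =>
    have := ih hw fun x => by linear_combination h (x + 1) - h x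
    intro x
    have e := h x
    rw [this x, mul_zero, add_zero] at e
    exact (mul_eq_zero.1 e).resolve_left ha

/-- For the difference w of two solutions, qw(D + 1) - (1 - q)w(D) is constant. A polynomial w is
then constant, and the initial condition gives (q - 1)w = 0. -/
lemma quadStep_unique {L : Type*} [Field L] {q : L} (hq : 2 * q - 1 ≠ 0) (hq1 : q ≠ 1)
    {u v w : ℕ → L} (hv : IsPoly v) (hw : IsPoly w) (h : IsQuadStep q u v)
    (h' : IsQuadStep q u w) : ∀ x, v x = w x := by
  have h1 : ∀ D, q * (v (D + 1) - w (D + 1)) - (1 - q) * (v D - w D) =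
      q * (v 1 - w 1) - (1 - q) * (v 0 - w 0) := by
    intro D
    induction D with
    | zero => simp
    | succ D ih =>
      rw [← ih]
      linear_combination h.1 D - h'.1 D
  obtain ⟨c, hc⟩ : ∃ c, c = (q * (v 1 - w 1) - (1 - q) * (v 0 - w 0)) / (2 * q - 1) := ⟨_, rfl⟩
  have hc' : c * (2 * q - 1) = q * (v 1 - w 1) - (1 - q) * (v 0 - w 0) := by
    rw [hc, div_mul_cancel₀ _ hq]
  obtain ⟨d, hd⟩ := (hv.sub hw).sub (isPoly_const c)
  have h2 := hd.eq_zero hq (c := q) fun x => by linear_combination h1 x - hc'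
  have h3 : c = 0 := by
    have e0 := h2 0
    have e1 := h2 1
    have : c * (q - 1) = 0 := by linear_combination h.2 - h'.2 - q * e1 + e0
    exact (mul_eq_zero.1 this).resolve_right (sub_ne_zero.2 hq1)
  intro x
  have := h2 x
  rw [h3] at this
  linear_combination this

end SecondOrder

/-! ### One solution over ℚ[q, 1/(2q - 1)], to be specialized at both roots. -/

section Universal

/-- The universal ring for the second order recursion: `ℚ[q]` with `2 q - 1` inverted. -/
abbrev QuadRing : Type := Localization.Away (2 * Polynomial.X - 1 : Polynomial ℚ)

/-- The generator of `QuadRing`. -/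
noncomputable def quadGen : QuadRing := algebraMap (Polynomial ℚ) QuadRing Polynomial.X

lemma isUnit_quadGen : IsUnit (2 * quadGen - 1) := by
  have := IsLocalization.Away.algebraMap_isUnit (S := QuadRing)
    (2 * Polynomial.X - 1 : Polynomial ℚ)
  rwa [map_sub, map_mul, map_ofNat, map_one] at this

/-- The coefficients of `serV`, divided by `q ^ D / (1 - q)`, in the universal ring. -/
noncomputable def quadSol : ℕ → {u : ℕ → QuadRing // IsPoly u}
  | 0 => ⟨fun _ => 1, isPoly_const 1⟩
  | r + 1 => ⟨_, (exists_quadStep isUnit_quadGen (quadSol r).2).choose_spec.1⟩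

lemma quadSol_zero (D : ℕ) : (quadSol 0).1 D = 1 := by rw [quadSol]

lemma quadSol_succ (r : ℕ) : IsQuadStep quadGen (quadSol r).1 (quadSol (r + 1)).1 :=
  (exists_quadStep isUnit_quadGen (quadSol r).2).choose_spec.2

variable {B : Type*} [CommRing B]

/-- The homomorphism from the universal ring that sends the generator to `b`. -/
noncomputable def quadHom [Algebra ℚ B] (b : B) (hb : IsUnit (2 * b - 1)) : QuadRing →+* B :=
  IsLocalization.Away.lift (2 * Polynomial.X - 1 : Polynomial ℚ)
    (g := (Polynomial.aeval b : Polynomial ℚ →ₐ[ℚ] B).toRingHom) (by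
      change IsUnit (Polynomial.aeval b (2 * Polynomial.X - 1 : Polynomial ℚ))
      rwa [map_sub, map_mul, map_ofNat, map_one, Polynomial.aeval_X])

lemma quadHom_gen [Algebra ℚ B] (b : B) (hb : IsUnit (2 * b - 1)) : quadHom b hb quadGen = b := by
  rw [quadHom, quadGen, IsLocalization.Away.lift_eq]
  simp

lemma quadHom_ext {f g : QuadRing →+* B} (h : f quadGen = g quadGen) : f = g := by
  refine IsLocalization.ringHom_ext
    (Submonoid.powers (2 * Polynomial.X - 1 : Polynomial ℚ)) ?_
  refine Polynomial.ringHom_ext' (Subsingleton.elim _ _) ?_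
  exact h

lemma IsQuadStep.map {A C : Type*} [CommRing A] [CommRing C] (f : A →+* C) {q : A}
    {u u' : ℕ → A} (h : IsQuadStep q u u') :
    IsQuadStep (f q) (fun D => f (u D)) fun D => f (u' D) := by
  refine ⟨fun D => ?_, ?_⟩
  · have := congrArg f (h.1 D)
    simpa only [map_mul, map_sub, map_add, map_one, map_natCast] using this
  · have := congrArg f h.2
    simpa only [map_mul] using this

end Universal

/-! ### The Catalan series, the small root and V in closed form. -/

section Catalan

lemma catalanGF_sq : catalanGF ^ 2 * PowerSeries.X + 1 = catalanGF := by
  have := congrArg (PowerSeries.map (Nat.castRingHom ℚ))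
    PowerSeries.catalanSeries_sq_mul_X_add_one
  simpa [catalanGF] using this

/-- The small root `q = t C(t)` of `q (1 - q) = t`. -/
noncomputable def smallRoot : PowerSeries ℚ := PowerSeries.X * catalanGF

lemma smallRoot_mul : smallRoot * (1 - smallRoot) = PowerSeries.X := by
  rw [smallRoot]; linear_combination (-PowerSeries.X) * catalanGF_sq

lemma catalanGF_mul : catalanGF * (1 - smallRoot) = 1 := by
  rw [smallRoot]; linear_combination -catalanGF_sq

lemma isUnit_smallRoot : IsUnit (2 * smallRoot - 1) := by
  rw [PowerSeries.isUnit_iff_constantCoeff]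
  simp [smallRoot]

lemma isUnit_one_sub_smallRoot : IsUnit (2 * (1 - smallRoot) - 1) := by
  rw [PowerSeries.isUnit_iff_constantCoeff]
  rw [map_sub, map_mul, map_ofNat, map_sub, map_one]
  simp [smallRoot]
  norm_num

/-- Specialization of the universal ring at the small root. -/
noncomputable abbrev specSmall : QuadRing →+* PowerSeries ℚ := quadHom smallRoot isUnit_smallRoot

/-- Specialization of the universal ring at the other root. -/
noncomputable abbrev specLarge : QuadRing →+* PowerSeries ℚ :=
  quadHom (1 - smallRoot) isUnit_one_sub_smallRoot

/-- With t = q(1 - q), the ansatz q^D C u(D) reduces the recurrence to `IsQuadStep`, and C(1 - q) =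
1 gives the initial condition. Since t divides q the ansatz decays, so uniqueness applies; the other
root would not decay. -/
lemma coeff_serV (r D : ℕ) : PowerSeries.coeff r (serV D) =
    lau (smallRoot ^ D * (catalanGF * specSmall ((quadSol r).1 D))) := by
  let S : ℕ → PowerSeries ℚ⸨X⸩ := fun D => PowerSeries.mk fun r =>
    lau (smallRoot ^ D * (catalanGF * specSmall ((quadSol r).1 D)))
  have hS : IsNull S := by
    refine fun r => ⟨0, fun D => ?_⟩
    rw [PowerSeries.coeff_mk, smallRoot, mul_pow, mul_assoc, map_mul, map_pow]
    refine ⟨catalanGF ^ D * (catalanGF * specSmall ((quadSol r).1 D)), ?_⟩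
    rw [sub_zero, zpow_natCast]; rfl
  have hstep : ∀ r, IsQuadStep smallRoot (fun D => specSmall ((quadSol r).1 D))
      fun D => specSmall ((quadSol (r + 1)).1 D) := by
    intro r
    have := (quadSol_succ r).map specSmall
    rwa [quadHom_gen] at this
  have h := eq_zero_of_serV_type (A := fun D => serV D - S D) (isNull_serV.sub hS) ?_ ?_ D
  · have h' := congrArg (PowerSeries.coeff r) (sub_eq_zero.1 h)
    rw [h', PowerSeries.coeff_mk]
  · have : S 1 = S 0 - 1 := by
      ext1 r
      rw [map_sub, PowerSeries.coeff_mk, PowerSeries.coeff_mk, PowerSeries.coeff_one]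
      cases r with
      | zero =>
        rw [if_pos rfl, ← map_one lau, ← map_sub]
        congr 1
        simp only [quadSol_zero, map_one]
        linear_combination -catalanGF_mul
      | succ r =>
        rw [if_neg (by omega), sub_zero]
        congr 1
        have := (hstep r).2
        linear_combination catalanGF * this
    simp only [serV_one, this]
    ring
  · intro D
    have : S (D + 2) = (1 + tC * PowerSeries.X * ((D : PowerSeries ℚ⸨X⸩) + 1)) * S (D + 1) -
        tC * (1 + PowerSeries.X * (D : PowerSeries ℚ⸨X⸩)) * S D := by
      have e : (1 + tC * PowerSeries.X * ((D : PowerSeries ℚ⸨X⸩) + 1)) * S (D + 1) -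
          tC * (1 + PowerSeries.X * (D : PowerSeries ℚ⸨X⸩)) * S D =
          S (D + 1) - tC * S D + PowerSeries.X * (tC * (((D + 1 : ℕ) : PowerSeries ℚ⸨X⸩) *
          S (D + 1)) - tC * ((D : PowerSeries ℚ⸨X⸩) * S D)) := by
        push_cast; ring
      rw [e]
      ext1 r
      rw [map_add, map_sub, coeff_tC_mul]
      cases r with
      | zero =>
        rw [PowerSeries.coeff_zero_X_mul]
        simp only [S, PowerSeries.coeff_mk, tL, ← map_mul, ← map_sub, add_zero]
        congr 1
        simp only [quadSol_zero, map_one]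
        rw [← smallRoot_mul]
        ring
      | succ r =>
        rw [PowerSeries.coeff_succ_X_mul, map_sub, coeff_tC_mul, coeff_tC_mul, coeff_natCast_mul,
          coeff_natCast_mul]
        simp only [S, PowerSeries.coeff_mk, tL, ← map_mul, ← map_sub, ← map_add,
          ← map_natCast lau]
        congr 1
        have := (hstep r).1 D
        rw [← smallRoot_mul]
        push_cast
        linear_combination smallRoot ^ (D + 1) * catalanGF * this
    simp only [serV_succ_succ, this]
    ring

end Catalan

/-! ### Evaluating rational functions at transcendental elements. -/

section RatHom

variable {L : Type*} [Field L] [Algebra ℚ L]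

/-- The homomorphism `ℚ(u) → L` that sends `u` to a transcendental element. -/
noncomputable def ratHom (a : L) (ha : Transcendental ℚ a) : RatFunc ℚ →+* L :=
  RatFunc.liftRingHom (Polynomial.aeval a : Polynomial ℚ →ₐ[ℚ] L).toRingHom <| by
    intro p hp
    rw [Submonoid.mem_comap]
    refine mem_nonZeroDivisors_of_ne_zero fun h => ?_
    exact nonZeroDivisors.ne_zero hp ((transcendental_iff.1 ha) p h)

lemma ratHom_algebraMap (a : L) (ha : Transcendental ℚ a) (p : Polynomial ℚ) :
    ratHom a ha (algebraMap (Polynomial ℚ) (RatFunc ℚ) p) = Polynomial.aeval a p := by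
  rw [ratHom, RatFunc.liftRingHom_algebraMap]
  rfl

lemma ratHom_X (a : L) (ha : Transcendental ℚ a) : ratHom a ha RatFunc.X = a := by
  rw [← RatFunc.algebraMap_X, ratHom_algebraMap, Polynomial.aeval_X]

lemma ratHom_apply (a : L) (ha : Transcendental ℚ a) (f : RatFunc ℚ) :
    ratHom a ha f = Polynomial.aeval a f.num / Polynomial.aeval a f.denom := by
  conv_lhs => rw [← RatFunc.num_div_denom f]
  rw [map_div₀, ratHom_algebraMap, ratHom_algebraMap]

lemma ratFunc_ringHom_ext {M : Type*} [Field M] {f g : RatFunc ℚ →+* M}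
    (h : f RatFunc.X = g RatFunc.X) : f = g := by
  refine IsLocalization.ringHom_ext (nonZeroDivisors (Polynomial ℚ)) ?_
  refine Polynomial.ringHom_ext' (Subsingleton.elim _ _) ?_
  simpa using h

lemma transcendental_of_ringHom {L' : Type*} [Field L'] [Algebra ℚ L'] (f : L →+* L') {a : L}
    (ha : Transcendental ℚ (f a)) : Transcendental ℚ a := by
  intro h
  exact ha (h.algHom (f.toRatAlgHom : L →ₐ[ℚ] L'))

/-- Divide a relation f(p) = 0 by the power of X contained in f. The constant term then makes the
cofactor vanish at 0, a contradiction. -/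
lemma transcendental_lau {p : PowerSeries ℚ} (hp : p ≠ 0)
    (h0 : PowerSeries.constantCoeff p = 0) : Transcendental ℚ (lau p) := by
  rw [transcendental_iff]
  intro f hf
  by_contra hne
  obtain ⟨g, hg, hg'⟩ := Polynomial.exists_eq_pow_rootMultiplicity_mul_and_not_dvd f hne 0
  have h1 : ∀ f : Polynomial ℚ, Polynomial.aeval (lau p) f = lau (Polynomial.aeval p f) := by
    intro f
    exact Polynomial.aeval_algHom_apply (lau.toRatAlgHom : PowerSeries ℚ →ₐ[ℚ] ℚ⸨X⸩) p f
  rw [h1, map_eq_zero_iff _ HahnSeries.ofPowerSeries_injective, hg, map_mul, map_pow, map_sub,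
    Polynomial.aeval_X, map_zero, map_zero, sub_zero] at hf
  have h2 := (mul_eq_zero.1 hf).resolve_left (pow_ne_zero _ hp)
  have h3 : PowerSeries.constantCoeff (Polynomial.aeval p g) = g.eval 0 := by
    have := Polynomial.aeval_algHom_apply
      ((PowerSeries.constantCoeff (R := ℚ)).toRatAlgHom : PowerSeries ℚ →ₐ[ℚ] ℚ) p g
    rw [← Polynomial.coe_aeval_eq_eval, ← h0]
    exact this.symm
  rw [h2, map_zero] at h3
  exact hg' (by rw [map_zero, sub_zero]; exact Polynomial.X_dvd_iff.2 (by
    rw [Polynomial.coeff_zero_eq_eval_zero, ← h3]))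

end RatHom

/-! ### The field ℚ(u) and its two embeddings: C and its conjugate. -/

section Specializations

lemma smallRoot_ne_zero : smallRoot ≠ 0 := by
  intro h
  have := smallRoot_mul
  rw [h, zero_mul] at this
  exact PowerSeries.X_ne_zero this.symm

/-- The small root in `ℚ((t))`. -/
noncomputable def qL : ℚ⸨X⸩ := lau smallRoot

lemma qL_ne_zero : qL ≠ 0 := by
  rw [qL, map_ne_zero_iff _ HahnSeries.ofPowerSeries_injective]
  exact smallRoot_ne_zero

lemma qL_mul : qL * (1 - qL) = tL := by
  rw [qL, ← map_one lau, ← map_sub, ← map_mul, smallRoot_mul, tL]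

lemma one_sub_qL_ne_zero : 1 - qL ≠ 0 := fun h => tL_ne_zero (by rw [← qL_mul, h, mul_zero])

lemma toLaurent_catalanGF : toLaurent catalanGF = (1 - qL)⁻¹ := by
  apply eq_inv_of_mul_eq_one_left
  have := congrArg lau catalanGF_mul
  rwa [map_mul, map_sub, map_one] at this

lemma transcendental_qL : Transcendental ℚ qL :=
  transcendental_lau smallRoot_ne_zero (by simp [smallRoot])

lemma transcendental_toLaurent_catalanGF : Transcendental ℚ (toLaurent catalanGF) := by
  intro h
  apply transcendental_qL
  have h1 : IsAlgebraic ℚ (1 - (toLaurent catalanGF)⁻¹) := isAlgebraic_one.sub h.inv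
  rwa [toLaurent_catalanGF, inv_inv, sub_sub_cancel] at h1

lemma transcendental_qL_inv : Transcendental ℚ qL⁻¹ := by
  intro h
  apply transcendental_qL
  simpa using h.inv

lemma transcendental_tL : Transcendental ℚ tL :=
  transcendental_lau PowerSeries.X_ne_zero (by simp)

/-- The specialization `u ↦ C(t)`. -/
noncomputable def specC : RatFunc ℚ →+* ℚ⸨X⸩ :=
  ratHom (toLaurent catalanGF) transcendental_toLaurent_catalanGF

/-- The specialization of `u` at the conjugate of `C(t)`. -/
noncomputable def specConj : RatFunc ℚ →+* ℚ⸨X⸩ := ratHom qL⁻¹ transcendental_qL_inv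

lemma specC_X : specC RatFunc.X = (1 - qL)⁻¹ := by rw [specC, ratHom_X, toLaurent_catalanGF]

lemma specConj_X : specConj RatFunc.X = qL⁻¹ := ratHom_X _ _

/-- The small root as a rational function of `u`. -/
noncomputable def qU : RatFunc ℚ := 1 - RatFunc.X⁻¹

/-- The variable `t` as a rational function of `u`. -/
noncomputable def tU : RatFunc ℚ := qU * (1 - qU)

lemma specC_qU : specC qU = qL := by
  rw [qU, map_sub, map_one, map_inv₀, specC_X, inv_inv, sub_sub_cancel]

lemma specConj_qU : specConj qU = 1 - qL := by
  rw [qU, map_sub, map_one, map_inv₀, specConj_X, inv_inv]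

lemma specC_tU : specC tU = tL := by
  rw [tU, map_mul, map_sub, map_one, specC_qU, qL_mul]

lemma specConj_tU : specConj tU = tL := by
  rw [tU, map_mul, map_sub, map_one, specConj_qU, ← qL_mul]; ring

/-- The embedding `ℚ(t) → ℚ(u)`. -/
noncomputable def tToU : RatFunc ℚ →+* RatFunc ℚ :=
  ratHom tU (transcendental_of_ringHom specC (by rw [specC_tU]; exact transcendental_tL))

lemma tToU_X : tToU RatFunc.X = tU := ratHom_X _ _

lemma specC_comp : specC.comp tToU = algebraMap (RatFunc ℚ) ℚ⸨X⸩ :=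
  ratFunc_ringHom_ext (by rw [RingHom.comp_apply, tToU_X, specC_tU, algebraMap_ratFunc_X])

/-- Since t = q(1 - q) is symmetric in q and 1 - q, both specializations of u restrict to the same
embedding of ℚ(t). -/
lemma specConj_comp : specConj.comp tToU = algebraMap (RatFunc ℚ) ℚ⸨X⸩ :=
  ratFunc_ringHom_ext (by rw [RingHom.comp_apply, tToU_X, specConj_tU, algebraMap_ratFunc_X])

lemma isUnit_qU : IsUnit (2 * qU - 1) := by
  rw [isUnit_iff_ne_zero]
  intro h
  have h1 := congrArg specC h
  rw [map_sub, map_mul, map_ofNat, map_one, map_zero, specC_qU, qL] at h1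
  have h2 : lau (2 * smallRoot - 1) = 0 := by rw [map_sub, map_mul, map_ofNat, map_one, h1]
  rw [map_eq_zero_iff _ HahnSeries.ofPowerSeries_injective] at h2
  exact isUnit_smallRoot.ne_zero h2

/-- Specialization of the universal ring to `ℚ(u)`. -/
noncomputable def specU : QuadRing →+* RatFunc ℚ := quadHom qU isUnit_qU

lemma specC_comp_specU : specC.comp specU = lau.comp specSmall :=
  quadHom_ext (by
    rw [RingHom.comp_apply, RingHom.comp_apply, specU, quadHom_gen, quadHom_gen, specC_qU, qL])

lemma specConj_comp_specU : specConj.comp specU = lau.comp specLarge :=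
  quadHom_ext (by
    rw [RingHom.comp_apply, RingHom.comp_apply, specU, quadHom_gen, quadHom_gen, specConj_qU, qL,
      map_sub, map_one])

/-- The series `serV 0` over `ℚ(u)`. -/
noncomputable def serU : PowerSeries (RatFunc ℚ) :=
  PowerSeries.mk fun r => RatFunc.X * specU ((quadSol r).1 0)

lemma map_specC_serU : PowerSeries.map specC serU = serV 0 := by
  ext1 r
  have := RingHom.congr_fun specC_comp_specU ((quadSol r).1 0)
  rw [RingHom.comp_apply, RingHom.comp_apply] at this
  rw [PowerSeries.coeff_map, serU, PowerSeries.coeff_mk, map_mul, coeff_serV, pow_zero, one_mul,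
    map_mul, this, specC_X, ← toLaurent_catalanGF]
  rfl

/-- The sequence of rational functions `R` with `F_k(t) = R_k(C(t))`. -/
noncomputable def genRat (k : ℕ) : RatFunc ℚ :=
  PowerSeries.coeff k (PowerSeries.map tToU ratPhiConst ^ 2 * serU + PowerSeries.map tToU ratPart) /
    tU ^ k

lemma innerEnum_coeff_eq_zero (e : Prop) (l D f k : ℕ) (h : l < k) :
    PowerSeries.coeff k (innerEnum e l D f) = 0 := by
  classical
  rw [innerEnum, map_sum]
  refine Finset.sum_eq_zero fun τ _ => ?_
  split_ifs
  · rw [PowerSeries.coeff_X_pow, if_neg]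
    intro h1
    have := Finset.card_le_univ (Finset.univ.filter fun i => IsInner D τ i)
    rw [Fintype.card_fin] at this
    omega
  · exact map_zero _

/-- `serF` counts all n + k points while `genFun` counts external points only, hence the factor t^k.
-/
lemma coeff_serF (k : ℕ) : PowerSeries.coeff k serF = tL ^ k * toLaurent (genFun k) := by
  have h : (PowerSeries.mk fun l => PowerSeries.coeff k (innerEnum True l 0 l)) =
      PowerSeries.X ^ k * genFun k := by
    ext m
    rw [PowerSeries.coeff_mk, PowerSeries.coeff_X_pow_mul']
    split_ifs with hm
    · obtain ⟨n, rfl⟩ := Nat.exists_eq_add_of_le' hm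
      rw [Nat.add_sub_cancel, genFun, PowerSeries.coeff_mk, card_ASqAv321]
    · exact innerEnum_coeff_eq_zero _ _ _ _ _ (by omega)
  rw [serF, gs, PowerSeries.coeff_mk, h, map_mul, map_pow]
  rfl

lemma specC_genRat (k : ℕ) : specC (genRat k) = toLaurent (genFun k) := by
  have h1 : ∀ A : PowerSeries (RatFunc ℚ),
      PowerSeries.map specC (PowerSeries.map tToU A) = serMap A := by
    intro A
    ext1 r
    rw [PowerSeries.coeff_map, PowerSeries.coeff_map, PowerSeries.coeff_map, ← specC_comp]
    rfl
  rw [genRat, map_div₀, map_pow, specC_tU, ← PowerSeries.coeff_map, map_add, map_mul, map_pow,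
    h1, h1, map_specC_serU, ← serF_eq_rational, coeff_serF,
    mul_div_cancel_left₀ _ (pow_ne_zero _ tL_ne_zero)]

end Specializations

/-! ### No F_k is a rational function of t. -/

section Irrational

/-- The numerators of `ratPhiConst`. -/
noncomputable def phiNum (r : ℕ) : Polynomial ℚ :=
  (if r = 0 then Polynomial.X else 0) - Polynomial.X * endJet r 0 1 + endJet r 0 0

lemma coeff_ratPhiConst (r : ℕ) : PowerSeries.coeff r ratPhiConst =
    algebraMap (Polynomial ℚ) (RatFunc ℚ) (phiNum r) / RatFunc.X ^ r := by
  rw [ratPhiConst, map_sub, map_add, coeff_tR_mul, endSer, endSer, PowerSeries.coeff_mk,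
    PowerSeries.coeff_mk, tR, PowerSeries.coeff_C, phiNum, endCoeff, endCoeff, map_add, map_sub,
    map_mul, RatFunc.algebraMap_X]
  have hX : (RatFunc.X : RatFunc ℚ) ≠ 0 := RatFunc.X_ne_zero
  split_ifs with h
  · subst h; simp only [pow_zero, RatFunc.algebraMap_X]; field_simp; ring
  · rw [map_zero]; field_simp; ring

lemma coeff_zero_phiNum (r : ℕ) : (phiNum r).coeff 0 = (-1) ^ r * (r.factorial : ℚ) := by
  rw [phiNum, Polynomial.coeff_add, Polynomial.coeff_sub, Polynomial.coeff_X_mul_zero,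
    coeff_zero_endJet r 0 0 (Nat.zero_le _)]
  split_ifs <;> simp

/-- The normalized difference of `serV 0` and its conjugate. -/
noncomputable def conjDiff (l : ℕ) : PowerSeries ℚ :=
  PowerSeries.X ^ l * ((1 - smallRoot) * specLarge ((quadSol l).1 0) -
    smallRoot * specSmall ((quadSol l).1 0))

/-- The prefactors of V(0) and its conjugate are 1/(1 - q) and 1/q; one factor t turns them into q
and 1 - q, so the difference becomes a power series. -/
lemma lau_conjDiff (l : ℕ) : lau (conjDiff l) = tL ^ (l + 1) *
    (specConj (PowerSeries.coeff l serU) - specC (PowerSeries.coeff l serU)) := by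
  have e1 := RingHom.congr_fun specC_comp_specU ((quadSol l).1 0)
  have e2 := RingHom.congr_fun specConj_comp_specU ((quadSol l).1 0)
  rw [RingHom.comp_apply, RingHom.comp_apply] at e1 e2
  rw [serU, PowerSeries.coeff_mk, map_mul, map_mul, e1, e2, specC_X, specConj_X, pow_succ,
    conjDiff, map_mul, map_pow, map_sub, map_mul, map_mul, map_sub, map_one]
  change tL ^ l * ((1 - qL) * _ - qL * _) = _
  have h1 := qL_ne_zero
  have h2 := one_sub_qL_ne_zero
  rw [← qL_mul]
  field_simp

lemma genRat_irrational (k : ℕ) (g : RatFunc ℚ) :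
    algebraMap (RatFunc ℚ) ℚ⸨X⸩ g ≠ toLaurent (genFun k) := by
  intro hg
  have h1 : genRat k = tToU g := by
    apply specC.injective
    rw [specC_genRat, ← hg, ← specC_comp]; rfl
  -- Conjugation fixes ℚ(t), so the rational parts cancel and only Φ² times the difference of the
  -- two specializations of `serU` remains.
  have h2 : specConj (genRat k) = specC (genRat k) := by
    rw [h1, ← RingHom.comp_apply, ← RingHom.comp_apply, specConj_comp, specC_comp]
  have hc : ∀ A : PowerSeries (RatFunc ℚ),
      PowerSeries.map specC (PowerSeries.map tToU A) = serMap A := by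
    intro A
    ext1 r
    rw [PowerSeries.coeff_map, PowerSeries.coeff_map, PowerSeries.coeff_map, ← specC_comp]
    rfl
  have hc' : ∀ A : PowerSeries (RatFunc ℚ),
      PowerSeries.map specConj (PowerSeries.map tToU A) = serMap A := by
    intro A
    ext1 r
    rw [PowerSeries.coeff_map, PowerSeries.coeff_map, PowerSeries.coeff_map, ← specConj_comp]
    rfl
  rw [genRat, map_div₀, map_div₀, map_pow, map_pow, specC_tU, specConj_tU,
    div_left_inj' (pow_ne_zero _ tL_ne_zero), ← PowerSeries.coeff_map, ← PowerSeries.coeff_map,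
    map_add (PowerSeries.map specConj), map_add (PowerSeries.map specC), map_mul
    (PowerSeries.map specConj), map_mul (PowerSeries.map specC), map_pow (PowerSeries.map specConj),
    map_pow (PowerSeries.map specC), hc, hc, hc', hc', ← sub_eq_zero, ← map_sub,
    add_sub_add_right_eq_sub, ← mul_sub] at h2
  have h3 := congrArg (fun x => tL ^ (k + 1) * x) h2
  simp only [mul_zero] at h3
  -- Replacing z by tz and multiplying by t clears all denominators, so the coefficients can be
  -- evaluated at t = 0.
  have h4 : PowerSeries.C tL * PowerSeries.rescale tL (serMap ratPhiConst ^ 2 *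
      (PowerSeries.map specConj serU - PowerSeries.map specC serU)) =
      PowerSeries.map lau ((PowerSeries.mk fun r => (phiNum r : PowerSeries ℚ)) ^ 2 *
        PowerSeries.mk conjDiff) := by
    have e1 : PowerSeries.rescale tL (serMap ratPhiConst) =
        PowerSeries.map lau (PowerSeries.mk fun r => (phiNum r : PowerSeries ℚ)) := by
      ext1 r
      rw [PowerSeries.coeff_rescale, PowerSeries.coeff_map, PowerSeries.coeff_map,
        PowerSeries.coeff_mk, coeff_ratPhiConst, map_div₀, map_pow, algebraMap_ratFunc_X,
        algebraMap_ratFunc_polynomial, mul_div_cancel₀ _ (pow_ne_zero _ tL_ne_zero)]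
    have e2 : PowerSeries.C tL * PowerSeries.rescale tL
        (PowerSeries.map specConj serU - PowerSeries.map specC serU) =
        PowerSeries.map lau (PowerSeries.mk conjDiff) := by
      ext1 r
      rw [PowerSeries.coeff_C_mul, PowerSeries.coeff_rescale, map_sub, PowerSeries.coeff_map,
        PowerSeries.coeff_map, PowerSeries.coeff_map, PowerSeries.coeff_mk, lau_conjDiff]
      ring
    rw [map_mul, map_pow, map_mul, map_pow, ← e1, ← e2]
    ring
  have h5 := congrArg (PowerSeries.coeff k) h4
  rw [PowerSeries.coeff_C_mul, PowerSeries.coeff_rescale, ← mul_assoc, ← pow_succ', h3,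
    PowerSeries.coeff_map, eq_comm, map_eq_zero_iff _ HahnSeries.ofPowerSeries_injective] at h5
  have h6 := congrArg PowerSeries.constantCoeff h5
  rw [← PowerSeries.coeff_map, map_mul, map_pow, map_zero] at h6
  -- At t = 0 only order 0 in z survives, with value 1 - 2q = 1.
  have h7 : PowerSeries.map (PowerSeries.constantCoeff (R := ℚ)) (PowerSeries.mk conjDiff) = 1 := by
    ext1 r
    rw [PowerSeries.coeff_map, PowerSeries.coeff_mk, PowerSeries.coeff_one, conjDiff]
    cases r with
    | zero => simp [quadSol_zero, smallRoot]
    | succ r => simp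
  rw [h7, mul_one, pow_two, PowerSeries.coeff_mul] at h6
  have h8 : ∀ p ∈ antidiagonal k,
      PowerSeries.coeff p.1 (PowerSeries.map (PowerSeries.constantCoeff (R := ℚ))
        (PowerSeries.mk fun r => (phiNum r : PowerSeries ℚ))) *
      PowerSeries.coeff p.2 (PowerSeries.map (PowerSeries.constantCoeff (R := ℚ))
        (PowerSeries.mk fun r => (phiNum r : PowerSeries ℚ))) =
      (-1) ^ k * ((p.1.factorial : ℚ) * p.2.factorial) := by
    intro p hp
    rw [HasAntidiagonal.mem_antidiagonal] at hp
    rw [PowerSeries.coeff_map, PowerSeries.coeff_map, PowerSeries.coeff_mk, PowerSeries.coeff_mk,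
      ← PowerSeries.coeff_zero_eq_constantCoeff_apply, Polynomial.coeff_coe,
      ← PowerSeries.coeff_zero_eq_constantCoeff_apply, Polynomial.coeff_coe, coeff_zero_phiNum,
      coeff_zero_phiNum, ← hp, pow_add]
    ring
  rw [Finset.sum_congr rfl h8, ← Finset.mul_sum] at h6
  have h9 : 0 < ∑ p ∈ antidiagonal k, ((p.1.factorial : ℚ) * p.2.factorial) :=
    Finset.sum_pos (fun p _ => by positivity) ⟨(k, 0), by simp⟩
  exact (mul_ne_zero (pow_ne_zero _ (by norm_num)) h9.ne') h6

end Irrational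

/-! ### Degree two over ℚ(t). -/

section Degree

lemma isRationalIn_genFun (k : ℕ) : IsRationalIn (genFun k) (genRat k) catalanGF := by
  have h := specC_genRat k
  rw [specC, ratHom_apply] at h
  refine ⟨fun h0 => ?_, h.symm⟩
  exact (RatFunc.denom_ne_zero (genRat k)) ((transcendental_iff.1
    transcendental_toLaurent_catalanGF) _ h0)

lemma catalanGF_root : Polynomial.aeval (toLaurent catalanGF)
    (Polynomial.C (RatFunc.X : RatFunc ℚ) * Polynomial.X ^ 2 + Polynomial.C (-1) * Polynomial.X +
      Polynomial.C 1) = 0 := by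
  have h := congrArg lau catalanGF_sq
  simp only [map_add, map_mul, map_pow, map_one] at h
  simp only [map_add, map_mul, map_pow, Polynomial.aeval_C, Polynomial.aeval_X, map_neg, map_one,
    algebraMap_ratFunc_X]
  change lau catalanGF ^ 2 * tL + 1 = lau catalanGF at h
  change tL * lau catalanGF ^ 2 + -1 * lau catalanGF + 1 = 0
  linear_combination h

/-- An element outside `k` of an extension generated by a root of a quadratic polynomial has
degree two. -/
lemma natDegree_minpoly_eq_two {k L : Type*} [Field k] [Field L] [Algebra k L] {a c : L}
    {P : Polynomial k} (hP : P.natDegree = 2) (hc0 : Polynomial.aeval c P = 0)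
    (ha : a ∈ IntermediateField.adjoin k {c}) (hk : ∀ g, algebraMap k L g ≠ a) :
    IsAlgebraic k a ∧ (minpoly k a).natDegree = 2 := by
  have hP0 : P ≠ 0 := fun h => by rw [h, Polynomial.natDegree_zero] at hP; omega
  have hc : IsIntegral k c := IsAlgebraic.isIntegral ⟨P, hP0, hc0⟩
  have hfin : FiniteDimensional k (IntermediateField.adjoin k {c}) :=
    IntermediateField.adjoin.finiteDimensional hc
  have hfr : Module.finrank k (IntermediateField.adjoin k {c}) ≤ 2 := by
    rw [IntermediateField.adjoin.finrank hc, ← hP]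
    exact Polynomial.natDegree_le_of_dvd (minpoly.dvd _ _ hc0) hP0
  have hint : IsIntegral k a := by
    have := Algebra.IsIntegral.isIntegral (R := k) (⟨a, ha⟩ : IntermediateField.adjoin k {c})
    exact this.map (IntermediateField.adjoin k {c}).val
  refine ⟨hint.isAlgebraic, ?_⟩
  have h1 : (minpoly k a).natDegree ≤ 2 := by
    have : minpoly k a = minpoly k (⟨a, ha⟩ : IntermediateField.adjoin k {c}) :=
      minpoly.algebraMap_eq (IntermediateField.adjoin k {c}).val.injective ⟨a, ha⟩
    rw [this]
    exact (minpoly.natDegree_le _).trans hfr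
  have h2 := minpoly.natDegree_pos hint
  have h3 : (minpoly k a).natDegree ≠ 1 := by
    intro h
    obtain ⟨g, hg⟩ := minpoly.natDegree_eq_one_iff.1 h
    exact hk g hg
  omega

lemma isAlgebraicOfDegree_genFun (k : ℕ) : IsAlgebraicOfDegree (genFun k) 2 := by
  refine natDegree_minpoly_eq_two (Polynomial.natDegree_quadratic RatFunc.X_ne_zero)
    catalanGF_root ?_ (genRat_irrational k)
  have haeval : ∀ p : Polynomial ℚ, Polynomial.aeval (toLaurent catalanGF) p ∈
      IntermediateField.adjoin (RatFunc ℚ) {toLaurent catalanGF} := by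
    intro p
    induction p using Polynomial.induction_on' with
    | add p q hp hq => rw [map_add]; exact add_mem hp hq
    | monomial n r =>
      rw [Polynomial.aeval_monomial, eq_ratCast]
      exact mul_mem (SubfieldClass.ratCast_mem _ _)
        (pow_mem (IntermediateField.mem_adjoin_simple_self _ _) _)
  rw [← specC_genRat, specC, ratHom_apply]
  exact div_mem (haeval _) (haeval _)

end Degree

/-! ### Uniqueness of polynomial and exponential-polynomial solutions. -/

section Uniqueness

lemma IsPolyDeg.eq_zero_of_second {L : Type*} [Field L] {d : ℕ} {w : ℕ → L} (hw : IsPolyDeg d w)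
    {a : L} (ha : a ≠ 0) (h : ∀ x, a * w (x + 2) - w (x + 1) + w x = 0) : ∀ x, w x = 0 := by
  induction d generalizing w with
  | zero => exact hw
  | succ d ih =>
    have := ih hw fun x => by linear_combination h (x + 1) - h x
    intro x
    have e : a * w x = 0 := by
      linear_combination h x - (2 * a - 1) * this x - a * (this (x + 1) - this x)
    exact (mul_eq_zero.1 e).resolve_left ha

/-- The value at `x` of the polynomial with the given list of coefficients. -/
def horner {L : Type*} [Semiring L] (l : List L) (x : L) : L := l.foldr (fun c s => c + x * s) 0

lemma isPoly_horner {L : Type*} [CommRing L] (l : List L) :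
    IsPoly fun x : ℕ => horner l (x : L) := by
  induction l with
  | nil => exact isPoly_const 0
  | cons c l ih => exact (isPoly_const c).add (isPoly_natCast.mul ih)

variable {F : Type*} [Field F] {t : F}

lemma isExpPoly_horner (t : F) (l : List F) : IsExpPoly t fun x : ℕ => t ^ x * horner l (x : F) :=
  ⟨0, _, isPoly_horner l, fun _ _ => rfl⟩

/-- Since α ≠ t, the polynomial factor vanishes for large x; since α ≠ 0, the zeros propagate
backwards. -/
lemma IsExpPoly.eq_zero {f : ℕ → F} (hf : IsExpPoly t f) (ht : t ≠ 0) {α : F} (hα : α ≠ 0)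
    (hαt : α ≠ t) (h : ∀ x, f (x + 1) - α * f x = 0) : ∀ x, f x = 0 := by
  obtain ⟨N, p, ⟨d, hd⟩, hf⟩ := hf
  have hs : ∀ n, IsPolyDeg d fun x => p (x + n) := by
    intro n
    induction n with
    | zero => exact hd
    | succ n ih => exact ih.shift.congr fun x => by rw [add_right_comm, add_assoc]
  have h1 := (hs N).eq_zero (sub_ne_zero.2 hαt.symm) (c := t) fun x => by
    have e := h (x + N)
    rw [hf _ (by omega), hf _ (by omega)] at e
    have : t ^ (x + N) * ((t - α) * p (x + N) + t * (p (x + N + 1) - p (x + N))) = 0 := by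
      linear_combination e
    rw [add_right_comm]
    exact (mul_eq_zero.1 this).resolve_left (pow_ne_zero _ ht)
  have h2 : ∀ n x, N ≤ x + n → f x = 0 := by
    intro n
    induction n with
    | zero =>
      intro x hx
      have := h1 (x - N)
      rw [Nat.sub_add_cancel (show N ≤ x by omega)] at this
      rw [hf x hx, this, mul_zero]
    | succ n ih =>
      intro x hx
      have := h x
      rw [ih (x + 1) (by omega), zero_sub, neg_eq_zero] at this
      exact (mul_eq_zero.1 this).resolve_left hα
  exact fun x => h2 N x (by omega)

end Uniqueness

/-! ### Closed forms for the end solution, W, the tails and Ψ. -/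

section Explicit

local notation "t" => (RatFunc.X : RatFunc ℚ)

lemma one_sub_X_ne_zero : 1 - t ≠ 0 := by
  rw [sub_ne_zero, ← map_one RatFunc.C]; exact (ratFunc_X_ne_C 1).symm

/-- A polynomial solution is unique, so a proposed closed form needs no initial values. -/
lemma endCoeff_eq {r : ℕ} {l : List (RatFunc ℚ)} {g : ℕ → RatFunc ℚ}
    (h : ∀ D : ℕ, t * endCoeff r (D + 2) - endCoeff r (D + 1) + endCoeff r D = g D)
    (h' : ∀ D : ℕ, t * horner l ((D + 2 : ℕ) : RatFunc ℚ) - horner l ((D + 1 : ℕ) : RatFunc ℚ) +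
      horner l (D : RatFunc ℚ) = g D) (D : ℕ) : endCoeff r D = horner l (D : RatFunc ℚ) := by
  have hp : IsPoly fun D => endCoeff r D :=
    (isPoly_coeff_endSer r).congr fun D => by rw [endSer, PowerSeries.coeff_mk]
  obtain ⟨d, hd⟩ := hp.sub (isPoly_horner l)
  exact sub_eq_zero.1 (hd.eq_zero_of_second RatFunc.X_ne_zero
    (fun D => by linear_combination h D - h' D) D)

lemma endCoeff_zero (D : ℕ) : endCoeff 0 D = -1 := by
  rw [endCoeff_eq (l := [-1]) endCoeff_zero_eq fun D => ?_]
  · simp [horner]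
  · simp only [horner, List.foldr]
    ring

lemma endCoeff_one (D : ℕ) : endCoeff 1 D =
    horner [(1 - 2 * t) / t, 1] (D : RatFunc ℚ) := by
  have h0 : t ≠ 0 := RatFunc.X_ne_zero
  refine endCoeff_eq (endCoeff_succ_eq 0) (fun D => ?_) D
  simp only [endCoeff_zero, horner, List.foldr]
  push_cast
  field_simp
  ring

lemma endCoeff_two (D : ℕ) : endCoeff 2 D =
    horner [-(2 - 6 * t + 3 * t ^ 2) / t ^ 2, -(2 - 3 * t) / t, -1] (D : RatFunc ℚ) := by
  have h0 : t ≠ 0 := RatFunc.X_ne_zero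
  refine endCoeff_eq (endCoeff_succ_eq 1) (fun D => ?_) D
  simp only [endCoeff_one, horner, List.foldr]
  push_cast
  field_simp
  ring

lemma endCoeff_three (D : ℕ) : endCoeff 3 D =
    horner [(6 - 24 * t + 23 * t ^ 2 - 4 * t ^ 3) / t ^ 3, (6 - 15 * t + 6 * t ^ 2) / t ^ 2,
      (3 - 4 * t) / t, 1] (D : RatFunc ℚ) := by
  have h0 : t ≠ 0 := RatFunc.X_ne_zero
  refine endCoeff_eq (endCoeff_succ_eq 2) (fun D => ?_) D
  simp only [endCoeff_two, horner, List.foldr]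
  push_cast
  field_simp
  ring

lemma coeff_ratPhiConst_zero : PowerSeries.coeff 0 ratPhiConst = 1 := by
  simp [ratPhiConst, endSer, endCoeff_zero, tR]

lemma coeff_succ_ratPhiConst (r : ℕ) : PowerSeries.coeff (r + 1) ratPhiConst =
    t * endCoeff (r + 1) 1 - endCoeff (r + 1) 0 := by
  rw [ratPhiConst, map_sub, map_add, coeff_tR_mul, tR, PowerSeries.coeff_C, if_neg (by omega),
    endSer, endSer, PowerSeries.coeff_mk, PowerSeries.coeff_mk, zero_add]

lemma coeff_ratPhiConst_one : PowerSeries.coeff 1 ratPhiConst = (-1 + 3 * t - t ^ 2) / t := by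
  have h0 : t ≠ 0 := RatFunc.X_ne_zero
  rw [coeff_succ_ratPhiConst, endCoeff_one, endCoeff_one]
  simp only [horner, List.foldr]
  push_cast
  field_simp
  ring

lemma coeff_ratPhiConst_two : PowerSeries.coeff 2 ratPhiConst =
    (2 - 8 * t + 7 * t ^ 2 - t ^ 3) / t ^ 2 := by
  have h0 : t ≠ 0 := RatFunc.X_ne_zero
  rw [coeff_succ_ratPhiConst, endCoeff_two, endCoeff_two]
  simp only [horner, List.foldr]
  push_cast
  field_simp
  ring

lemma coeff_ratPhiConst_three : PowerSeries.coeff 3 ratPhiConst =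
    (-6 + 30 * t - 41 * t ^ 2 + 15 * t ^ 3 - t ^ 4) / t ^ 3 := by
  have h0 : t ≠ 0 := RatFunc.X_ne_zero
  rw [coeff_succ_ratPhiConst, endCoeff_three, endCoeff_three]
  simp only [horner, List.foldr]
  push_cast
  field_simp
  ring

lemma coeff_zero_ratW (x : ℕ) : PowerSeries.coeff 0 (ratW x) = t ^ x := by
  induction x with
  | zero => simp [ratW]
  | succ x ih =>
    rw [ratW_succ, show tR * (1 + PowerSeries.X * (x : PowerSeries (RatFunc ℚ))) * ratW x =
      tR * (ratW x + PowerSeries.X * ((x : PowerSeries (RatFunc ℚ)) * ratW x)) by ring,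
      coeff_tR_mul, map_add,
      PowerSeries.coeff_zero_X_mul, ih]
    ring

lemma coeff_ratW_eq {r : ℕ} {f : ℕ → RatFunc ℚ} {p : ℕ → RatFunc ℚ}
    (hf : ∀ x, PowerSeries.coeff r (ratW x) = t ^ x * f x) (h0 : p 0 = 0)
    (hp : ∀ x : ℕ, p (x + 1) = p x + x * f x) (x : ℕ) :
    PowerSeries.coeff (r + 1) (ratW x) = t ^ x * p x := by
  induction x with
  | zero => simp [ratW, h0, PowerSeries.coeff_one]
  | succ x ih =>
    rw [ratW_succ, show tR * (1 + PowerSeries.X * (x : PowerSeries (RatFunc ℚ))) * ratW x =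
      tR * (ratW x + PowerSeries.X * ((x : PowerSeries (RatFunc ℚ)) * ratW x)) by ring,
      coeff_tR_mul, map_add,
      PowerSeries.coeff_succ_X_mul, coeff_natCast_mul', ih, hf, hp]
    ring

lemma coeff_one_ratW (x : ℕ) : PowerSeries.coeff 1 (ratW x) =
    t ^ x * ((x : RatFunc ℚ) * (x - 1) / 2) :=
  coeff_ratW_eq (f := fun _ => 1) (p := fun x => (x : RatFunc ℚ) * (x - 1) / 2)
    (fun x => by rw [coeff_zero_ratW, mul_one]) (by simp)
    (fun x => by push_cast; field_simp; ring) x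

lemma coeff_two_ratW (x : ℕ) : PowerSeries.coeff 2 (ratW x) =
    t ^ x * ((x : RatFunc ℚ) * (x - 1) * (x - 2) * (3 * x - 1) / 24) :=
  coeff_ratW_eq (p := fun x => (x : RatFunc ℚ) * (x - 1) * (x - 2) * (3 * x - 1) / 24)
    coeff_one_ratW (by simp) (fun x => by push_cast; field_simp; ring) x

lemma coeff_three_ratW (x : ℕ) : PowerSeries.coeff 3 (ratW x) =
    t ^ x * ((x : RatFunc ℚ) ^ 2 * (x - 1) ^ 2 * (x - 2) * (x - 3) / 48) :=
  coeff_ratW_eq (p := fun x => (x : RatFunc ℚ) ^ 2 * (x - 1) ^ 2 * (x - 2) * (x - 3) / 48)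
    coeff_two_ratW (by simp) (fun x => by push_cast; field_simp; ring) x

lemma ratTail_sub (x : ℕ) : ratTail x - ratTail (x + 1) = ratPhi x :=
  exists_ratTail.choose_spec.2 x

/-- The index is shifted by one because `ratPhi 0 = 1` does not fit the pattern of the later terms.
-/
lemma coeff_ratTail_eq {r : ℕ} {l : List (RatFunc ℚ)}
    (h : ∀ x : ℕ, t ^ x * horner l (x : RatFunc ℚ) -
      t ^ (x + 1) * horner l ((x + 1 : ℕ) : RatFunc ℚ) =
      t * PowerSeries.coeff r (ratW x)) (x : ℕ) :
    PowerSeries.coeff r (ratTail (x + 1)) = t ^ x * horner l x := by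
  have hT : IsExpPoly t fun x => PowerSeries.coeff r (ratTail (x + 1)) :=
    (IsExpPolySer.shift exists_ratTail.choose_spec.1) r
  refine sub_eq_zero.1 ((hT.sub (isExpPoly_horner t l)).eq_zero RatFunc.X_ne_zero one_ne_zero
    (sub_ne_zero.1 one_sub_X_ne_zero) (fun x => ?_) x)
  have e := congrArg (PowerSeries.coeff r) (ratTail_sub (x + 1))
  rw [ratPhi, coeff_tR_mul, map_sub, ← h] at e
  linear_combination -e

lemma coeff_zero_ratTail (x : ℕ) : PowerSeries.coeff 0 (ratTail (x + 1)) =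
    t ^ x * horner [t / (1 - t)] (x : RatFunc ℚ) := by
  have h1 := one_sub_X_ne_zero
  refine coeff_ratTail_eq (fun x => ?_) x
  rw [coeff_zero_ratW]
  simp only [horner, List.foldr]
  field_simp
  ring

lemma coeff_one_ratTail (x : ℕ) : PowerSeries.coeff 1 (ratTail (x + 1)) =
    t ^ x * horner [t ^ 3 / (1 - t) ^ 3, (-t + 3 * t ^ 2) / (2 * (1 - t) ^ 2),
      t / (2 * (1 - t))] (x : RatFunc ℚ) := by
  have h1 := one_sub_X_ne_zero
  refine coeff_ratTail_eq (fun x => ?_) x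
  rw [coeff_one_ratW]
  simp only [horner, List.foldr]
  push_cast
  field_simp
  ring

lemma coeff_two_ratTail (x : ℕ) : PowerSeries.coeff 2 (ratTail (x + 1)) =
    t ^ x * horner [(2 * t ^ 4 + t ^ 5) / (1 - t) ^ 5,
      (-t + 3 * t ^ 2 + 3 * t ^ 3 + 31 * t ^ 4) / (12 * (1 - t) ^ 4),
      (3 * t - 10 * t ^ 2 + 19 * t ^ 3) / (8 * (1 - t) ^ 3),
      (-5 * t + 11 * t ^ 2) / (12 * (1 - t) ^ 2), t / (8 * (1 - t))] (x : RatFunc ℚ) := by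
  have h1 := one_sub_X_ne_zero
  refine coeff_ratTail_eq (fun x => ?_) x
  rw [coeff_two_ratW]
  simp only [horner, List.foldr]
  push_cast
  field_simp
  ring

lemma coeff_ratTail_zero (r : ℕ) : PowerSeries.coeff r (ratTail 0) =
    PowerSeries.coeff r (ratTail (0 + 1)) + if r = 0 then 1 else 0 := by
  have e := congrArg (PowerSeries.coeff r) (ratTail_sub 0)
  rw [ratPhi, map_sub, PowerSeries.coeff_one] at e
  linear_combination e

lemma coeff_ratPsi_zero (r : ℕ) : PowerSeries.coeff r (ratPsi 0) =
    t * (PowerSeries.coeff r (ratTail (0 + 1)) + if r = 0 then 1 else 0) := by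
  rw [ratPsi, coeff_tR_mul, coeff_ratTail_zero]

lemma coeff_zero_ratPsi (x : ℕ) : PowerSeries.coeff 0 (ratPsi (x + 1)) =
    t ^ x * horner [t ^ 2 / (1 - t)] (x : RatFunc ℚ) := by
  rw [ratPsi, mul_assoc, mul_assoc, map_add, coeff_tR_mul, coeff_tR_mul,
    PowerSeries.coeff_zero_X_mul, coeff_zero_ratTail]
  simp only [horner, List.foldr]
  ring

lemma coeff_succ_ratPsi_one (r : ℕ) : PowerSeries.coeff (r + 1) (ratPsi (0 + 1)) =
    t * PowerSeries.coeff (r + 1) (ratTail (0 + 1)) := by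
  rw [ratPsi, Nat.cast_zero, mul_zero, zero_mul, add_zero, coeff_tR_mul]

lemma coeff_succ_ratPsi (r x : ℕ) : PowerSeries.coeff (r + 1) (ratPsi (x + 1 + 1)) =
    t * (PowerSeries.coeff (r + 1) (ratTail (x + 1 + 1)) +
      ((x : RatFunc ℚ) + 1) * PowerSeries.coeff r (ratPsi (x + 1))) := by
  rw [ratPsi, mul_assoc, mul_assoc, map_add, coeff_tR_mul, coeff_tR_mul,
    PowerSeries.coeff_succ_X_mul, coeff_natCast_mul']
  push_cast
  ring

lemma coeff_one_ratPsi (x : ℕ) : PowerSeries.coeff 1 (ratPsi (x + 1)) =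
    t ^ x * horner [t ^ 4 / (1 - t) ^ 3, (t ^ 2 + t ^ 3) / (2 * (1 - t) ^ 2),
      t ^ 2 / (2 * (1 - t))] (x : RatFunc ℚ) := by
  have h1 := one_sub_X_ne_zero
  cases x with
  | zero =>
    rw [coeff_succ_ratPsi_one, coeff_one_ratTail]
    simp only [horner, List.foldr]
    push_cast
    field_simp
    ring
  | succ x =>
    rw [coeff_succ_ratPsi, coeff_one_ratTail, coeff_zero_ratPsi]
    simp only [horner, List.foldr]
    push_cast
    field_simp
    ring

lemma coeff_two_ratPsi (x : ℕ) : PowerSeries.coeff 2 (ratPsi (x + 1)) =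
    t ^ x * horner [(2 * t ^ 5 + t ^ 6) / (1 - t) ^ 5,
      (-t ^ 2 - 9 * t ^ 3 + 39 * t ^ 4 + 7 * t ^ 5) / (12 * (1 - t) ^ 4),
      (-t ^ 2 + 6 * t ^ 3 + 7 * t ^ 4) / (8 * (1 - t) ^ 3),
      (t ^ 2 + 5 * t ^ 3) / (12 * (1 - t) ^ 2), t ^ 2 / (8 * (1 - t))] (x : RatFunc ℚ) := by
  have h1 := one_sub_X_ne_zero
  cases x with
  | zero =>
    rw [coeff_succ_ratPsi_one, coeff_two_ratTail]
    simp only [horner, List.foldr]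
    push_cast
    field_simp
    ring
  | succ x =>
    rw [coeff_succ_ratPsi, coeff_two_ratTail, coeff_one_ratPsi]
    simp only [horner, List.foldr]
    push_cast
    field_simp
    ring

end Explicit

/-! ### Closed forms for the floor solution. -/

section ExplicitFloor

local notation "t" => (RatFunc.X : RatFunc ℚ)

/-- No initial value is required: the exponential-polynomial tail determines the exceptional first
values backwards, as 1 - t is invertible. -/
lemma floorCoeff_eq {r : ℕ} {y f : ℕ → RatFunc ℚ} (h : IsFloorStep r y (floorCoeff r).1)
    (hf : IsExpPoly t f) (h' : IsFloorStep r y f) (x : ℕ) : (floorCoeff r).1 x = f x := by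
  have h2 : 1 - t ≠ t := by
    intro h
    apply ratFunc_X_ne_C (1 / 2)
    rw [map_div₀, map_one, map_ofNat]
    linear_combination -h / 2
  exact sub_eq_zero.1 (((floorCoeff r).2.sub hf).eq_zero RatFunc.X_ne_zero one_sub_X_ne_zero h2
    (fun x => by linear_combination h x - h' x) x)

lemma coeff_floorRhs_zero (r : ℕ) : PowerSeries.coeff (r + 1) (floorRhs 0) =
    -(t * endCoeff (r + 1) 0) - t * PowerSeries.coeff r (ratPsi 0) := by
  rw [floorRhs, if_pos rfl, add_zero, map_sub, map_neg, coeff_tR_mul, coeff_tR_mul,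
    PowerSeries.coeff_succ_X_mul, map_add, ratPhi, PowerSeries.coeff_one, if_neg (by omega),
    show ratW 0 = 1 by simp [ratW], one_mul, endSer, PowerSeries.coeff_mk, add_zero]

lemma coeff_floorRhs_succ (r x : ℕ) : PowerSeries.coeff (r + 1) (floorRhs (x + 1)) =
    -(t * (∑ i ∈ range (r + 2), PowerSeries.coeff i (ratW (x + 1)) *
      endCoeff (r + 1 - i) (x + 1) + t * PowerSeries.coeff (r + 1) (ratW x))) -
      t * PowerSeries.coeff r (ratPsi (x + 1)) + t * PowerSeries.coeff r (ratPsi x) := by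
  rw [floorRhs, if_neg (by omega), Nat.add_sub_cancel, map_add, map_sub, map_neg, coeff_tR_mul,
    coeff_tR_mul, coeff_tR_mul, PowerSeries.coeff_succ_X_mul, PowerSeries.coeff_succ_X_mul,
    map_add, ratPhi, coeff_tR_mul, PowerSeries.coeff_mul,
    Finset.Nat.sum_antidiagonal_eq_sum_range_succ_mk]
  simp only [endSer, PowerSeries.coeff_mk]

/-- At order 0 the source vanishes, because `ratW x * endSer x` and `ratPhi x` cancel. -/
lemma floorCoeff_zero_eq (x : ℕ) : (floorCoeff 0).1 x = 0 := by
  refine floorCoeff_eq (f := fun _ => 0) floorCoeff_zero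
    (isExpPoly_of_eventually_zero (N := 0) fun _ _ => rfl) (fun x => ?_) x
  cases x with
  | zero => simp [floorRhs, tR, ratW, ratPhi, endSer, endCoeff_zero]
  | succ x =>
    rw [floorRhs, map_add, map_sub, map_neg, coeff_tR_mul, coeff_tR_mul,
      PowerSeries.coeff_zero_X_mul, map_add, ratPhi, coeff_tR_mul, if_neg (by omega),
      coeff_tR_mul, PowerSeries.coeff_zero_X_mul, PowerSeries.coeff_mul]
    simp only [endSer, PowerSeries.coeff_mk, Nat.antidiagonal_zero, sum_singleton, endCoeff_zero,
      coeff_zero_ratW]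
    ring

/-- The coefficient of `z` in `floorSer`. -/
noncomputable def floorOne : ℕ → RatFunc ℚ
  | 0 => (1 - 2 * t + 2 * t ^ 2) / (1 - t) ^ 2
  | y + 1 => t ^ y * horner [t] (y : RatFunc ℚ)

/-- The coefficient of `z ^ 2` in `floorSer`. -/
noncomputable def floorTwo : ℕ → RatFunc ℚ
  | 0 => (-2 + 10 * t - 21 * t ^ 2 + 22 * t ^ 3 - 12 * t ^ 4 + 4 * t ^ 5 + t ^ 6) /
      (t * (1 - t) ^ 4)
  | 1 => (-2 + 7 * t - 10 * t ^ 2 + 7 * t ^ 3 - t ^ 4) / (1 - t) ^ 3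
  | y + 2 => t ^ y * horner [(-2 * t + 3 * t ^ 2 - 2 * t ^ 3) / (1 - t), t ^ 2 / 2, t ^ 2 / 2]
      (y : RatFunc ℚ)

/-- The coefficient of `z ^ 3` in `floorSer`. -/
noncomputable def floorThree : ℕ → RatFunc ℚ
  | 0 => (6 - 48 * t + 167 * t ^ 2 - 328 * t ^ 3 + 398 * t ^ 4 - 306 * t ^ 5 + 144 * t ^ 6 -
      38 * t ^ 7 + 10 * t ^ 8 + 2 * t ^ 9) / (t ^ 2 * (1 - t) ^ 6)
  | 1 => (6 - 38 * t + 103 * t ^ 2 - 153 * t ^ 3 + 133 * t ^ 4 - 69 * t ^ 5 + 21 * t ^ 6 +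
      t ^ 7) / (t * (1 - t) ^ 5)
  | 2 => (6 - 30 * t + 63 * t ^ 2 - 71 * t ^ 3 + 45 * t ^ 4 - 14 * t ^ 5 + 3 * t ^ 6) /
      (1 - t) ^ 4
  | y + 3 => t ^ y * horner
      [(6 * t - 24 * t ^ 2 + 40 * t ^ 3 - 37 * t ^ 4 + 19 * t ^ 5 - 5 * t ^ 6) / (1 - t) ^ 3,
      (-12 * t ^ 2 + 47 * t ^ 3 - 88 * t ^ 4 + 41 * t ^ 5) / (12 * (1 - t) ^ 2),
      (-8 * t ^ 2 + 19 * t ^ 3 - 15 * t ^ 4) / (8 * (1 - t)), 7 * t ^ 3 / 12, t ^ 3 / 8]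
      (y : RatFunc ℚ)

lemma floorCoeff_one_eq (x : ℕ) : (floorCoeff 1).1 x = floorOne x := by
  have h0 : t ≠ 0 := RatFunc.X_ne_zero
  have h1 := one_sub_X_ne_zero
  refine floorCoeff_eq (floorCoeff_succ 0)
    ((isExpPoly_horner t _).of_shift h0 fun x => rfl) (fun x => ?_) x
  simp only [floorCoeff_zero_eq]
  rcases x with _ | _ | x
  · rw [coeff_floorRhs_zero, coeff_ratPsi_zero, coeff_zero_ratTail]
    simp only [Nat.reduceAdd, endCoeff_one]
    simp only [floorOne, horner, List.foldr]
    push_cast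
    field_simp
    ring
  · rw [coeff_floorRhs_succ, coeff_zero_ratPsi, coeff_ratPsi_zero, coeff_zero_ratTail]
    simp only [sum_range_succ, sum_range_zero, Nat.reduceAdd, Nat.reduceSub,
      coeff_zero_ratW, coeff_one_ratW,
      endCoeff_zero, endCoeff_one]
    simp only [floorOne, horner, List.foldr]
    push_cast
    field_simp
    ring
  · rw [coeff_floorRhs_succ, coeff_zero_ratPsi, coeff_zero_ratPsi]
    simp only [sum_range_succ, sum_range_zero, Nat.reduceAdd, Nat.reduceSub,
      coeff_zero_ratW, coeff_one_ratW,
      endCoeff_zero, endCoeff_one]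
    simp only [floorOne, horner, List.foldr]
    push_cast
    field_simp
    ring

lemma floorCoeff_two_eq (x : ℕ) : (floorCoeff 2).1 x = floorTwo x := by
  have h0 : t ≠ 0 := RatFunc.X_ne_zero
  have h1 := one_sub_X_ne_zero
  refine floorCoeff_eq (floorCoeff_succ 1)
    (((isExpPoly_horner t _).of_shift (g := fun x => floorTwo (x + 1)) h0 fun x => rfl).of_shift
      h0 fun x => rfl) (fun x => ?_) x
  simp only [floorCoeff_one_eq]
  rcases x with _ | _ | x
  · rw [coeff_floorRhs_zero, coeff_ratPsi_zero, coeff_one_ratTail]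
    simp only [Nat.reduceAdd, endCoeff_two]
    simp only [floorTwo, floorOne, horner, List.foldr]
    push_cast
    field_simp
    ring
  · rw [coeff_floorRhs_succ, coeff_one_ratPsi, coeff_ratPsi_zero, coeff_one_ratTail]
    simp only [sum_range_succ, sum_range_zero, Nat.reduceAdd, Nat.reduceSub,
      coeff_zero_ratW, coeff_one_ratW, coeff_two_ratW,
      endCoeff_zero, endCoeff_one, endCoeff_two]
    simp only [floorTwo, floorOne, horner, List.foldr]
    push_cast
    field_simp
    ring
  · rw [coeff_floorRhs_succ, coeff_one_ratPsi, coeff_one_ratPsi]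
    simp only [sum_range_succ, sum_range_zero, Nat.reduceAdd, Nat.reduceSub,
      coeff_zero_ratW, coeff_one_ratW, coeff_two_ratW,
      endCoeff_zero, endCoeff_one, endCoeff_two]
    simp only [floorTwo, floorOne, horner, List.foldr]
    push_cast
    field_simp
    ring

lemma floorCoeff_three_eq (x : ℕ) : (floorCoeff 3).1 x = floorThree x := by
  have h0 : t ≠ 0 := RatFunc.X_ne_zero
  have h1 := one_sub_X_ne_zero
  refine floorCoeff_eq (floorCoeff_succ 2)
    ((((isExpPoly_horner t _).of_shift (g := fun x => floorThree (x + 2)) h0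
      fun x => rfl).of_shift (g := fun x => floorThree (x + 1))
      h0 fun x => rfl).of_shift h0 fun x => rfl) (fun x => ?_) x
  simp only [floorCoeff_two_eq]
  rcases x with _ | _ | _ | x
  · rw [coeff_floorRhs_zero, coeff_ratPsi_zero, coeff_two_ratTail]
    simp only [Nat.reduceAdd, endCoeff_three]
    simp only [floorThree, floorTwo, horner, List.foldr]
    push_cast
    field_simp
    ring
  · rw [coeff_floorRhs_succ, coeff_two_ratPsi, coeff_ratPsi_zero, coeff_two_ratTail]
    simp only [sum_range_succ, sum_range_zero, Nat.reduceAdd, Nat.reduceSub,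
      coeff_zero_ratW, coeff_one_ratW, coeff_two_ratW, coeff_three_ratW,
      endCoeff_zero, endCoeff_one, endCoeff_two, endCoeff_three]
    simp only [floorThree, floorTwo, horner, List.foldr]
    push_cast
    field_simp
    ring
  · rw [coeff_floorRhs_succ, coeff_two_ratPsi, coeff_two_ratPsi]
    simp only [sum_range_succ, sum_range_zero, Nat.reduceAdd, Nat.reduceSub,
      coeff_zero_ratW, coeff_one_ratW, coeff_two_ratW, coeff_three_ratW,
      endCoeff_zero, endCoeff_one, endCoeff_two, endCoeff_three]
    simp only [floorThree, floorTwo, horner, List.foldr]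
    push_cast
    field_simp
    ring
  · rw [coeff_floorRhs_succ, coeff_two_ratPsi, coeff_two_ratPsi]
    simp only [sum_range_succ, sum_range_zero, Nat.reduceAdd, Nat.reduceSub,
      coeff_zero_ratW, coeff_one_ratW, coeff_two_ratW, coeff_three_ratW,
      endCoeff_zero, endCoeff_one, endCoeff_two, endCoeff_three]
    simp only [floorThree, floorTwo, horner, List.foldr]
    push_cast
    field_simp
    ring

end ExplicitFloor

/-! ### Closed forms for the rational part. -/

section ExplicitPart

local notation "t" => (RatFunc.X : RatFunc ℚ)

lemma coeff_succ_ratPart (r : ℕ) : PowerSeries.coeff (r + 1) ratPart =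
    ∑ i ∈ range (r + 2), PowerSeries.coeff i ratPhiConst * endCoeff (r + 1 - i) 0 +
      t * (endCoeff (r + 1) 0 + (floorCoeff (r + 1)).1 0) := by
  rw [ratPart, map_add, map_add, coeff_tR_mul, PowerSeries.coeff_mul,
    Finset.Nat.sum_antidiagonal_eq_sum_range_succ_mk]
  simp only [map_add, endSer, floorSer, PowerSeries.coeff_mk, PowerSeries.coeff_one,
    if_neg (Nat.succ_ne_zero r), zero_add, add_zero]

lemma coeff_one_ratPart : PowerSeries.coeff 1 ratPart =
    (2 - 8 * t + 10 * t ^ 2 - 4 * t ^ 3 + t ^ 4) / (t * (1 - t) ^ 2) := by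
  have h0 : t ≠ 0 := RatFunc.X_ne_zero
  have h1 := one_sub_X_ne_zero
  rw [coeff_succ_ratPart]
  simp only [sum_range_succ, sum_range_zero, Nat.reduceAdd, Nat.reduceSub, floorCoeff_one_eq,
    coeff_ratPhiConst_zero, coeff_ratPhiConst_one, endCoeff_zero, endCoeff_one,
    floorOne, horner, List.foldr]
  push_cast
  field_simp
  ring

lemma coeff_two_ratPart : PowerSeries.coeff 2 ratPart =
    (-5 + 37 * t - 111 * t ^ 2 + 176 * t ^ 3 - 160 * t ^ 4 + 83 * t ^ 5 - 23 * t ^ 6 + 4 * t ^ 7 +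
      t ^ 8) / (t ^ 2 * (1 - t) ^ 4) := by
  have h0 : t ≠ 0 := RatFunc.X_ne_zero
  have h1 := one_sub_X_ne_zero
  rw [coeff_succ_ratPart]
  simp only [sum_range_succ, sum_range_zero, Nat.reduceAdd, Nat.reduceSub, floorCoeff_two_eq,
    coeff_ratPhiConst_zero, coeff_ratPhiConst_one, coeff_ratPhiConst_two,
    endCoeff_zero, endCoeff_one, endCoeff_two,
    floorTwo, horner, List.foldr]
  push_cast
  field_simp
  ring

lemma coeff_three_ratPart : PowerSeries.coeff 3 ratPart =
    (16 - 168 * t + 764 * t ^ 2 - 1990 * t ^ 3 + 3295 * t ^ 4 - 3626 * t ^ 5 + 2686 * t ^ 6 -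
      1324 * t ^ 7 + 416 * t ^ 8 - 76 * t ^ 9 + 12 * t ^ 10 + 2 * t ^ 11) /
      (t ^ 3 * (1 - t) ^ 6) := by
  have h0 : t ≠ 0 := RatFunc.X_ne_zero
  have h1 := one_sub_X_ne_zero
  rw [coeff_succ_ratPart]
  simp only [sum_range_succ, sum_range_zero, Nat.reduceAdd, Nat.reduceSub, floorCoeff_three_eq,
    coeff_ratPhiConst_zero, coeff_ratPhiConst_one, coeff_ratPhiConst_two,
    coeff_ratPhiConst_three, endCoeff_zero, endCoeff_one, endCoeff_two, endCoeff_three,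
    floorThree, horner, List.foldr]
  push_cast
  field_simp
  ring

end ExplicitPart

/-! ### Closed forms for V in s = u - 1, where q = s/(1 + s). -/

section ExplicitQuad

lemma quadStep_eq {L : Type*} [Field L] {q : L} (hq : 2 * q - 1 ≠ 0) (hq1 : q ≠ 1)
    {u v : ℕ → L} (hv : IsPoly v) (h : IsQuadStep q u v) {l : List L}
    (h1 : ∀ D : ℕ, q * horner l ((D : L) + 2) - horner l ((D : L) + 1) +
      (1 - q) * horner l (D : L) = (1 - q) * (q * ((D + 1) * u (D + 1)) - D * u D))
    (h2 : q * horner l 1 = horner l 0) (D : ℕ) :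
    v D = horner l (D : L) := by
  refine quadStep_unique hq hq1 hv (isPoly_horner l) h ⟨fun D => ?_, ?_⟩ D
  · push_cast; exact h1 D
  · simpa using h2

/-- The coefficients of the polynomial `quadSol 1` at `q = s / (1 + s)`. -/
def quadOne {L : Type*} [Field L] (s : L) : List L :=
  [s ^ 3 / ((1 - s) ^ 2 * (1 + s)),
    (-1 + 2 * s) / (2 * (1 - s) ^ 2),
    1 / (2 * (1 - s) * (1 + s))]

/-- The coefficients of the polynomial `quadSol 2` at `q = s / (1 + s)`. -/
def quadTwo {L : Type*} [Field L] (s : L) : List L :=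
  [(2 * s ^ 4 + 2 * s ^ 5 + 2 * s ^ 6 - s ^ 7) / ((1 - s) ^ 5 * (1 + s) ^ 2),
    (-1 + 4 * s - 5 * s ^ 2 + 2 * s ^ 3 + 42 * s ^ 4 - 12 * s ^ 5) / (12 * (1 - s) ^ 5 * (1 + s)),
    (3 - 6 * s - 5 * s ^ 2 + 24 * s ^ 3 + 4 * s ^ 4) / (8 * (1 - s) ^ 4 * (1 + s) ^ 2),
    (-5 + 10 * s) / (12 * (1 - s) ^ 3 * (1 + s)),
    1 / (8 * (1 - s) ^ 2 * (1 + s) ^ 2)]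

/-- The coefficients of the polynomial `quadSol 3` at `q = s / (1 + s)`. -/
def quadThree {L : Type*} [Field L] (s : L) : List L :=
  [(6 * s ^ 5 + 16 * s ^ 6 + 27 * s ^ 7 + 12 * s ^ 8 + 2 * s ^ 9 - 4 * s ^ 10 + s ^ 11) /
      ((1 - s) ^ 8 * (1 + s) ^ 3),
    (-s ^ 3 + 11 * s ^ 4 + 123 * s ^ 5 + 163 * s ^ 6 + 118 * s ^ 7 - 66 * s ^ 8 + 12 * s ^ 9) /
      (12 * (1 - s) ^ 8 * (1 + s) ^ 2),
    (3 - 12 * s + 8 * s ^ 2 + 27 * s ^ 3 + 4 * s ^ 4 + 185 * s ^ 5 + 469 * s ^ 6 + 48 * s ^ 7 -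
      12 * s ^ 8) / (24 * (1 - s) ^ 7 * (1 + s) ^ 3),
    (-17 + 68 * s - 61 * s ^ 2 - 106 * s ^ 3 + 348 * s ^ 4 + 8 * s ^ 5) /
      (48 * (1 - s) ^ 6 * (1 + s) ^ 2),
    (17 - 34 * s - 35 * s ^ 2 + 106 * s ^ 3 + 46 * s ^ 4) / (48 * (1 - s) ^ 5 * (1 + s) ^ 3),
    (-7 + 14 * s) / (48 * (1 - s) ^ 4 * (1 + s) ^ 2),
    1 / (48 * (1 - s) ^ 3 * (1 + s) ^ 3)]

lemma X_eq_one_add : (RatFunc.X : RatFunc ℚ) = 1 + (RatFunc.X - 1) := by ring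

lemma qU_eq : qU = (RatFunc.X - 1) / (1 + (RatFunc.X - 1)) := by
  have h : (RatFunc.X : RatFunc ℚ) ≠ 0 := RatFunc.X_ne_zero
  rw [← X_eq_one_add, qU]
  field_simp

lemma tU_eq : tU = (RatFunc.X - 1) / (1 + (RatFunc.X - 1)) ^ 2 := by
  have h : (RatFunc.X : RatFunc ℚ) ≠ 0 := RatFunc.X_ne_zero
  rw [tU, qU_eq, ← X_eq_one_add]
  field_simp
  ring

lemma specU_quadSol_succ (r : ℕ) : IsQuadStep qU (fun D => specU ((quadSol r).1 D))
    fun D => specU ((quadSol (r + 1)).1 D) := by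
  have := (quadSol_succ r).map specU
  rwa [specU, quadHom_gen] at this

lemma qU_ne_one : qU ≠ 1 := by
  intro h
  have : (RatFunc.X : RatFunc ℚ)⁻¹ = 0 := by
    rw [qU] at h
    linear_combination -h
  exact RatFunc.X_ne_zero (inv_eq_zero.1 this)

lemma one_sub_s_ne_zero : 1 - ((RatFunc.X : RatFunc ℚ) - 1) ≠ 0 := by
  intro h
  apply ratFunc_X_ne_C 2
  rw [map_ofNat]
  linear_combination -h

lemma one_add_s_ne_zero : 1 + ((RatFunc.X : RatFunc ℚ) - 1) ≠ 0 := by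
  rw [← X_eq_one_add]; exact RatFunc.X_ne_zero

lemma specU_quadSol_one (D : ℕ) : specU ((quadSol 1).1 D) =
    horner (quadOne (RatFunc.X - 1)) (D : RatFunc ℚ) := by
  have h1 := one_sub_s_ne_zero
  have h2 := one_add_s_ne_zero
  refine quadStep_eq isUnit_qU.ne_zero qU_ne_one ((quadSol 1).2.map specU)
    (specU_quadSol_succ 0) (fun D => ?_) ?_ D
  · simp only [quadSol_zero, map_one, quadOne, qU_eq, horner, List.foldr]
    generalize (RatFunc.X : RatFunc ℚ) - 1 = s at h1 h2 ⊢
    field_simp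
    ring
  · simp only [quadOne, qU_eq, horner, List.foldr]
    generalize (RatFunc.X : RatFunc ℚ) - 1 = s at h1 h2 ⊢
    field_simp
    ring

lemma specU_quadSol_two (D : ℕ) : specU ((quadSol 2).1 D) =
    horner (quadTwo (RatFunc.X - 1)) (D : RatFunc ℚ) := by
  have h1 := one_sub_s_ne_zero
  have h2 := one_add_s_ne_zero
  refine quadStep_eq isUnit_qU.ne_zero qU_ne_one ((quadSol 2).2.map specU)
    (specU_quadSol_succ 1) (fun D => ?_) ?_ D
  · simp only [specU_quadSol_one, quadOne, quadTwo, qU_eq, horner, List.foldr]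
    generalize (RatFunc.X : RatFunc ℚ) - 1 = s at h1 h2 ⊢
    push_cast
    field_simp
    ring
  · simp only [quadTwo, qU_eq, horner, List.foldr]
    generalize (RatFunc.X : RatFunc ℚ) - 1 = s at h1 h2 ⊢
    field_simp
    ring

lemma specU_quadSol_three (D : ℕ) : specU ((quadSol 3).1 D) =
    horner (quadThree (RatFunc.X - 1)) (D : RatFunc ℚ) := by
  have h1 := one_sub_s_ne_zero
  have h2 := one_add_s_ne_zero
  refine quadStep_eq isUnit_qU.ne_zero qU_ne_one ((quadSol 3).2.map specU)
    (specU_quadSol_succ 2) (fun D => ?_) ?_ D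
  · simp only [specU_quadSol_two, quadTwo, quadThree, qU_eq, horner, List.foldr]
    generalize (RatFunc.X : RatFunc ℚ) - 1 = s at h1 h2 ⊢
    push_cast
    field_simp
    ring
  · simp only [quadThree, qU_eq, horner, List.foldr]
    generalize (RatFunc.X : RatFunc ℚ) - 1 = s at h1 h2 ⊢
    field_simp
    ring

end ExplicitQuad

/-! ### Assembling the three explicit rational functions. -/

section Shape

lemma coeff_serU_zero : PowerSeries.coeff 0 serU = 1 + (RatFunc.X - 1) := by
  rw [serU, PowerSeries.coeff_mk, quadSol_zero, map_one]
  ring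

lemma coeff_serU_one {s : RatFunc ℚ} (hs : RatFunc.X - 1 = s) :
    PowerSeries.coeff 1 serU = s ^ 3 / (1 - s) ^ 2 := by
  have h1 := one_sub_s_ne_zero
  have h2 := one_add_s_ne_zero
  rw [serU, PowerSeries.coeff_mk, specU_quadSol_one, Nat.cast_zero]
  simp only [quadOne, horner, List.foldr, hs, zero_mul, add_zero] at h1 h2 ⊢
  rw [show (RatFunc.X : RatFunc ℚ) = 1 + s by rw [← hs]; ring]
  field_simp

lemma coeff_serU_two {s : RatFunc ℚ} (hs : RatFunc.X - 1 = s) :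
    PowerSeries.coeff 2 serU =
      (2 * s ^ 4 + 2 * s ^ 5 + 2 * s ^ 6 - s ^ 7) / ((1 - s) ^ 5 * (1 + s)) := by
  have h1 := one_sub_s_ne_zero
  have h2 := one_add_s_ne_zero
  rw [serU, PowerSeries.coeff_mk, specU_quadSol_two, Nat.cast_zero]
  simp only [quadTwo, horner, List.foldr, hs, zero_mul, add_zero] at h1 h2 ⊢
  rw [show (RatFunc.X : RatFunc ℚ) = 1 + s by rw [← hs]; ring]
  field_simp

lemma coeff_serU_three {s : RatFunc ℚ} (hs : RatFunc.X - 1 = s) :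
    PowerSeries.coeff 3 serU =
      (6 * s ^ 5 + 16 * s ^ 6 + 27 * s ^ 7 + 12 * s ^ 8 + 2 * s ^ 9 - 4 * s ^ 10 + s ^ 11) /
      ((1 - s) ^ 8 * (1 + s) ^ 2) := by
  have h1 := one_sub_s_ne_zero
  have h2 := one_add_s_ne_zero
  rw [serU, PowerSeries.coeff_mk, specU_quadSol_three, Nat.cast_zero]
  simp only [quadThree, horner, List.foldr, hs, zero_mul, add_zero] at h1 h2 ⊢
  rw [show (RatFunc.X : RatFunc ℚ) = 1 + s by rw [← hs]; ring]
  field_simp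

lemma coeff_genRat (k : ℕ) : genRat k =
    (∑ i ∈ range (k + 1), (∑ j ∈ range (i + 1), tToU (PowerSeries.coeff j ratPhiConst) *
      tToU (PowerSeries.coeff (i - j) ratPhiConst)) * PowerSeries.coeff (k - i) serU +
      tToU (PowerSeries.coeff k ratPart)) / tU ^ k := by
  rw [genRat, map_add, PowerSeries.coeff_map, PowerSeries.coeff_mul,
    Finset.Nat.sum_antidiagonal_eq_sum_range_succ_mk]
  simp only [pow_two, PowerSeries.coeff_mul, Finset.Nat.sum_antidiagonal_eq_sum_range_succ_mk,
    PowerSeries.coeff_map]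

lemma s_ne_zero : (RatFunc.X : RatFunc ℚ) - 1 ≠ 0 := by
  rw [sub_ne_zero, ← map_one RatFunc.C]; exact ratFunc_X_ne_C 1

/-- This is u² - u + 1, the numerator of 1 - t in terms of u; it brings one of the two denominator
factors of `shape`. The other, u - 2, is the numerator of 2q - 1. -/
lemma quadratic_ne_zero : 1 + ((RatFunc.X : RatFunc ℚ) - 1) + (RatFunc.X - 1) ^ 2 ≠ 0 := by
  intro h
  have h1 : algebraMap (Polynomial ℚ) (RatFunc ℚ) (Polynomial.X ^ 2 - Polynomial.X + 1) =
      algebraMap (Polynomial ℚ) (RatFunc ℚ) 0 := by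
    simp only [map_add, map_sub, map_pow, map_one, map_zero, RatFunc.algebraMap_X]
    linear_combination h
  have h2 := congrArg (Polynomial.eval 0) (RatFunc.algebraMap_injective ℚ h1)
  simp at h2

lemma genRat_one : genRat 1 = shape 1 P1 := by
  have h0 := s_ne_zero
  have h1 := one_sub_s_ne_zero
  have h2 := one_add_s_ne_zero
  have h3 := quadratic_ne_zero
  rw [coeff_genRat]
  simp only [sum_range_succ, sum_range_zero, Nat.reduceAdd, Nat.reduceSub, Nat.reduceMul,
    coeff_ratPhiConst_zero, coeff_ratPhiConst_one,
    coeff_one_ratPart, shape, P1, coeff_serU_zero,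
    coeff_serU_one rfl,
    map_add, map_sub, map_mul, map_div₀, map_neg, map_pow, map_one, map_ofNat, tToU_X,
    RatFunc.algebraMap_X, tU_eq]
  have e1 : (RatFunc.X : RatFunc ℚ) ^ 2 + 1 - RatFunc.X =
      1 + (RatFunc.X - 1) + (RatFunc.X - 1) ^ 2 := by ring
  have e2 : (RatFunc.X : RatFunc ℚ) - 2 = -(1 - (RatFunc.X - 1)) := by ring
  rw [e1, e2]
  generalize (RatFunc.X : RatFunc ℚ) - 1 = s at h0 h1 h2 h3 ⊢
  have e3 : 1 - s / (1 + s) ^ 2 = (1 + s + s ^ 2) / (1 + s) ^ 2 := by field_simp; ring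
  rw [e3]
  field_simp
  ring

lemma genRat_two : genRat 2 = shape 2 P2 := by
  have h0 := s_ne_zero
  have h1 := one_sub_s_ne_zero
  have h2 := one_add_s_ne_zero
  have h3 := quadratic_ne_zero
  rw [coeff_genRat]
  simp only [sum_range_succ, sum_range_zero, Nat.reduceAdd, Nat.reduceSub, Nat.reduceMul,
    coeff_ratPhiConst_zero, coeff_ratPhiConst_one, coeff_ratPhiConst_two,
    coeff_two_ratPart, shape, P2, coeff_serU_zero,
    coeff_serU_one rfl, coeff_serU_two rfl,
    map_add, map_sub, map_mul, map_div₀, map_neg, map_pow, map_one, map_ofNat, tToU_X,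
    RatFunc.algebraMap_X, tU_eq]
  have e1 : (RatFunc.X : RatFunc ℚ) ^ 2 + 1 - RatFunc.X =
      1 + (RatFunc.X - 1) + (RatFunc.X - 1) ^ 2 := by ring
  have e2 : (RatFunc.X : RatFunc ℚ) - 2 = -(1 - (RatFunc.X - 1)) := by ring
  rw [e1, e2]
  generalize (RatFunc.X : RatFunc ℚ) - 1 = s at h0 h1 h2 h3 ⊢
  have e3 : 1 - s / (1 + s) ^ 2 = (1 + s + s ^ 2) / (1 + s) ^ 2 := by field_simp; ring
  rw [e3]
  field_simp
  ring

lemma genRat_three : genRat 3 = shape 3 P3 := by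
  have h0 := s_ne_zero
  have h1 := one_sub_s_ne_zero
  have h2 := one_add_s_ne_zero
  have h3 := quadratic_ne_zero
  rw [coeff_genRat]
  simp only [sum_range_succ, sum_range_zero, Nat.reduceAdd, Nat.reduceSub, Nat.reduceMul,
    coeff_ratPhiConst_zero, coeff_ratPhiConst_one, coeff_ratPhiConst_two, coeff_ratPhiConst_three,
    coeff_three_ratPart, shape, P3, coeff_serU_zero,
    coeff_serU_one rfl, coeff_serU_two rfl, coeff_serU_three rfl,
    map_add, map_sub, map_mul, map_div₀, map_neg, map_pow, map_one, map_ofNat, tToU_X,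
    RatFunc.algebraMap_X, tU_eq]
  have e1 : (RatFunc.X : RatFunc ℚ) ^ 2 + 1 - RatFunc.X =
      1 + (RatFunc.X - 1) + (RatFunc.X - 1) ^ 2 := by ring
  have e2 : (RatFunc.X : RatFunc ℚ) - 2 = -(1 - (RatFunc.X - 1)) := by ring
  rw [e1, e2]
  generalize (RatFunc.X : RatFunc ℚ) - 1 = s at h0 h1 h2 h3 ⊢
  have e3 : 1 - s / (1 + s) ^ 2 = (1 + s + s ^ 2) / (1 + s) ^ 2 := by field_simp; ring
  rw [e3]
  field_simp
  ring

end Shape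

end AlmostSquare

theorem theorem2p2 :
    ∃ R : ℕ → RatFunc ℚ,
      (∀ k : ℕ,
        AlmostSquare.IsAlgebraicOfDegree (AlmostSquare.genFun k) 2 ∧
          AlmostSquare.IsRationalIn (AlmostSquare.genFun k) (R k) AlmostSquare.catalanGF) ∧
      R 1 = AlmostSquare.shape 1 AlmostSquare.P1 ∧
      R 2 = AlmostSquare.shape 2 AlmostSquare.P2 ∧
      R 3 = AlmostSquare.shape 3 AlmostSquare.P3 :=
  ⟨AlmostSquare.genRat, fun k => ⟨AlmostSquare.isAlgebraicOfDegree_genFun k,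
    AlmostSquare.isRationalIn_genFun k⟩, AlmostSquare.genRat_one, AlmostSquare.genRat_two,
    AlmostSquare.genRat_three⟩
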